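/- **Theorem.** Let $\Omega\subset\mathbb R^n$ be open, $1<p<\infty$, and let $Q(x)$, $x\in\Omega$, be symmetric nonnegative semidefinite $n\times n$ matrices, $Q(x,\xi)=\langle Q(x)\xi,\xi\rangle=|\sqrt{Q(x)}\,\xi|^2$, with $|Q|\in L^{p/2}_{loc}(\Omega)$. For $1<q<\infty$ write $q'=q/(q-1)$. For measurable $E\subset\Omega$ write $\|f\|_{\alpha,E;\overline{dx}}=\big(\frac1{|E|}\int_E|f|^\alpha dx\big)^{1/\alpha}$ (the essential supremum of $|f|$ over $E$ if $\alpha=\infty$). Let $Lip_0(S)$ be the class of Lipschitz functions with compact support contained in $S$. *Sobolev spaces.* Put $\|f\|_{W^{1,p}_Q(\Omega)}=\big(\int_\Omega|\sqrt Q\nabla f|^p dx+\int_\Omega|f|^pdx\big)^{1/p}$. The space $W^{1,p}_Q(\Omega)$ consists of all pairs $(w,\nabla w)$ of measurable functions, with values in $\mathbb R$ and $\mathbb R^n$, for which there are $w_i\in Lip_{loc}(\Omega)$ of finite norm with $w_i\to w$ in $L^p(\Omega)$ and $\int_\Omega|\sqrt Q(\nabla w_i-\nabla w)|^pdx\to0$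 ($\nabla w$ denotes the second member of the pair; it need not be determined by $w$). $(W^{1,p}_Q)_0(S)$ is defined in the same way on $S$, with $w_i\in Lip_0(S)$. *Quasimetric.* Let $\rho:\Omega\times\Omega\to[0,\infty)$ be symmetric with $\rho(x,y)=0\iff x=y$ and $\rho(x,y)\le\kappa[\rho(x,z)+\rho(y,z)]$ for some $\kappa\ge1$. Put $B(x,r)=\{y\in\Omega:\rho(x,y)<r\}$, and assume that these sets are Lebesgue measurable for $x\in\Omega$, $r>0$. Assume that for every $x\in\Omega$, $|x-y|\to0$ as $\rho(x,y)\to0$. Let $r_1:\Omega\to(0,\infty)$ be such that $\overline{B(y,r)}$ is a compact subset of $\Omega$ whenever $y\in\Omega$, $0<r<r_1(y)$. *Sobolev estimate.* Assume that there are $\sigma>1$ and $C_S>0$ such that for all $B_r=B(y,r)$ with $y\in\Omega$, $0<r<r_1(y)$, and all $(w,\nabla w)\in(W^{1,p}_Q)_0(B_r)$, $$\|w\|_{p\sigma,B_r;\overline{dx}}\le C_S\big[r\,\|\sqrt Q\nabla w\|_{p,B_r;\overline{dx}}+\|w\|_{p,B_r;\overline{dx}}\big].$$ *Cutoff functions.*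 Assume that there are $\tau\in(0,1)$, $s^*\in(p\sigma',\infty]$ and $N,C_{s^*}>0$ such that every ball $B(y,r)$ with $y\in\Omega$, $0<r<r_1(y)$, has a sequence of Lipschitz functions $(\eta_j)_{j\ge1}$ with $\operatorname{supp}\eta_1\subset B(y,r)$ and, for all $j\ge1$, $0\le\eta_j\le1$, $\eta_j=1$ on $B(y,\tau r)$, $\operatorname{supp}\eta_{j+1}\subset\{x\in B(y,r):\eta_j(x)=1\}$ and $\|\sqrt Q\nabla\eta_j\|_{s^*,B(y,r);\overline{dx}}\le C_{s^*}N^j/r$. Write $s^*=s'p$ with $\sigma'<s'\le\infty$, and let $s$ satisfy $1/s+1/s'=1$, so $1\le s<\sigma$. *Qualitative conditions.* Assume that there are $t,t'\in[1,\infty]$ with $1/t+1/t'=1$ such that for all balls $B(y,r)$ with $y\in\Omega$, $0<r<r_1(y)$: $\sqrt Q\nabla\eta_j\in L^{tp}(B(y,r))$ for each of the functions $\eta_j$, $j\ge1$, belonging to $B(y,r)$; and there is a constant $c_2=c_2(B(y,r))$ with $\|f\|_{L^{pt'}(B(y,r))}\le c_2\|f\|_{W^{1,p}_Q(\Omega)}$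 for all $f\in Lip_{loc}(\Omega)$. *Equation.* Let $a>1$ and $\psi\in[p,p+1-\sigma^{-1})$. Let $A:\Omega\times\mathbb R\times\mathbb R^n\to\mathbb R^n$ and $B:\Omega\times\mathbb R\times\mathbb R^n\to\mathbb R$, and let $b,c,d,e,f,g,h$ be nonnegative measurable functions on $\Omega$ with $$b\in L_{loc}^{p'\sigma'}(\Omega),\quad c\in L_{loc}^{\frac{\sigma p}{\sigma p-1-\sigma(\psi-1)}}(\Omega),\quad d\in L^{\sigma'}_{loc}(\Omega),\quad e\in L^{p'}_{loc}(\Omega),\quad f\in L^{(\sigma p)'}_{loc}(\Omega).$$ Assume that there is a vector $\tilde A(x,z,\xi)\in\mathbb R^n$ such that for a.e. $x\in\Omega$ and all $(z,\xi)\in\mathbb R\times\mathbb R^n$, $$\begin{aligned}&A(x,z,\xi)=\sqrt{Q(x)}\,\tilde A(x,z,\xi),\\ &\xi\cdot A(x,z,\xi)\ge a^{-1}|\sqrt{Q(x)}\,\xi|^p-h|z|^p-g,\\ &|\tilde A(x,z,\xi)|\le a|\sqrt{Q(x)}\,\xi|^{p-1}+b|z|^{p-1}+e,\\ &|B(x,z,\xi)|\le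 c|\sqrt{Q(x)}\,\xi|^{\psi-1}+d|z|^{p-1}+f.\end{aligned}$$ Let $(u,\nabla u)\in W^{1,p}_Q(\Omega)$ be a weak solution of $\operatorname{div}A(x,u,\nabla u)=B(x,u,\nabla u)$ in $\Omega$, that is, $\int_\Omega[\nabla\varphi\cdot A(x,u,\nabla u)+\varphi B(x,u,\nabla u)]\,dx=0$ for all $\varphi\in Lip_0(\Omega)$, the integrals being convergent. *Conclusion.* Let $\epsilon_1,\epsilon_2,\epsilon_3\in(0,1]$. For $k>0$, $y\in\Omega$ and $0<r<\tau r_1(y)$ put $\bar u=|u|+k$, $\bar b=b+k^{1-p}e$, $\bar h=h+k^{-p}g$, $\bar d=d+k^{1-p}f$, and, with all norms taken over $B(y,r)$, $$\begin{aligned}\bar Z=1&+r^{p-1}\|\bar b\|_{p'\sigma';\overline{dx}}+\Big(r^p\big\|c^{\frac p{p+1-\psi}}\bar u^{\frac{p(\psi-p)}{p+1-\psi}}\big\|_{\frac{p\sigma'}{p-\epsilon_1};\overline{dx}}\Big)^{1/\epsilon_1}\\&+\Big(r^p\|\bar h\|_{\frac{p\sigma'}{p-\epsilon_2};\overline{dx}}\Big)^{1/\epsilon_2}+\Big(r^p\|\bar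 d\|_{\frac{p\sigma'}{p-\epsilon_3};\overline{dx}}\Big)^{1/\epsilon_3}\in[1,\infty].\end{aligned}$$ Then $$\|\bar u\|_{L^\infty(B(y,\tau r))}\le C\,\bar Z^{\Psi_0}\,\|\bar u\|_{sp,B(y,r);\overline{dx}},\qquad \Psi_0=\sum_{j=0}^\infty\Big(\frac s\sigma\Big)^j=\frac{\sigma}{\sigma-s},$$ where $C>0$ is a constant independent of $u$, $k$, $B(y,r)$, of $A$, $B$ and $b,c,d,e,f,g,h$, and of $t$, $t'$ and the constants in the qualitative conditions (it may depend on $\Omega,\rho,r_1,Q,p,\sigma$, the cutoff functions, $a,\psi,\epsilon_1,\epsilon_2,\epsilon_3$). -/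

import Mathlib

open MeasureTheory Set Filter Topology
open scoped ENNReal NNReal

namespace DegQuasilinear

/-- Euclidean space of dimension `n`, with its Euclidean norm and Lebesgue measure. -/
abbrev Rn (n : ℕ) : Type := EuclideanSpace ℝ (Fin n)

open scoped MatrixOrder in
/-- The nonnegative square root of a nonnegative semidefinite matrix, acting on `Rn n`. -/
noncomputable def sqrtQ {n : ℕ} (M : Matrix (Fin n) (Fin n) ℝ) : Rn n →L[ℝ] Rn n :=
  Matrix.toEuclideanCLM (𝕜 := ℝ) (CFC.sqrt M)

open scoped MatrixOrder in
/-- `|√M ξ|² = ⟨M ξ, ξ⟩`, so `|√Q(x) ξ|` is the square root of the quadratic form `Q(x, ξ)`. -/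
theorem norm_sqrtQ_sq {n : ℕ} {M : Matrix (Fin n) (Fin n) ℝ} (hM : M.PosSemidef) (ξ : Rn n) :
    ‖sqrtQ M ξ‖ ^ 2 = inner ℝ (Matrix.toEuclideanCLM (𝕜 := ℝ) M ξ) ξ := by
  have hsa : star (CFC.sqrt M) = CFC.sqrt M :=
    (CFC.sqrt_nonneg M).isSelfAdjoint.star_eq
  have hadj : ContinuousLinearMap.adjoint (sqrtQ M) = sqrtQ M := by
    rw [← ContinuousLinearMap.star_eq_adjoint, sqrtQ, ← map_star, hsa]
  have hmul : Matrix.toEuclideanCLM (𝕜 := ℝ) M = sqrtQ M * sqrtQ M := by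
    rw [sqrtQ, ← map_mul, CFC.sqrt_mul_sqrt_self M hM.nonneg]
  rw [hmul, ← real_inner_self_eq_norm_sq, mul_apply_eq_comp]
  conv_rhs => rw [← ContinuousLinearMap.adjoint_inner_right, hadj]

/-- `L^q(S)` norm with respect to Lebesgue measure normalized by `|S|`:
`(|S|⁻¹ ∫_S |f|^q)^(1/q)` for finite `q > 0`, and the essential supremum over `S` for `q = ∞`. -/
noncomputable def avgNorm {n : ℕ} {F : Type*} [NormedAddCommGroup F]
    (f : Rn n → F) (q : ℝ≥0∞) (S : Set (Rn n)) : ℝ≥0∞ :=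
  eLpNorm f q ((volume S)⁻¹ • volume.restrict S)

/-- `f ∈ L^q_loc(Ω)`. -/
def LocLp {n : ℕ} {F : Type*} [NormedAddCommGroup F]
    (f : Rn n → F) (q : ℝ≥0∞) (Ω : Set (Rn n)) : Prop :=
  ∀ K : Set (Rn n), IsCompact K → K ⊆ Ω → MemLp f q (volume.restrict K)

/-- A symmetric quasimetric on `Ω` with constant `κ`. -/
structure IsQuasimetric {n : ℕ} (Ω : Set (Rn n)) (ρ : Rn n → Rn n → ℝ) (κ : ℝ) : Prop where
  one_le : 1 ≤ κ
  nonneg : ∀ x ∈ Ω, ∀ y ∈ Ω, 0 ≤ ρ x y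
  eq_zero_iff : ∀ x ∈ Ω, ∀ y ∈ Ω, ρ x y = 0 ↔ x = y
  symm : ∀ x ∈ Ω, ∀ y ∈ Ω, ρ x y = ρ y x
  triangle : ∀ x ∈ Ω, ∀ y ∈ Ω, ∀ z ∈ Ω, ρ x y ≤ κ * (ρ x z + ρ y z)

/-- The quasimetric ball `{y ∈ Ω : ρ(x, y) < r}`. -/
def qball {n : ℕ} (Ω : Set (Rn n)) (ρ : Rn n → Rn n → ℝ) (x : Rn n) (r : ℝ) : Set (Rn n) :=
  {y | y ∈ Ω ∧ ρ x y < r}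

/-- For every `x ∈ Ω`, `|x - y| → 0` as `ρ(x, y) → 0`. -/
def QuasiDominatesEuclid {n : ℕ} (Ω : Set (Rn n)) (ρ : Rn n → Rn n → ℝ) : Prop :=
  ∀ x ∈ Ω, ∀ ε > 0, ∃ δ > 0, ∀ y ∈ Ω, ρ x y < δ → dist x y < ε

/-- Lipschitz functions with compact support contained in `S` (extended by zero to `Rn n`). -/
def Lip0 {n : ℕ} (S : Set (Rn n)) (φ : Rn n → ℝ) : Prop :=
  (∃ K : ℝ≥0, LipschitzWith K φ) ∧ HasCompactSupport φ ∧ tsupport φ ⊆ S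

/-- `(∫_Ω |f|^p + ∫_Ω |√Q ∇f|^p)^(1/p)`; the gradient is the almost everywhere defined classical
gradient of a locally Lipschitz function. -/
noncomputable def wNorm {n : ℕ} (Ω : Set (Rn n)) (Q : Rn n → Matrix (Fin n) (Fin n) ℝ) (p : ℝ)
    (f : Rn n → ℝ) : ℝ≥0∞ :=
  (eLpNorm (fun x => sqrtQ (Q x) (gradient f x)) (ENNReal.ofReal p) (volume.restrict Ω) ^ p
    + eLpNorm f (ENNReal.ofReal p) (volume.restrict Ω) ^ p) ^ (1 / p)

/-- The pair `(w, v)` is the limit in `L^p(S) × 𝓛^p(S, Q)` of pairs `(f i, ∇ f i)`. -/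
def PairLimit {n : ℕ} (S : Set (Rn n)) (Q : Rn n → Matrix (Fin n) (Fin n) ℝ) (p : ℝ)
    (f : ℕ → Rn n → ℝ) (w : Rn n → ℝ) (v : Rn n → Rn n) : Prop :=
  AEMeasurable w (volume.restrict S) ∧ AEMeasurable v (volume.restrict S) ∧
  Tendsto (fun i => eLpNorm (fun x => f i x - w x) (ENNReal.ofReal p) (volume.restrict S))
    atTop (𝓝 0) ∧
  Tendsto (fun i => eLpNorm (fun x => sqrtQ (Q x) (gradient (f i) x - v x)) (ENNReal.ofReal p)
    (volume.restrict S)) atTop (𝓝 0)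

/-- `(w, v)` belongs to the degenerate Sobolev space `W^{1,p}_Q(Ω)`: it is the limit pair of a
sequence of locally Lipschitz functions on `Ω` with finite norm. -/
def MemW {n : ℕ} (Ω : Set (Rn n)) (Q : Rn n → Matrix (Fin n) (Fin n) ℝ) (p : ℝ)
    (w : Rn n → ℝ) (v : Rn n → Rn n) : Prop :=
  ∃ f : ℕ → Rn n → ℝ,
    (∀ i, LocallyLipschitzOn Ω (f i) ∧ wNorm Ω Q p (f i) < ∞) ∧ PairLimit Ω Q p f w v

/-- `(w, v)` belongs to `(W^{1,p}_Q)_0(S)`: it is the limit pair of a sequence of Lipschitz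
functions with compact support in `S`. -/
def MemW0 {n : ℕ} (S : Set (Rn n)) (Q : Rn n → Matrix (Fin n) (Fin n) ℝ) (p : ℝ)
    (w : Rn n → ℝ) (v : Rn n → Rn n) : Prop :=
  ∃ f : ℕ → Rn n → ℝ,
    (∀ i, Lip0 S (f i) ∧ wNorm S Q p (f i) < ∞) ∧ PairLimit S Q p f w v

/-- The Sobolev estimate with gain `σ` and constant `C` on all balls `B(y, r)`, `0 < r < r₁ y`. -/
def SobolevEstimate {n : ℕ} (Ω : Set (Rn n)) (ρ : Rn n → Rn n → ℝ) (r₁ : Rn n → ℝ)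
    (Q : Rn n → Matrix (Fin n) (Fin n) ℝ) (p σ C : ℝ) : Prop :=
  ∀ y ∈ Ω, ∀ r : ℝ, 0 < r → r < r₁ y → ∀ (w : Rn n → ℝ) (v : Rn n → Rn n),
    MemW0 (qball Ω ρ y r) Q p w v →
      avgNorm w (ENNReal.ofReal (p * σ)) (qball Ω ρ y r) ≤
        ENNReal.ofReal C *
          (ENNReal.ofReal r *
              avgNorm (fun x => sqrtQ (Q x) (v x)) (ENNReal.ofReal p) (qball Ω ρ y r)
            + avgNorm w (ENNReal.ofReal p) (qball Ω ρ y r))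

/-- `η 1, η 2, …` is an accumulating sequence of Lipschitz cutoff functions for the ball
`B(y, r)`; the value `η 0` plays no role. -/
structure IsCutoffSeq {n : ℕ} (Ω : Set (Rn n)) (ρ : Rn n → Rn n → ℝ)
    (Q : Rn n → Matrix (Fin n) (Fin n) ℝ) (τ : ℝ) (sStar : ℝ≥0∞) (N C : ℝ)
    (y : Rn n) (r : ℝ) (η : ℕ → Rn n → ℝ) : Prop where
  lipschitz : ∀ j, 1 ≤ j → ∃ K : ℝ≥0, LipschitzWith K (η j)
  supp_one : tsupport (η 1) ⊆ qball Ω ρ y r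
  range : ∀ j, 1 ≤ j → ∀ x, 0 ≤ η j x ∧ η j x ≤ 1
  eq_one : ∀ j, 1 ≤ j → qball Ω ρ y (τ * r) ⊆ {x | x ∈ qball Ω ρ y r ∧ η j x = 1}
  supp_succ : ∀ j, 1 ≤ j → tsupport (η (j + 1)) ⊆ {x | x ∈ qball Ω ρ y r ∧ η j x = 1}
  grad_le : ∀ j, 1 ≤ j →
    avgNorm (fun x => sqrtQ (Q x) (gradient (η j) x)) sStar (qball Ω ρ y r) ≤
      ENNReal.ofReal (C * N ^ j / r)

/-- The structural conditions on `A` and `B` relative to `Q`. -/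
def StructuralConditions {n : ℕ} (Ω : Set (Rn n)) (Q : Rn n → Matrix (Fin n) (Fin n) ℝ)
    (p a γ ψ δ : ℝ) (b c d e f g h : Rn n → ℝ)
    (A : Rn n → ℝ → Rn n → Rn n) (B : Rn n → ℝ → Rn n → ℝ) : Prop :=
  ∃ A' : Rn n → ℝ → Rn n → Rn n, ∀ᵐ x ∂(volume.restrict Ω), ∀ (z : ℝ) (ξ : Rn n),
    A x z ξ = sqrtQ (Q x) (A' x z ξ) ∧
    a⁻¹ * ‖sqrtQ (Q x) ξ‖ ^ p - h x * |z| ^ γ - g x ≤ inner ℝ ξ (A x z ξ) ∧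
    ‖A' x z ξ‖ ≤ a * ‖sqrtQ (Q x) ξ‖ ^ (p - 1) + b x * |z| ^ (γ - 1) + e x ∧
    |B x z ξ| ≤ c x * ‖sqrtQ (Q x) ξ‖ ^ (ψ - 1) + d x * |z| ^ (δ - 1) + f x

/-- The structural coefficients are nonnegative and measurable on `Ω` and have the minimal local
integrability under which the weak formulation makes sense. -/
structure AdmissibleCoefficients {n : ℕ} (Ω : Set (Rn n)) (p σ γ ψ δ : ℝ)
    (b c d e f g h : Rn n → ℝ) : Prop where
  nonneg : ∀ x ∈ Ω, 0 ≤ b x ∧ 0 ≤ c x ∧ 0 ≤ d x ∧ 0 ≤ e x ∧ 0 ≤ f x ∧ 0 ≤ g x ∧ 0 ≤ h x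
  meas_b : AEMeasurable b (volume.restrict Ω)
  meas_c : AEMeasurable c (volume.restrict Ω)
  meas_d : AEMeasurable d (volume.restrict Ω)
  meas_e : AEMeasurable e (volume.restrict Ω)
  meas_f : AEMeasurable f (volume.restrict Ω)
  meas_g : AEMeasurable g (volume.restrict Ω)
  meas_h : AEMeasurable h (volume.restrict Ω)
  loc_b : LocLp b (ENNReal.ofReal (σ * p / (σ * (p - 1) - γ + 1))) Ω
  loc_c : LocLp c (ENNReal.ofReal (σ * p / (σ * p - 1 - σ * (ψ - 1)))) Ω
  loc_d : LocLp d (ENNReal.ofReal (p * σ / (p * σ - δ))) Ω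
  loc_e : LocLp e (ENNReal.ofReal (Real.conjExponent p)) Ω
  loc_f : LocLp f (ENNReal.ofReal (Real.conjExponent (σ * p))) Ω

/-- The pair `(u, v)`, with `v` in the role of `∇u`, satisfies
`∫_Ω [∇φ · A(x, u, ∇u) + φ B(x, u, ∇u)] dx = 0` for all Lipschitz `φ` with compact support in `Ω`,
the integral being convergent. -/
def WeakSolution {n : ℕ} (Ω : Set (Rn n)) (Q : Rn n → Matrix (Fin n) (Fin n) ℝ) (p : ℝ)
    (A : Rn n → ℝ → Rn n → Rn n) (B : Rn n → ℝ → Rn n → ℝ)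
    (u : Rn n → ℝ) (v : Rn n → Rn n) : Prop :=
  MemW Ω Q p u v ∧ ∀ φ : Rn n → ℝ, Lip0 Ω φ →
    IntegrableOn (fun x => inner ℝ (gradient φ x) (A x (u x) (v x)) + φ x * B x (u x) (v x)) Ω ∧
    ∫ x in Ω, (inner ℝ (gradient φ x) (A x (u x) (v x)) + φ x * B x (u x) (v x)) = 0

/-- The quantity `Z̄` on a ball `S` of radius `r`. -/
noncomputable def Zbar {n : ℕ} (S : Set (Rn n)) (r p σ ψ ε₁ ε₂ ε₃ k : ℝ)
    (u b c d e f g h : Rn n → ℝ) : ℝ≥0∞ :=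
  1 + ENNReal.ofReal (r ^ (p - 1)) *
        avgNorm (fun x => b x + k ^ (1 - p) * e x)
          (ENNReal.ofReal (Real.conjExponent p * Real.conjExponent σ)) S
    + (ENNReal.ofReal (r ^ p) *
        avgNorm (fun x => c x ^ (p / (p + 1 - ψ)) *
            (|u x| + k) ^ (p * (ψ - p) / (p + 1 - ψ)))
          (ENNReal.ofReal (p * Real.conjExponent σ / (p - ε₁))) S) ^ (1 / ε₁)
    + (ENNReal.ofReal (r ^ p) *
        avgNorm (fun x => h x + k ^ (-p) * g x)
          (ENNReal.ofReal (p * Real.conjExponent σ / (p - ε₂))) S) ^ (1 / ε₂)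
    + (ENNReal.ofReal (r ^ p) *
        avgNorm (fun x => d x + k ^ (1 - p) * f x)
          (ENNReal.ofReal (p * Real.conjExponent σ / (p - ε₃))) S) ^ (1 / ε₃)

end DegQuasilinear

/-! The proof is a Moser iteration. Put `ω = √(u² + k²)`. It satisfies `k ≤ ω ≤ |u| + k ≤ 2 ω`, so
the inhomogeneous terms `e, f, g` are absorbed into `b, d, h` with weights that are powers of `k`.
Let `T` be a bounded smooth truncation of `u² + k²` and `F = ω T ^ (l / 2)`. Testing the equation
with `η ^ p u T ^ (p l / 2)` bounds the energy of `η F` by the gradient of the cutoff `η` and by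
lower order integrals (`IsApprox.energy_estimate`, resting on `pointwise_energy`). The Sobolev
estimate then controls `x = ‖η F‖` in `L^{pσ}`.

A Hölder inequality with three factors bounds each lower order integral by a power of `Z̄`, a power
of `x` strictly below `p`, and a power of `Φ`, the `L^{sp}` norm of `F` on the support of `η`. Hence
`x` can be absorbed (`le_of_absorb`, `moser_step`). The powers `1 / εᵢ` in the definition of `Z̄`
are made so that `Z̄` comes out of the absorption with exponent exactly one: `x ≤ const · M Z̄ Φ`,
where `M` bounds the scaled gradient of the cutoff in `L^{s*}` and the constant grows like a power
of `1 + l`. Letting the truncation tend to the identity and taking the root of order `α = 1 + l`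
gives a reverse Hölder inequality from exponent `s p α` to `p σ α` (`IsApprox.reverse_holder`). As
`s < σ` this is a gain; with `α = (σ / s) ^ j` the exponents of `Z̄` form the geometric series with
sum `σ / (σ - s)` (`le_of_iterate`, `IsApprox.eLpNorm_top_le`).

Two points are special to the degenerate setting. A priori `u` lies only in `L^p`. The qualitative
conditions, used on the larger ball of radius `r / τ`, make the Sobolev estimate applicable to
cut-off Lipschitz approximants, so these converge to `u` in `L^{pσ}` on the ball of radius `r`; the
constants of this step do not enter the final bound. Moreover `∇u` is not determined by `u`, so the
chain rule is available only through approximation. For this reason every function of `u` is `C¹`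
with bounded derivative, and no truncation with corners is used. -/

namespace DegQuasilinear

/-! ### The matrix square root and measurability of the form. -/

section SquareRoot

variable {n : ℕ}

open scoped MatrixOrder in
theorem inner_sqrtQ_right (M : Matrix (Fin n) (Fin n) ℝ) (ξ ζ : Rn n) :
    inner ℝ ξ (sqrtQ M ζ) = inner ℝ (sqrtQ M ξ) ζ := by
  have hsa : star (CFC.sqrt M) = CFC.sqrt M :=
    (CFC.sqrt_nonneg M).isSelfAdjoint.star_eq
  have hadj : ContinuousLinearMap.adjoint (sqrtQ M) = sqrtQ M := by
    rw [← ContinuousLinearMap.star_eq_adjoint, sqrtQ, ← map_star, hsa]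
  rw [← ContinuousLinearMap.adjoint_inner_left, hadj]

theorem norm_sqrtQ_eq {M : Matrix (Fin n) (Fin n) ℝ} (hM : M.PosSemidef) (ξ : Rn n) :
    ‖sqrtQ M ξ‖ = √(inner ℝ (Matrix.toEuclideanCLM (𝕜 := ℝ) M ξ) ξ) := by
  rw [← norm_sqrtQ_sq hM, Real.sqrt_sq (norm_nonneg _)]

/-- The measure `μ` sees `x ↦ |√Q(x) v(x)|` as measurable for every measurable field `v`. -/
def MeasurableForm (Q : Rn n → Matrix (Fin n) (Fin n) ℝ) (μ : Measure (Rn n)) : Prop :=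
  ∀ v : Rn n → Rn n, AEMeasurable v μ → AEMeasurable (fun x => ‖sqrtQ (Q x) (v x)‖) μ

/-- Measurability of the matrix square root is avoided: `|√Q v|` is the root of the scalar `⟨Q v,
v⟩`, which is measurable as soon as `Q` and `v` are. -/
theorem measurableForm_of_aestronglyMeasurable {Q : Rn n → Matrix (Fin n) (Fin n) ℝ}
    {μ : Measure (Rn n)} (hQ : ∀ᵐ x ∂μ, (Q x).PosSemidef)
    (hm : AEStronglyMeasurable (fun x => Matrix.toEuclideanCLM (𝕜 := ℝ) (Q x)) μ) :
    MeasurableForm Q μ := by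
  intro v hv
  have h1 : AEStronglyMeasurable (fun x => Matrix.toEuclideanCLM (𝕜 := ℝ) (Q x) (v x)) μ :=
    (ContinuousLinearMap.id ℝ (Rn n →L[ℝ] Rn n)).aestronglyMeasurable_comp₂ hm
      hv.aestronglyMeasurable
  have h2 : AEMeasurable (fun x => √(inner ℝ (Matrix.toEuclideanCLM (𝕜 := ℝ) (Q x) (v x)) (v x)))
      μ := (h1.inner hv.aestronglyMeasurable).aemeasurable.sqrt
  refine h2.congr ?_
  filter_upwards [hQ] with x hx
  rw [norm_sqrtQ_eq hx]

theorem measurable_gradient (f : Rn n → ℝ) : Measurable (gradient f) :=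
  (InnerProductSpace.toDual ℝ (Rn n)).symm.continuous.measurable.comp (measurable_fderiv ℝ f)

end SquareRoot

/-! ### Calculus of locally Lipschitz functions. -/

section LocallyLipschitz

variable {n : ℕ}

/-- Rademacher's theorem on the interior of each Lipschitz neighbourhood; the exceptional sets may
be glued because a locally null set is null. -/
theorem ae_differentiableAt_of_locallyLipschitzOn {Ω : Set (Rn n)} (hΩ : IsOpen Ω)
    {f : Rn n → ℝ} (hf : LocallyLipschitzOn Ω f) :
    ∀ᵐ x ∂(volume.restrict Ω), DifferentiableAt ℝ f x := by
  rw [ae_restrict_iff' hΩ.measurableSet]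
  have : volume {x | x ∈ Ω ∧ ¬ DifferentiableAt ℝ f x} = 0 := by
    refine measure_null_of_locally_null _ fun x hx => ?_
    obtain ⟨K, t, ht, hK⟩ := hf hx.1
    rw [hΩ.nhdsWithin_eq hx.1] at ht
    refine ⟨{x | x ∈ Ω ∧ ¬ DifferentiableAt ℝ f x} ∩ interior t,
      inter_mem_nhdsWithin _ (interior_mem_nhds.2 ht), ?_⟩
    have h := (hK.mono interior_subset).ae_differentiableWithinAt_of_mem (μ := volume)
    refine measure_mono_null ?_ h
    rintro z ⟨hz, hzt⟩ hd
    exact hz.2 ((hd hzt).differentiableAt (isOpen_interior.mem_nhds hzt))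
  have h2 : ∀ᵐ x ∂(volume : Measure (Rn n)), ¬ (x ∈ Ω ∧ ¬ DifferentiableAt ℝ f x) :=
    measure_eq_zero_iff_ae_notMem.1 this
  filter_upwards [h2] with x hx hxΩ
  by_contra hd
  exact hx ⟨hxΩ, hd⟩

theorem aemeasurable_of_locallyLipschitzOn {Ω : Set (Rn n)} (hΩ : IsOpen Ω)
    {f : Rn n → ℝ} (hf : LocallyLipschitzOn Ω f) : AEMeasurable f (volume.restrict Ω) :=
  hf.continuousOn.aemeasurable hΩ.measurableSet

/-- The product of a compactly supported Lipschitz function with a Lipschitz function of a locally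
Lipschitz function is Lipschitz. -/
theorem Lip0.mul_comp {Ω S : Set (Rn n)} (hΩ : IsOpen Ω) (hS : S ⊆ Ω) {f ζ : Rn n → ℝ} {H : ℝ → ℝ}
    (hf : LocallyLipschitzOn Ω f) {L : ℝ≥0} (hH : LipschitzWith L H) (hζ : Lip0 S ζ) :
    Lip0 S (fun x => ζ x * H (f x)) := by
  obtain ⟨⟨Kζ, hKζ⟩, hcpt, hsupp⟩ := hζ
  refine ⟨?_, hcpt.mul_right, (tsupport_mul_subset_left (f := ζ)).trans hsupp⟩
  obtain ⟨δ, hδ, hsub⟩ := hcpt.isCompact.exists_cthickening_subset_open hΩ (hsupp.trans hS)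
  have hcK : IsCompact (Metric.cthickening δ (tsupport ζ)) := hcpt.isCompact.cthickening
  obtain ⟨Kf, hKf⟩ := (hf.mono hsub).exists_lipschitzOnWith_of_compact hcK
  have hHf : LipschitzOnWith (L * Kf) (fun x => H (f x)) (Metric.cthickening δ (tsupport ζ)) :=
    hH.comp_lipschitzOnWith hKf
  obtain ⟨M, hM⟩ := hcK.exists_bound_of_continuousOn hHf.continuousOn
  obtain ⟨Mζ, hMζ⟩ := hcpt.exists_bound_of_continuous hKζ.continuous
  have hMζ0 : 0 ≤ Mζ := (norm_nonneg _).trans (hMζ 0)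
  set M' := max M 0 with hM'
  have hM0 : 0 ≤ M' := le_max_right _ _
  have hMb : ∀ x ∈ Metric.cthickening δ (tsupport ζ), |H (f x)| ≤ M' := fun x hx =>
    (hM x hx).trans (le_max_left _ _)
  have hsmall : tsupport ζ ⊆ Metric.cthickening δ (tsupport ζ) := Metric.self_subset_cthickening _
  have hC1 : 0 ≤ Mζ * (L * Kf) + M' * Kζ := by positivity
  have hC2 : 0 ≤ Mζ * M' / δ := by positivity
  -- `f` is Lipschitz only near the support of `ζ`. For `y` in the `δ`-thickening the product rule
  -- applies. Beyond it `ζ y = 0` and `dist x y ≥ δ`, so the bounded value at `x` is at most `(Mζ M'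
  -- / δ) dist x y`.
  have key : ∀ x y, x ∈ tsupport ζ →
      |ζ x * H (f x) - ζ y * H (f y)| ≤
        (Mζ * (L * Kf) + M' * Kζ + Mζ * M' / δ) * dist x y := by
    intro x y hx
    by_cases hy : y ∈ Metric.cthickening δ (tsupport ζ)
    · have e : ζ x * H (f x) - ζ y * H (f y)
          = ζ x * (H (f x) - H (f y)) + H (f y) * (ζ x - ζ y) := by ring
      have h1 : |H (f x) - H (f y)| ≤ (L * Kf) * dist x y := by
        have := hHf.dist_le_mul x (hsmall hx) y hy
        rwa [Real.dist_eq] at this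
      have h2 : |ζ x - ζ y| ≤ Kζ * dist x y := by
        have := hKζ.dist_le_mul x y
        rwa [Real.dist_eq] at this
      have h3 : |ζ x| ≤ Mζ := hMζ x
      rw [e]
      calc _ ≤ |ζ x| * |H (f x) - H (f y)| + |H (f y)| * |ζ x - ζ y| := by
            rw [← abs_mul, ← abs_mul]; exact abs_add_le _ _
        _ ≤ Mζ * ((L * Kf) * dist x y) + M' * (Kζ * dist x y) := by
            gcongr
            exact hMb y hy
        _ ≤ _ := by nlinarith [mul_nonneg hC2 (dist_nonneg (x := x) (y := y))]
    · have hy0 : ζ y = 0 := image_eq_zero_of_notMem_tsupport fun h => hy (hsmall h)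
      have hd : δ ≤ dist x y := by
        by_contra! h
        exact hy (Metric.mem_cthickening_of_dist_le y x δ _ hx (by rw [dist_comm]; exact h.le))
      rw [hy0, zero_mul, sub_zero, abs_mul]
      calc _ ≤ Mζ * M' := mul_le_mul (hMζ x) (hMb x (hsmall hx)) (abs_nonneg _) hMζ0
        _ = Mζ * M' / δ * δ := by field_simp
        _ ≤ Mζ * M' / δ * dist x y := by gcongr
        _ ≤ _ := by nlinarith [mul_nonneg hC1 (dist_nonneg (x := x) (y := y))]
  refine ⟨(Mζ * (L * Kf) + M' * Kζ + Mζ * M' / δ).toNNReal, LipschitzWith.of_dist_le_mul ?_⟩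
  intro x y
  rw [Real.coe_toNNReal _ (by positivity), Real.dist_eq]
  by_cases hx : x ∈ tsupport ζ
  · exact key x y hx
  · by_cases hy : y ∈ tsupport ζ
    · rw [abs_sub_comm, dist_comm]
      exact key y x hy
    · rw [image_eq_zero_of_notMem_tsupport hx, image_eq_zero_of_notMem_tsupport hy]
      simp only [zero_mul, sub_self, abs_zero]
      positivity

theorem gradient_mul_comp {f ζ : Rn n → ℝ} {H : ℝ → ℝ} {H' : ℝ} {x : Rn n}
    (hζ : DifferentiableAt ℝ ζ x) (hf : DifferentiableAt ℝ f x) (hH : HasDerivAt H H' (f x)) :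
    gradient (fun x => ζ x * H (f x)) x =
      H (f x) • gradient ζ x + (ζ x * H') • gradient f x := by
  have h1 := (hζ.hasFDerivAt.mul (hH.comp_hasFDerivAt x hf.hasFDerivAt)).fderiv
  have h2 : fderiv ℝ (fun x => ζ x * H (f x)) x =
      ζ x • H' • fderiv ℝ f x + H (f x) • fderiv ℝ ζ x := h1
  rw [gradient, h2]
  simp only [map_add, map_smul, gradient, smul_smul]
  rw [add_comm]

theorem gradient_sub {f g : Rn n → ℝ} {x : Rn n}
    (hf : DifferentiableAt ℝ f x) (hg : DifferentiableAt ℝ g x) :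
    gradient (fun x => f x - g x) x = gradient f x - gradient g x := by
  rw [gradient, fderiv_fun_sub hf hg, map_sub]; rfl

theorem gradient_rpow {ζ : Rn n → ℝ} {p : ℝ} (hp : 1 ≤ p) {x : Rn n}
    (hζ : DifferentiableAt ℝ ζ x) :
    gradient (fun x => ζ x ^ p) x = (p * ζ x ^ (p - 1)) • gradient ζ x := by
  have h1 := ((Real.hasDerivAt_rpow_const (Or.inr hp)).comp_hasFDerivAt x hζ.hasFDerivAt).fderiv
  have h2 : fderiv ℝ (fun x => ζ x ^ p) x = (p * ζ x ^ (p - 1)) • fderiv ℝ ζ x := h1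
  rw [gradient, h2, map_smul]; rfl

theorem gradient_eq_zero_of_notMem_tsupport {f : Rn n → ℝ} {x : Rn n} (hx : x ∉ tsupport f) :
    gradient f x = 0 := by
  have : f =ᶠ[𝓝 x] fun _ => 0 := notMem_tsupport_iff_eventuallyEq.1 hx
  rw [this.gradient_eq, gradient_fun_const]

/-- The derivative of `t ^ p` is at most `p` on `[0, 1]`. The test function carries `η ^ p`, so that
powers of `η` match those of the solution in Young's inequality. -/
theorem Lip0.rpow {S : Set (Rn n)} {ζ : Rn n → ℝ} (hζ : Lip0 S ζ) (h01 : ∀ x, 0 ≤ ζ x ∧ ζ x ≤ 1)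
    {p : ℝ} (hp : 1 ≤ p) : Lip0 S (fun x => ζ x ^ p) := by
  obtain ⟨⟨K, hK⟩, hcpt, hsupp⟩ := hζ
  have hz : (0 : ℝ) ^ p = 0 := Real.zero_rpow (by linarith)
  refine ⟨?_, hcpt.comp_left (g := fun t : ℝ => t ^ p) hz,
    (tsupport_comp_subset (g := fun t : ℝ => t ^ p) hz ζ).trans hsupp⟩
  have hL : LipschitzOnWith p.toNNReal (fun t : ℝ => t ^ p) (Icc 0 1) := by
    refine (convex_Icc (0 : ℝ) 1).lipschitzOnWith_of_nnnorm_hasDerivWithin_le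
      (f' := fun t => p * t ^ (p - 1))
      (fun t ht => (Real.hasDerivAt_rpow_const (Or.inr hp)).hasDerivWithinAt) fun t ht => ?_
    rw [← NNReal.coe_le_coe, coe_nnnorm, Real.coe_toNNReal _ (by linarith), Real.norm_eq_abs,
      abs_of_nonneg (mul_nonneg (by linarith) (Real.rpow_nonneg ht.1 _))]
    have := Real.rpow_le_one ht.1 ht.2 (by linarith : 0 ≤ p - 1)
    nlinarith
  refine ⟨p.toNNReal * K, ?_⟩
  rw [← lipschitzOnWith_univ] at hK ⊢
  exact hL.comp hK fun x _ => h01 x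

end LocallyLipschitz

/-! ### Sobolev norms, higher integrability and approximation. -/

section SobolevNorms

variable {n : ℕ}

/-- An open set is a countable union of compact subsets, and local integrability contains
measurability on each of them. -/
theorem measurableForm_of_locLp {Ω : Set (Rn n)} (hΩ : IsOpen Ω)
    {Q : Rn n → Matrix (Fin n) (Fin n) ℝ} (hQ : ∀ x ∈ Ω, (Q x).PosSemidef) {q : ℝ≥0∞}
    (hQloc : LocLp (fun x => Matrix.toEuclideanCLM (𝕜 := ℝ) (Q x)) q Ω) :
    MeasurableForm Q (volume.restrict Ω) := by
  refine measurableForm_of_aestronglyMeasurable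
    ((ae_restrict_iff' hΩ.measurableSet).2 (ae_of_all _ hQ)) ?_
  obtain ⟨F, hF, hsub, hU, -⟩ := hΩ.exists_iUnion_isClosed
  have hU' : Ω = ⋃ i : ℕ × ℕ, F i.1 ∩ Metric.closedBall 0 i.2 := by
    ext x
    rw [← hU]
    simp only [mem_iUnion, mem_inter_iff, Prod.exists]
    constructor
    · rintro ⟨i, hi⟩
      obtain ⟨m, hm⟩ := exists_nat_ge ‖x‖
      exact ⟨i, m, hi, by simpa using hm⟩
    · rintro ⟨i, m, hi, -⟩
      exact ⟨i, hi⟩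
  rw [hU', aestronglyMeasurable_iUnion_iff]
  intro i
  exact (hQloc _ ((isCompact_closedBall _ _).inter_left (hF _))
    (inter_subset_left.trans (hsub _))).1

theorem MeasurableForm.mono {Q : Rn n → Matrix (Fin n) (Fin n) ℝ} {Ω S : Set (Rn n)}
    (hQ : MeasurableForm Q (volume.restrict Ω)) (hS : S ⊆ Ω) :
    ∀ v : Rn n → Rn n, AEMeasurable v (volume.restrict Ω) →
      AEMeasurable (fun x => ‖sqrtQ (Q x) (v x)‖) (volume.restrict S) :=
  fun v hv => (hQ v hv).mono_measure (Measure.restrict_mono hS le_rfl)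

theorem eLpNorm_sqrtQ_le_wNorm {Ω : Set (Rn n)} {Q : Rn n → Matrix (Fin n) (Fin n) ℝ} {p : ℝ}
    (hp : 0 < p) (f : Rn n → ℝ) :
    eLpNorm (fun x => sqrtQ (Q x) (gradient f x)) (ENNReal.ofReal p) (volume.restrict Ω) ≤
      wNorm Ω Q p f := by
  rw [wNorm, one_div, ENNReal.le_rpow_inv_iff hp]
  exact le_self_add

theorem eLpNorm_le_wNorm {Ω : Set (Rn n)} {Q : Rn n → Matrix (Fin n) (Fin n) ℝ} {p : ℝ}
    (hp : 0 < p) (f : Rn n → ℝ) :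
    eLpNorm f (ENNReal.ofReal p) (volume.restrict Ω) ≤ wNorm Ω Q p f := by
  rw [wNorm, one_div, ENNReal.le_rpow_inv_iff hp]
  exact le_add_self

theorem wNorm_le_add {Ω : Set (Rn n)} {Q : Rn n → Matrix (Fin n) (Fin n) ℝ} {p : ℝ}
    (hp : 1 ≤ p) (f : Rn n → ℝ) :
    wNorm Ω Q p f ≤
      eLpNorm (fun x => sqrtQ (Q x) (gradient f x)) (ENNReal.ofReal p) (volume.restrict Ω)
        + eLpNorm f (ENNReal.ofReal p) (volume.restrict Ω) :=
  ENNReal.rpow_add_rpow_le_add _ _ hp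

theorem avgNorm_eq {F : Type*} [NormedAddCommGroup F] {S : Set (Rn n)} (hS : volume S ≠ ∞)
    (f : Rn n → F) (q : ℝ≥0∞) :
    avgNorm f q S = ((volume S)⁻¹) ^ (1 / q).toReal * eLpNorm f q (volume.restrict S) := by
  rw [avgNorm, eLpNorm_smul_measure_of_ne_zero (ENNReal.inv_ne_zero.2 hS), smul_eq_mul]

/-- A locally Lipschitz function is, after multiplication with a cutoff function, controlled in
`L^{pσ}` by its Sobolev norm. -/
theorem eLpNorm_le_of_sobolev {Ω S S' : Set (Rn n)} (hΩ : IsOpen Ω) (hS : S ⊆ Ω)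
    (hS' : S' ⊆ S) (hvol : volume S ≠ ∞)
    {Q : Rn n → Matrix (Fin n) (Fin n) ℝ} (hQ : MeasurableForm Q (volume.restrict Ω))
    {p σ : ℝ} (hp : 1 < p) {C r : ℝ} (hm : NullMeasurableSet S' volume)
    (hSob : ∀ (w : Rn n → ℝ) (v : Rn n → Rn n), MemW0 S Q p w v →
      avgNorm w (ENNReal.ofReal (p * σ)) S ≤
        ENNReal.ofReal C * (ENNReal.ofReal r *
              avgNorm (fun x => sqrtQ (Q x) (v x)) (ENNReal.ofReal p) S
            + avgNorm w (ENNReal.ofReal p) S))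
    {ζ : Rn n → ℝ} (hζ : Lip0 S ζ) (h01 : ∀ x, 0 ≤ ζ x ∧ ζ x ≤ 1) (hone : ∀ x ∈ S', ζ x = 1)
    {t t' : ℝ≥0∞} (htt' : t⁻¹ + t'⁻¹ = 1)
    (ht : eLpNorm (fun x => sqrtQ (Q x) (gradient ζ x)) (t * ENNReal.ofReal p)
      (volume.restrict S) < ∞) {c₂ : ℝ}
    (ht' : ∀ f : Rn n → ℝ, LocallyLipschitzOn Ω f →
          eLpNorm f (ENNReal.ofReal p * t') (volume.restrict S) ≤
            ENNReal.ofReal c₂ * wNorm Ω Q p f) :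
    ∃ C' : ℝ≥0∞, C' ≠ ∞ ∧ ∀ f, LocallyLipschitzOn Ω f → wNorm Ω Q p f < ∞ →
      eLpNorm f (ENNReal.ofReal (p * σ)) (volume.restrict S') ≤ C' * wNorm Ω Q p f := by
  have hp0 : 0 < p := by linarith
  by_cases hv0 : volume S = 0
  · refine ⟨0, ENNReal.zero_ne_top, fun f _ _ => ?_⟩
    rw [Measure.restrict_eq_zero.2 (measure_mono_null hS' hv0)]
    simp
  set T := eLpNorm (fun x => sqrtQ (Q x) (gradient ζ x)) (t * ENNReal.ofReal p)
      (volume.restrict S) with hT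
  set P := ENNReal.ofReal p with hP
  have hP1 : 1 ≤ P := by rw [hP, ENNReal.one_le_ofReal]; exact hp.le
  set D1 := ENNReal.ofReal c₂ * T + 1 with hD1
  have hholder : ENNReal.HolderTriple (P * t') (t * P) P := by
    constructor
    have hP0 : P ≠ 0 := by positivity
    have hPt : P ≠ ∞ := ENNReal.ofReal_ne_top
    rw [ENNReal.mul_inv (Or.inl hP0) (Or.inl hPt), ENNReal.mul_inv (Or.inr hPt) (Or.inr hP0),
      mul_comm t⁻¹, ← mul_add, add_comm, htt', mul_one]
  -- In `∇(ζ f) = f ∇ζ + ζ ∇f` the first term is the reason for the qualitative conditions: `f` is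
  -- taken in `L^{pt'}` and `√Q ∇ζ` in `L^{tp}`.
  have hgrad : ∀ f, LocallyLipschitzOn Ω f →
      eLpNorm (fun x => sqrtQ (Q x) (gradient (fun x => ζ x * f x) x)) P (volume.restrict S) ≤
        D1 * wNorm Ω Q p f := by
    intro f hf
    have hmf := (aemeasurable_of_locallyLipschitzOn hΩ hf).mono_measure
      (Measure.restrict_mono hS le_rfl)
    have hmζ := hQ.mono hS _ (measurable_gradient ζ).aemeasurable
    have hmg := hQ.mono hS _ (measurable_gradient f).aemeasurable
    have hae : ∀ᵐ x ∂(volume.restrict S),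
        ‖sqrtQ (Q x) (gradient (fun x => ζ x * f x) x)‖ ≤
          |f x| * ‖sqrtQ (Q x) (gradient ζ x)‖ + ‖sqrtQ (Q x) (gradient f x)‖ := by
      obtain ⟨Kζ, hKζ⟩ := hζ.1
      filter_upwards [ae_restrict_of_ae hKζ.ae_differentiableAt,
        ae_restrict_of_ae_restrict_of_subset hS (ae_differentiableAt_of_locallyLipschitzOn hΩ hf)]
        with x hx1 hx2
      have hg := gradient_mul_comp hx1 hx2 (hasDerivAt_id' (f x))
      rw [mul_one] at hg
      rw [hg, map_add, map_smul, map_smul]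
      refine (norm_add_le _ _).trans ?_
      rw [norm_smul, norm_smul, Real.norm_eq_abs, Real.norm_eq_abs, abs_of_nonneg (h01 x).1]
      gcongr
      exact mul_le_of_le_one_left (norm_nonneg _) (h01 x).2
    calc _ ≤ eLpNorm (fun x => |f x| * ‖sqrtQ (Q x) (gradient ζ x)‖ +
              ‖sqrtQ (Q x) (gradient f x)‖) P (volume.restrict S) := eLpNorm_mono_ae_real hae
      _ ≤ eLpNorm (fun x => |f x| * ‖sqrtQ (Q x) (gradient ζ x)‖) P (volume.restrict S) +
            eLpNorm (fun x => ‖sqrtQ (Q x) (gradient f x)‖) P (volume.restrict S) :=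
          eLpNorm_add_le (hmf.abs.mul hmζ).aestronglyMeasurable hmg.aestronglyMeasurable hP1
      _ ≤ ENNReal.ofReal c₂ * wNorm Ω Q p f * T + wNorm Ω Q p f := by
          gcongr
          · refine (eLpNorm_smul_le_mul_eLpNorm (p := P * t') (q := t * P) (r := P)
              hmζ.aestronglyMeasurable hmf.abs.aestronglyMeasurable).trans ?_
            rw [eLpNorm_norm]
            gcongr
            exact (eLpNorm_norm f).trans_le (ht' f hf)
          · rw [eLpNorm_norm]
            exact (eLpNorm_mono_measure _ (Measure.restrict_mono hS le_rfl)).trans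
              (eLpNorm_sqrtQ_le_wNorm hp0 f)
      _ = D1 * wNorm Ω Q p f := by rw [hD1]; ring
  have hval : ∀ f, eLpNorm (fun x => ζ x * f x) P (volume.restrict S) ≤ wNorm Ω Q p f := by
    intro f
    refine (eLpNorm_mono (g := f) fun x => ?_).trans
      ((eLpNorm_mono_measure _ (Measure.restrict_mono hS le_rfl)).trans (eLpNorm_le_wNorm hp0 f))
    rw [norm_mul, Real.norm_eq_abs, abs_of_nonneg (h01 x).1]
    exact mul_le_of_le_one_left (norm_nonneg _) (h01 x).2
  have hT_ne : T ≠ ∞ := ht.ne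
  have hD1t : D1 ≠ ∞ := by rw [hD1]; finiteness
  set V := (volume S)⁻¹ with hV
  have hVt : V ≠ ∞ := ENNReal.inv_ne_top.2 hv0
  have hV0 : V ≠ 0 := ENNReal.inv_ne_zero.2 hvol
  set e1 := (1 / ENNReal.ofReal (p * σ)).toReal with he1
  set e2 := (1 / P).toReal with he2
  set X := ENNReal.ofReal C * (ENNReal.ofReal r * (V ^ e2 * D1) + V ^ e2) with hX
  have hV2 : V ^ e2 ≠ ∞ := ENNReal.rpow_ne_top_of_ne_zero hV0 hVt
  have hXt : X ≠ ∞ := by rw [hX]; finiteness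
  refine ⟨(V ^ e1)⁻¹ * X, ENNReal.mul_ne_top (ENNReal.inv_ne_top.2
    (ENNReal.rpow_pos (pos_iff_ne_zero.2 hV0) hVt).ne') hXt, fun f hf hfin => ?_⟩
  have hLip : Lip0 S (fun x => ζ x * f x) := hζ.mul_comp hΩ hS hf LipschitzWith.id
  -- `ζ f` is itself Lipschitz with compact support, so a constant sequence is a witness.
  have hmem : MemW0 S Q p (fun x => ζ x * f x) (gradient (fun x => ζ x * f x)) := by
    refine ⟨fun _ => fun x => ζ x * f x, fun _ => ⟨hLip, ?_⟩, ?_, ?_, ?_, ?_⟩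
    · refine (wNorm_le_add hp.le _).trans_lt ?_
      refine (add_le_add (hgrad f hf) (hval f)).trans_lt ?_
      finiteness
    · obtain ⟨K, hK⟩ := hLip.1
      exact hK.continuous.measurable.aemeasurable
    · exact (measurable_gradient _).aemeasurable
    · simp
    · simp
  have h := hSob _ _ hmem
  rw [avgNorm_eq hvol, avgNorm_eq hvol, avgNorm_eq hvol] at h
  have h2 : V ^ e1 * eLpNorm (fun x => ζ x * f x) (ENNReal.ofReal (p * σ)) (volume.restrict S)
      ≤ X * wNorm Ω Q p f := by
    refine h.trans ?_
    calc _ ≤ ENNReal.ofReal C * (ENNReal.ofReal r * (V ^ e2 * (D1 * wNorm Ω Q p f))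
            + V ^ e2 * wNorm Ω Q p f) := by
          gcongr
          · exact hgrad f hf
          · exact hval f
      _ = X * wNorm Ω Q p f := by rw [hX]; ring
  have h3 : eLpNorm f (ENNReal.ofReal (p * σ)) (volume.restrict S') ≤
      eLpNorm (fun x => ζ x * f x) (ENNReal.ofReal (p * σ)) (volume.restrict S) := by
    refine le_trans (le_of_eq ?_) (eLpNorm_mono_measure _ (Measure.restrict_mono hS' le_rfl))
    refine eLpNorm_congr_ae ?_
    filter_upwards [ae_restrict_mem₀ hm] with x hx
    rw [hone x hx, one_mul]
  calc _ ≤ _ := h3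
    _ = (V ^ e1)⁻¹ * (V ^ e1 * eLpNorm (fun x => ζ x * f x) (ENNReal.ofReal (p * σ))
          (volume.restrict S)) := by
        rw [← mul_assoc, ENNReal.inv_mul_cancel (ENNReal.rpow_pos (pos_iff_ne_zero.2 hV0) hVt).ne'
          (ENNReal.rpow_ne_top_of_ne_zero hV0 hVt), one_mul]
    _ ≤ (V ^ e1)⁻¹ * (X * wNorm Ω Q p f) := by gcongr
    _ = _ := by ring

/-- The locally Lipschitz functions `f i` approximate the pair `(u, v)` on `S`, almost everywhere,
in `L^q(S)`, and in the degenerate `L^p` norm of the gradients. -/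
structure IsApprox (Ω S : Set (Rn n)) (Q : Rn n → Matrix (Fin n) (Fin n) ℝ) (p : ℝ) (q : ℝ≥0∞)
    (f : ℕ → Rn n → ℝ) (u : Rn n → ℝ) (v : Rn n → Rn n) : Prop where
  lip : ∀ i, LocallyLipschitzOn Ω (f i)
  meas_u : AEMeasurable u (volume.restrict Ω)
  meas_v : AEMeasurable v (volume.restrict Ω)
  ae_lim : ∀ᵐ x ∂(volume.restrict S), Tendsto (fun i => f i x) atTop (𝓝 (u x))
  lim : Tendsto (fun i => eLpNorm (fun x => f i x - u x) q (volume.restrict S)) atTop (𝓝 0)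
  lim_grad : Tendsto (fun i => eLpNorm (fun x => sqrtQ (Q x) (gradient (f i) x - v x))
    (ENNReal.ofReal p) (volume.restrict S)) atTop (𝓝 0)
  u_mem : eLpNorm u q (volume.restrict S) ≠ ∞
  v_mem : eLpNorm (fun x => sqrtQ (Q x) (v x)) (ENNReal.ofReal p) (volume.restrict S) ≠ ∞

/-- An element of `W^{1,p}_Q(Ω)` is the limit of locally Lipschitz functions converging almost
everywhere, and in every Lebesgue space that is locally controlled by the Sobolev norm. -/
theorem MemW.exists_approx {Ω S : Set (Rn n)} (hΩ : IsOpen Ω) (hS : S ⊆ Ω)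
    {Q : Rn n → Matrix (Fin n) (Fin n) ℝ} (hQ : MeasurableForm Q (volume.restrict Ω))
    {p : ℝ} (hp : 1 < p) {q : ℝ≥0∞} (hq : 1 ≤ q) {C' : ℝ≥0∞} (hC' : C' ≠ ∞)
    (hloc : ∀ f, LocallyLipschitzOn Ω f → wNorm Ω Q p f < ∞ →
      eLpNorm f q (volume.restrict S) ≤ C' * wNorm Ω Q p f)
    {u : Rn n → ℝ} {v : Rn n → Rn n} (hu : MemW Ω Q p u v) :
    ∃ f : ℕ → Rn n → ℝ, IsApprox Ω S Q p q f u v := by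
  obtain ⟨f₀, hf₀, hum, hvm, hlim₀, hglim₀⟩ := hu
  have hp0 : 0 < p := by linarith
  set P := ENNReal.ofReal p with hP
  have hP1 : 1 ≤ P := by rw [hP, ENNReal.one_le_ofReal]; exact hp.le
  have hm₀ : ∀ i, AEMeasurable (f₀ i) (volume.restrict Ω) := fun i =>
    aemeasurable_of_locallyLipschitzOn hΩ (hf₀ i).1
  -- Convergence almost everywhere, on a subsequence, is needed below for Fatou's lemma and later
  -- for the continuity of `H'` in the chain rule.
  obtain ⟨φ, hφ, hae⟩ := (tendstoInMeasure_of_tendsto_eLpNorm (p := P) (by positivity)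
    (fun i => (hm₀ i).aestronglyMeasurable) hum.aestronglyMeasurable hlim₀).exists_seq_tendsto_ae
  set f : ℕ → Rn n → ℝ := fun i => f₀ (φ i) with hf
  have hlim := hlim₀.comp hφ.tendsto_atTop
  have hglim := hglim₀.comp hφ.tendsto_atTop
  have hmono : volume.restrict S ≤ volume.restrict Ω := Measure.restrict_mono hS le_rfl
  set D : ℕ → ℝ≥0∞ := fun i =>
    eLpNorm (fun x => sqrtQ (Q x) (gradient (f i) x - v x)) P (volume.restrict Ω) +
    eLpNorm (fun x => f i x - u x) P (volume.restrict Ω) with hD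
  have hD0 : Tendsto D atTop (𝓝 0) := by
    have := hglim.add hlim
    rwa [add_zero] at this
  have hgm : ∀ w : Rn n → Rn n, AEMeasurable w (volume.restrict Ω) →
      AEStronglyMeasurable (fun x => ‖sqrtQ (Q x) (w x)‖) (volume.restrict Ω) :=
    fun w hw => (hQ w hw).aestronglyMeasurable
  have hpair : ∀ i j, wNorm Ω Q p (fun x => f i x - f j x) ≤ D i + D j := by
    intro i j
    refine (wNorm_le_add hp.le _).trans ?_
    have h1 : eLpNorm (fun x => sqrtQ (Q x) (gradient (fun x => f i x - f j x) x)) P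
        (volume.restrict Ω) ≤
        eLpNorm (fun x => sqrtQ (Q x) (gradient (f i) x - v x)) P (volume.restrict Ω) +
        eLpNorm (fun x => sqrtQ (Q x) (gradient (f j) x - v x)) P (volume.restrict Ω) := by
      have hae : ∀ᵐ x ∂(volume.restrict Ω),
          ‖sqrtQ (Q x) (gradient (fun x => f i x - f j x) x)‖ ≤
          ‖sqrtQ (Q x) (gradient (f i) x - v x)‖ + ‖sqrtQ (Q x) (gradient (f j) x - v x)‖ := by
        filter_upwards [ae_differentiableAt_of_locallyLipschitzOn hΩ (hf₀ (φ i)).1,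
          ae_differentiableAt_of_locallyLipschitzOn hΩ (hf₀ (φ j)).1] with x h1 h2
        rw [gradient_sub h1 h2,
          show gradient (f₀ (φ i)) x - gradient (f₀ (φ j)) x =
            (gradient (f i) x - v x) - (gradient (f j) x - v x) by simp [hf], map_sub]
        exact norm_sub_le _ _
      refine (eLpNorm_mono_ae_real hae).trans ?_
      refine (eLpNorm_add_le (hgm _ ((measurable_gradient _).aemeasurable.sub hvm))
        (hgm _ ((measurable_gradient _).aemeasurable.sub hvm)) hP1).trans ?_
      rw [eLpNorm_norm, eLpNorm_norm]
      rfl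
    have h2 : eLpNorm (fun x => f i x - f j x) P (volume.restrict Ω) ≤
        eLpNorm (fun x => f i x - u x) P (volume.restrict Ω) +
        eLpNorm (fun x => f j x - u x) P (volume.restrict Ω) := by
      refine le_trans (le_of_eq ?_) (eLpNorm_sub_le
        ((hm₀ (φ i)).sub hum).aestronglyMeasurable
        ((hm₀ (φ j)).sub hum).aestronglyMeasurable hP1)
      congr 1
      ext x
      simp [hf]
    refine (add_le_add h1 h2).trans (le_of_eq ?_)
    simp only [hD]
    ring
  have hsub : ∀ i j, LocallyLipschitzOn Ω (fun x => f i x - f j x) := fun i j => by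
    intro x hx
    obtain ⟨K1, t1, ht1, h1⟩ := (hf₀ (φ i)).1 hx
    obtain ⟨K2, t2, ht2, h2⟩ := (hf₀ (φ j)).1 hx
    exact ⟨K1 + K2, t1 ∩ t2, inter_mem ht1 ht2,
      (h1.mono inter_subset_left).sub (h2.mono inter_subset_right)⟩
  -- Fatou in `j`: `f i - f j → f i - u` almost everywhere, and the bound `C' (D i + D j)` for the
  -- differences tends to `C' D i`. The limit in `L^q` is thereby identified as `u` without an
  -- appeal to completeness.
  have hbound : ∀ᶠ i in atTop, eLpNorm (fun x => f i x - u x) q (volume.restrict S) ≤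
      C' * D i := by
    have hDfin : ∀ᶠ i in atTop, D i < ∞ := hD0.eventually (gt_mem_nhds ENNReal.zero_lt_top)
    filter_upwards [hDfin] with i hi
    have hmi : ∀ j, AEStronglyMeasurable (fun x => f i x - f j x) (volume.restrict S) := fun j =>
      (((hm₀ (φ i)).sub (hm₀ (φ j))).mono_measure
        (Measure.restrict_mono hS le_rfl)).aestronglyMeasurable
    refine (Lp.eLpNorm_lim_le_liminf_eLpNorm hmi (fun x => f i x - u x) ?_).trans ?_
    · filter_upwards [ae_restrict_of_ae_restrict_of_subset hS hae] with x hx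
      exact tendsto_const_nhds.sub hx
    · have hlimD : Tendsto (fun j => C' * (D i + D j)) atTop (𝓝 (C' * D i)) := by
        have : Tendsto (fun j => D i + D j) atTop (𝓝 (D i + 0)) := tendsto_const_nhds.add hD0
        rw [add_zero] at this
        exact ENNReal.Tendsto.const_mul this (Or.inr hC')
      rw [← hlimD.liminf_eq]
      refine liminf_le_liminf ?_
      filter_upwards [hDfin] with j hj
      have hfin : wNorm Ω Q p (fun x => f i x - f j x) < ∞ :=
        (hpair i j).trans_lt (ENNReal.add_lt_top.2 ⟨hi, hj⟩)
      exact (hloc _ (hsub i j) hfin).trans (mul_le_mul_right (hpair i j) _)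
  have hCD : Tendsto (fun i => C' * D i) atTop (𝓝 0) := by
    simpa using ENNReal.Tendsto.const_mul hD0 (Or.inr hC')
  have hlimS : Tendsto (fun i => eLpNorm (fun x => f i x - u x) q (volume.restrict S)) atTop
      (𝓝 0) := tendsto_of_tendsto_of_tendsto_of_le_of_le' tendsto_const_nhds hCD
    (Eventually.of_forall fun _ => zero_le) hbound
  refine ⟨f, fun i => (hf₀ (φ i)).1, hum, hvm, ae_restrict_of_ae_restrict_of_subset hS hae, hlimS,
    tendsto_of_tendsto_of_tendsto_of_le_of_le tendsto_const_nhds hglim (fun _ => zero_le)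
      fun i => eLpNorm_mono_measure _ hmono, ?_, ?_⟩
  · obtain ⟨i, hi⟩ := (hlimS.eventually (gt_mem_nhds ENNReal.zero_lt_top)).exists
    have hfi := (hloc _ (hf₀ (φ i)).1 (hf₀ (φ i)).2).trans_lt
      (ENNReal.mul_lt_top hC'.lt_top (hf₀ (φ i)).2)
    have hm := ((hm₀ (φ i)).mono_measure hmono).aestronglyMeasurable
    have hle := eLpNorm_sub_le hm (hm.sub (hum.mono_measure hmono).aestronglyMeasurable) hq
    rw [sub_sub_cancel] at hle
    exact (hle.trans_lt (ENNReal.add_lt_top.2 ⟨hfi, hi⟩)).ne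
  · obtain ⟨i, hi⟩ := (hglim.eventually (gt_mem_nhds ENNReal.zero_lt_top)).exists
    have hfi := (eLpNorm_sqrtQ_le_wNorm hp0 _).trans_lt (hf₀ (φ i)).2
    have hle : eLpNorm (fun x => sqrtQ (Q x) (v x)) P (volume.restrict Ω) ≤
        eLpNorm (fun x => ‖sqrtQ (Q x) (gradient (f i) x)‖ +
          ‖sqrtQ (Q x) (gradient (f i) x - v x)‖) P (volume.restrict Ω) := by
      refine eLpNorm_mono_real fun x => ?_
      have := norm_sub_le (sqrtQ (Q x) (gradient (f i) x))
        (sqrtQ (Q x) (gradient (f i) x - v x))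
      rwa [← map_sub, sub_sub_cancel] at this
    have hle2 := hle.trans (eLpNorm_add_le (hgm _ (measurable_gradient _).aemeasurable)
      (hgm _ ((measurable_gradient (f i)).aemeasurable.sub hvm)) hP1)
    rw [eLpNorm_norm, eLpNorm_norm] at hle2
    exact ((eLpNorm_mono_measure _ hmono).trans_lt (hle2.trans_lt
      (ENNReal.add_lt_top.2 ⟨hfi, hi⟩))).ne

end SobolevNorms

/-! ### Chain rule for limit pairs and limits in the weak formulation. -/

section WeakLimits

theorem eLpNorm_ofReal_eq {α F : Type*} [MeasurableSpace α] [NormedAddCommGroup F]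
    {μ : Measure α} {p : ℝ} (hp : 0 < p) (f : α → F) :
    eLpNorm f (ENNReal.ofReal p) μ = (∫⁻ x, ‖f x‖ₑ ^ p ∂μ) ^ (1 / p) := by
  rw [eLpNorm_eq_lintegral_rpow_enorm_toReal (by positivity) ENNReal.ofReal_ne_top,
    ENNReal.toReal_ofReal hp.le]

/-- If `0 ≤ M ≤ g + R` and `g` has vanishing integral, then `∫ M ≤ ∫ R`; `M` need not be
measurable. -/
theorem lintegral_ofReal_le_of_le_add {α : Type*} [MeasurableSpace α] {μ : Measure α}
    {M g R : α → ℝ} (hg : Integrable g μ) (hg0 : ∫ x, g x ∂μ = 0) (hR : AEMeasurable R μ)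
    (hR0 : ∀ᵐ x ∂μ, 0 ≤ R x) (hM0 : ∀ᵐ x ∂μ, 0 ≤ M x) (h : ∀ᵐ x ∂μ, M x ≤ g x + R x) :
    ∫⁻ x, ENNReal.ofReal (M x) ∂μ ≤ ∫⁻ x, ENNReal.ofReal (R x) ∂μ := by
  have hpos : ∫⁻ x, ENNReal.ofReal (g x) ∂μ ≠ ∞ := 
    ((lintegral_mono fun x => Real.ofReal_le_enorm (g x)).trans_lt hg.2).ne
  have hneg : ∫⁻ x, ENNReal.ofReal (-g x) ∂μ ≠ ∞ := 
    ((lintegral_mono fun x => Real.ofReal_le_enorm (-g x)).trans_lt hg.neg.2).ne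
  have heq : ∫⁻ x, ENNReal.ofReal (g x) ∂μ = ∫⁻ x, ENNReal.ofReal (-g x) ∂μ := by
    rw [integral_eq_lintegral_pos_part_sub_lintegral_neg_part hg, sub_eq_zero,
      ENNReal.toReal_eq_toReal_iff' hpos hneg] at hg0
    exact hg0
  have hmeas : AEMeasurable (fun x => ENNReal.ofReal (-g x)) μ :=
    hg.aemeasurable.neg.ennreal_ofReal
  -- Moving the negative part of `g` to the left leaves an inequality between nonnegative functions.
  -- The two parts of `g` have the same finite integral, which is cancelled afterwards.
  have hle : ∫⁻ x, ENNReal.ofReal (M x) + ENNReal.ofReal (-g x) ∂μ ≤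
      ∫⁻ x, ENNReal.ofReal (R x) + ENNReal.ofReal (g x) ∂μ := by
    refine lintegral_mono_ae ?_
    filter_upwards [hR0, hM0, h] with x h1 h2 h3
    rcases le_total 0 (g x) with hgx | hgx
    · rw [ENNReal.ofReal_of_nonpos (by linarith : -g x ≤ 0), add_zero, ← ENNReal.ofReal_add h1 hgx]
      exact ENNReal.ofReal_le_ofReal (by linarith)
    · rw [ENNReal.ofReal_of_nonpos hgx, add_zero, ← ENNReal.ofReal_add h2 (by linarith)]
      exact ENNReal.ofReal_le_ofReal (by linarith)
  rw [lintegral_add_right' _ hmeas, lintegral_add_left' hR.ennreal_ofReal, heq] at hle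
  exact (ENNReal.add_le_add_iff_right hneg).1 hle

/-- Dominated convergence with majorant `|L X| ^ p`. -/
theorem tendsto_eLpNorm_mul_of_bounded {α : Type*} [MeasurableSpace α] {μ : Measure α} {p : ℝ}
    (hp : 0 < p) {b : ℕ → α → ℝ} {X : α → ℝ} (hb : ∀ i, AEMeasurable (b i) μ)
    (hX : AEMeasurable X μ) (hXp : eLpNorm X (ENNReal.ofReal p) μ ≠ ∞) {L : ℝ}
    (hL : ∀ i x, |b i x| ≤ L) (hlim : ∀ᵐ x ∂μ, Tendsto (fun i => b i x) atTop (𝓝 0)) :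
    Tendsto (fun i => eLpNorm (fun x => b i x * X x) (ENNReal.ofReal p) μ) atTop (𝓝 0) := by
  have h0 : Tendsto (fun i => ∫⁻ x, ‖b i x * X x‖ₑ ^ p ∂μ) atTop (𝓝 (∫⁻ _, 0 ∂μ)) := by
    refine tendsto_lintegral_of_dominated_convergence' (fun x => ‖L * X x‖ₑ ^ p)
      (fun i => ((hb i).mul hX).enorm.pow_const p) (fun i => ae_of_all _ fun x => ?_) ?_ ?_
    · refine ENNReal.rpow_le_rpow ?_ hp.le
      rw [enorm_le_iff_norm_le, norm_mul, norm_mul]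
      gcongr
      exact (hL i x).trans (le_abs_self L)
    · have h1 : eLpNorm (fun x => L * X x) (ENNReal.ofReal p) μ ≠ ∞ := by
        have : (fun x => L * X x) = L • X := rfl
        rw [this, eLpNorm_const_smul]
        finiteness
      rw [eLpNorm_ofReal_eq hp] at h1
      intro h2
      rw [h2, ENNReal.top_rpow_of_pos (by positivity)] at h1
      exact h1 rfl
    · filter_upwards [hlim] with x hx
      have h1 : Tendsto (fun i => ‖b i x * X x‖ₑ) atTop (𝓝 0) := by
        have : Tendsto (fun i => b i x * X x) atTop (𝓝 0) := by
          simpa using hx.mul_const (X x)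
        simpa using this.enorm
      simpa [ENNReal.zero_rpow_of_pos hp] using h1.ennrpow_const p
  simp only [eLpNorm_ofReal_eq hp]
  rw [lintegral_zero] at h0
  have := h0.ennrpow_const (1 / p)
  rwa [ENNReal.zero_rpow_of_pos (by positivity)] at this

variable {n : ℕ}

theorem tendsto_eLpNorm_mul_comp_sub {S : Set (Rn n)} {f : ℕ → Rn n → ℝ} {u ζ : Rn n → ℝ}
    {q : ℝ≥0∞} (hlim : Tendsto (fun i => eLpNorm (fun x => f i x - u x) q (volume.restrict S))
      atTop (𝓝 0)) (h01 : ∀ x, 0 ≤ ζ x ∧ ζ x ≤ 1) {H : ℝ → ℝ} {L : ℝ≥0}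
    (hH : LipschitzWith L H) :
    Tendsto (fun i => eLpNorm (fun x => ζ x * H (f i x) - ζ x * H (u x)) q (volume.restrict S))
      atTop (𝓝 0) := by
  have h1 : Tendsto (fun i => (L : ℝ≥0∞) * eLpNorm (fun x => f i x - u x) q (volume.restrict S))
      atTop (𝓝 0) := by
    simpa using ENNReal.Tendsto.const_mul hlim (Or.inr ENNReal.coe_ne_top)
  refine tendsto_of_tendsto_of_tendsto_of_le_of_le tendsto_const_nhds h1 (fun _ => zero_le)
    fun i => ?_
  refine eLpNorm_le_nnreal_smul_eLpNorm_of_ae_le_mul (ae_of_all _ fun x => ?_) q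
  rw [← NNReal.coe_le_coe, NNReal.coe_mul, coe_nnnorm, coe_nnnorm, ← mul_sub, norm_mul,
    Real.norm_eq_abs, abs_of_nonneg (h01 x).1]
  refine (mul_le_of_le_one_left (norm_nonneg _) (h01 x).2).trans ?_
  exact hH.norm_sub_le _ _

/-- Convergence of the gradients of `ζ H(f i)` when `f i` approximates the pair `(u, v)`. -/
theorem tendsto_gradient_mul_comp {Ω S : Set (Rn n)} (hΩ : IsOpen Ω) (hS : S ⊆ Ω)
    {Q : Rn n → Matrix (Fin n) (Fin n) ℝ} (hQ : MeasurableForm Q (volume.restrict Ω))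
    {p : ℝ} (hp : 1 ≤ p) {f : ℕ → Rn n → ℝ} {u : Rn n → ℝ} {v : Rn n → Rn n}
    (hf : ∀ i, LocallyLipschitzOn Ω (f i))
    (hum : AEMeasurable u (volume.restrict Ω)) (hvm : AEMeasurable v (volume.restrict Ω))
    (hae : ∀ᵐ x ∂(volume.restrict S), Tendsto (fun i => f i x) atTop (𝓝 (u x)))
    (hgrad : Tendsto (fun i => eLpNorm (fun x => sqrtQ (Q x) (gradient (f i) x - v x))
      (ENNReal.ofReal p) (volume.restrict S)) atTop (𝓝 0))
    (hv : eLpNorm (fun x => sqrtQ (Q x) (v x)) (ENNReal.ofReal p) (volume.restrict S) ≠ ∞)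
    {ζ : Rn n → ℝ} (hζ : Lip0 S ζ) (h01 : ∀ x, 0 ≤ ζ x ∧ ζ x ≤ 1)
    (hE : Tendsto (fun i => eLpNorm (fun x => |f i x - u x| * ‖sqrtQ (Q x) (gradient ζ x)‖)
      (ENNReal.ofReal p) (volume.restrict S)) atTop (𝓝 0))
    {H H' : ℝ → ℝ} {L : ℝ≥0} (hH : ∀ z, HasDerivAt H (H' z) z) (hH'c : Continuous H')
    (hL : ∀ z, |H' z| ≤ L) :
    Tendsto (fun i => eLpNorm (fun x => sqrtQ (Q x) (gradient (fun x => ζ x * H (f i x)) x -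
      (H (u x) • gradient ζ x + (ζ x * H' (u x)) • v x))) (ENNReal.ofReal p) (volume.restrict S))
      atTop (𝓝 0) := by
  set P := ENNReal.ofReal p with hP
  have hP1 : 1 ≤ P := by rw [hP, ENNReal.one_le_ofReal]; exact hp
  set μ := volume.restrict S with hμ
  have hmono : μ ≤ volume.restrict Ω := Measure.restrict_mono hS le_rfl
  have hHL : LipschitzWith L H := by
    refine lipschitzWith_of_nnnorm_deriv_le (fun z => (hH z).differentiableAt) fun z => ?_
    rw [(hH z).deriv, ← NNReal.coe_le_coe]
    exact hL z
  have hmu : AEMeasurable u μ := hum.mono_measure hmono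
  have hmf : ∀ i, AEMeasurable (f i) μ := fun i =>
    (aemeasurable_of_locallyLipschitzOn hΩ (hf i)).mono_measure hmono
  have hmζ := hQ.mono hS _ (measurable_gradient ζ).aemeasurable
  have hmv := hQ.mono hS _ hvm
  have hmg : ∀ i, AEMeasurable (fun x => ‖sqrtQ (Q x) (gradient (f i) x - v x)‖) μ := fun i =>
    hQ.mono hS _ ((measurable_gradient (f i)).aemeasurable.sub hvm)
  have h3 : Tendsto (fun i => eLpNorm (fun x => (H' (f i x) - H' (u x)) *
      ‖sqrtQ (Q x) (v x)‖) P μ) atTop (𝓝 0) := by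
    refine tendsto_eLpNorm_mul_of_bounded (by linarith) (L := 2 * L) (fun i => ?_) hmv ?_ ?_ ?_
    · exact (hH'c.measurable.comp_aemeasurable (hmf i)).sub
        (hH'c.measurable.comp_aemeasurable hmu)
    · rwa [eLpNorm_norm]
    · intro i x
      have h1 := hL (f i x)
      have h2 := hL (u x)
      rw [abs_le] at h1 h2 ⊢
      constructor <;> linarith
    · filter_upwards [hae] with x hx
      have := ((hH'c.tendsto (u x)).comp hx).sub_const (H' (u x))
      simpa using this
  have hsum : Tendsto (fun i => (L : ℝ≥0∞) * eLpNorm (fun x => |f i x - u x| *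
      ‖sqrtQ (Q x) (gradient ζ x)‖) P μ + (L : ℝ≥0∞) *
      eLpNorm (fun x => sqrtQ (Q x) (gradient (f i) x - v x)) P μ +
      eLpNorm (fun x => (H' (f i x) - H' (u x)) * ‖sqrtQ (Q x) (v x)‖) P μ) atTop (𝓝 0) := by
    have := ((ENNReal.Tendsto.const_mul (a := (L : ℝ≥0∞)) hE (Or.inr ENNReal.coe_ne_top)).add
      (ENNReal.Tendsto.const_mul (a := (L : ℝ≥0∞)) hgrad (Or.inr ENNReal.coe_ne_top))).add h3
    simpa only [mul_zero, add_zero] using this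
  refine tendsto_of_tendsto_of_tendsto_of_le_of_le tendsto_const_nhds hsum (fun _ => zero_le)
    fun i => ?_
  have hpt : ∀ᵐ x ∂μ, ‖sqrtQ (Q x) (gradient (fun x => ζ x * H (f i x)) x -
      (H (u x) • gradient ζ x + (ζ x * H' (u x)) • v x))‖ ≤
      L * (|f i x - u x| * ‖sqrtQ (Q x) (gradient ζ x)‖) +
      L * ‖sqrtQ (Q x) (gradient (f i) x - v x)‖ +
      |H' (f i x) - H' (u x)| * ‖sqrtQ (Q x) (v x)‖ := by
    obtain ⟨Kζ, hKζ⟩ := hζ.1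
    filter_upwards [ae_restrict_of_ae hKζ.ae_differentiableAt,
      ae_restrict_of_ae_restrict_of_subset hS (ae_differentiableAt_of_locallyLipschitzOn hΩ (hf i))]
      with x hx1 hx2
    rw [gradient_mul_comp hx1 hx2 (hH (f i x))]
    -- The three differences vanish in the limit for different reasons: the first by `hE`, the
    -- second by convergence of the gradients, the third by dominated convergence, with `v` as a
    -- fixed factor.
    have e : H (f i x) • gradient ζ x + (ζ x * H' (f i x)) • gradient (f i) x -
        (H (u x) • gradient ζ x + (ζ x * H' (u x)) • v x) =
        (H (f i x) - H (u x)) • gradient ζ x + (ζ x * H' (f i x)) • (gradient (f i) x - v x) +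
        (ζ x * (H' (f i x) - H' (u x))) • v x := by module
    rw [e, map_add, map_add, map_smul, map_smul, map_smul]
    refine (norm_add₃_le).trans ?_
    rw [norm_smul, norm_smul, norm_smul, norm_mul, norm_mul, Real.norm_eq_abs (ζ x),
      abs_of_nonneg (h01 x).1]
    have hz0 := (h01 x).1
    have hz1 := (h01 x).2
    gcongr ?_ + ?_ + ?_
    · rw [← mul_assoc]
      gcongr
      exact hHL.norm_sub_le _ _
    · gcongr
      exact (mul_le_of_le_one_left (norm_nonneg _) hz1).trans (hL _)
    · gcongr
      exact mul_le_of_le_one_left (norm_nonneg _) hz1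
  have hm1 : AEMeasurable (fun x => |f i x - u x| * ‖sqrtQ (Q x) (gradient ζ x)‖) μ :=
    ((hmf i).sub hmu).abs.mul hmζ
  have hm2 := hmg i
  have hm3 : AEMeasurable (fun x => |H' (f i x) - H' (u x)| * ‖sqrtQ (Q x) (v x)‖) μ :=
    ((hH'c.measurable.comp_aemeasurable (hmf i)).sub
      (hH'c.measurable.comp_aemeasurable hmu)).abs.mul hmv
  refine (eLpNorm_mono_ae_real hpt).trans ?_
  refine (eLpNorm_add_le ((hm1.const_mul _).add (hm2.const_mul _)).aestronglyMeasurable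
    hm3.aestronglyMeasurable hP1).trans ?_
  gcongr ?_ + ?_
  · refine (eLpNorm_add_le (hm1.const_mul _).aestronglyMeasurable
      (hm2.const_mul _).aestronglyMeasurable hP1).trans ?_
    have hLn : ‖(L : ℝ)‖ₑ = (L : ℝ≥0∞) := by
      rw [enorm_eq_nnnorm]; simp
    gcongr ?_ + ?_
    · have := eLpNorm_const_smul (L : ℝ) (fun x => |f i x - u x| *
        ‖sqrtQ (Q x) (gradient ζ x)‖) P μ
      rw [hLn] at this
      exact this.le
    · have := eLpNorm_const_smul (L : ℝ) (fun x => ‖sqrtQ (Q x) (gradient (f i) x - v x)‖) P μ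
      rw [hLn, eLpNorm_norm] at this
      exact this.le
  · refine eLpNorm_mono fun x => ?_
    simp

/-- Passage to the limit in the weak formulation, for test functions `φ i` approximating the pair
`(φ, V)`. -/
theorem lintegral_le_of_tendsto_testFunctions {Ω S : Set (Rn n)} (hΩ : IsOpen Ω) (hS : S ⊆ Ω)
    {Q : Rn n → Matrix (Fin n) (Fin n) ℝ} (hQ : MeasurableForm Q (volume.restrict Ω))
    {P P' q q' : ℝ≥0∞} [hPP' : ENNReal.HolderConjugate P P'] [hqq' : ENNReal.HolderConjugate q q']
    {A A' : Rn n → Rn n} {B 𝔞 𝔟 : Rn n → ℝ}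
    (hA : ∀ᵐ x ∂(volume.restrict S), A x = sqrtQ (Q x) (A' x))
    (hA' : ∀ᵐ x ∂(volume.restrict S), ‖A' x‖ ≤ 𝔞 x)
    (hB : ∀ᵐ x ∂(volume.restrict S), |B x| ≤ 𝔟 x)
    (h𝔞 : MemLp 𝔞 P' (volume.restrict S)) (h𝔟 : MemLp 𝔟 q' (volume.restrict S))
    {φ : ℕ → Rn n → ℝ} (hφ : ∀ i, Lip0 S (φ i))
    (hweak : ∀ i, IntegrableOn (fun x => inner ℝ (gradient (φ i) x) (A x) + φ i x * B x) Ω ∧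
      ∫ x in Ω, (inner ℝ (gradient (φ i) x) (A x) + φ i x * B x) = 0)
    {w : Rn n → ℝ} {V : Rn n → Rn n}
    (hwm : AEMeasurable w (volume.restrict Ω)) (hVm : AEMeasurable V (volume.restrict Ω))
    (hw : Tendsto (fun i => eLpNorm (fun x => φ i x - w x) q (volume.restrict S)) atTop (𝓝 0))
    (hV : Tendsto (fun i => eLpNorm (fun x => sqrtQ (Q x) (gradient (φ i) x - V x)) P
      (volume.restrict S)) atTop (𝓝 0))
    {M R : Rn n → ℝ} (hRm : AEMeasurable R (volume.restrict S))
    (hR0 : ∀ᵐ x ∂(volume.restrict S), 0 ≤ R x) (hM0 : ∀ᵐ x ∂(volume.restrict S), 0 ≤ M x)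
    (hM : ∀ᵐ x ∂(volume.restrict S), M x ≤ inner ℝ (V x) (A x) + w x * B x + R x) :
    ∫⁻ x in S, ENNReal.ofReal (M x) ≤ ∫⁻ x in S, ENNReal.ofReal (R x) := by
  set μ := volume.restrict S with hμ
  have hmono : μ ≤ volume.restrict Ω := Measure.restrict_mono hS le_rfl
  -- Error made by replacing `(w, V)` by `(φ i, ∇ φ i)` in the integrand, measured by the majorants.
  -- Only the combined integrand of a test function is known to be integrable, so the limit is taken
  -- in `Y` and never in `A` or `B` separately.
  set Y : ℕ → Rn n → ℝ := fun i x =>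
    ‖sqrtQ (Q x) (gradient (φ i) x - V x)‖ * 𝔞 x + |φ i x - w x| * 𝔟 x with hY
  have hm1 : ∀ i, AEMeasurable (fun x => ‖sqrtQ (Q x) (gradient (φ i) x - V x)‖) μ := fun i =>
    hQ.mono hS _ ((measurable_gradient _).aemeasurable.sub hVm)
  have hmφ : ∀ i, AEMeasurable (fun x => φ i x - w x) μ := fun i => by
    obtain ⟨K, hK⟩ := (hφ i).1
    exact hK.continuous.measurable.aemeasurable.sub (hwm.mono_measure hmono)
  have hYm : ∀ i, AEMeasurable (Y i) μ := fun i =>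
    ((hm1 i).mul h𝔞.aemeasurable).add ((hmφ i).abs.mul h𝔟.aemeasurable)
  have hY0 : ∀ i, ∀ᵐ x ∂μ, 0 ≤ Y i x := fun i => by
    filter_upwards [hA', hB] with x h1 h2
    have h3 := (norm_nonneg _).trans h1
    have h4 := (abs_nonneg _).trans h2
    simp only [hY]
    positivity
  have hYlim : Tendsto (fun i => ∫⁻ x, ENNReal.ofReal (Y i x) ∂μ) atTop (𝓝 0) := by
    have hup : Tendsto (fun i =>
        eLpNorm (fun x => sqrtQ (Q x) (gradient (φ i) x - V x)) P μ * eLpNorm 𝔞 P' μ +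
        eLpNorm (fun x => φ i x - w x) q μ * eLpNorm 𝔟 q' μ) atTop (𝓝 0) := by
      have := (ENNReal.Tendsto.mul_const hV (Or.inr h𝔞.eLpNorm_ne_top)).add
        (ENNReal.Tendsto.mul_const hw (Or.inr h𝔟.eLpNorm_ne_top))
      simpa only [zero_mul, add_zero] using this
    refine tendsto_of_tendsto_of_tendsto_of_le_of_le tendsto_const_nhds hup (fun _ => zero_le)
      fun i => ?_
    calc ∫⁻ x, ENNReal.ofReal (Y i x) ∂μ
        ≤ ∫⁻ x, ‖(fun x => ‖sqrtQ (Q x) (gradient (φ i) x - V x)‖) x * 𝔞 x‖ₑ +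
            ‖(φ i x - w x) * 𝔟 x‖ₑ ∂μ := by
          refine lintegral_mono_ae ?_
          filter_upwards [hB] with x h2
          have h4 := (abs_nonneg _).trans h2
          refine (ENNReal.ofReal_add_le).trans ?_
          gcongr ?_ + ?_
          · exact Real.ofReal_le_enorm _
          · refine (Real.ofReal_le_enorm _).trans (le_of_eq ?_)
            rw [enorm_mul, enorm_mul, Real.enorm_abs]
      _ = eLpNorm ((fun x => ‖sqrtQ (Q x) (gradient (φ i) x - V x)‖) • 𝔞) 1 μ +
            eLpNorm ((fun x => φ i x - w x) • 𝔟) 1 μ := by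
          rw [eLpNorm_one_eq_lintegral_enorm, eLpNorm_one_eq_lintegral_enorm]
          exact lintegral_add_left' ((hm1 i).mul h𝔞.aemeasurable).enorm _
      _ ≤ _ := by
          gcongr ?_ + ?_
          · refine (eLpNorm_smul_le_mul_eLpNorm (p := P) (q := P') h𝔞.1
              (hm1 i).aestronglyMeasurable).trans ?_
            rw [eLpNorm_norm]
          · exact eLpNorm_smul_le_mul_eLpNorm (p := q) (q := q') h𝔟.1
              (hmφ i).aestronglyMeasurable
  have hstep : ∀ i, ∫⁻ x, ENNReal.ofReal (M x) ∂μ ≤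
      ∫⁻ x, ENNReal.ofReal (R x) ∂μ + ∫⁻ x, ENNReal.ofReal (Y i x) ∂μ := by
    intro i
    obtain ⟨hint, hzero⟩ := hweak i
    have hvan : ∀ x ∈ Ω \ S, inner ℝ (gradient (φ i) x) (A x) + φ i x * B x = 0 := by
      intro x hx
      have hxt : x ∉ tsupport (φ i) := fun h => hx.2 ((hφ i).2.2 h)
      rw [gradient_eq_zero_of_notMem_tsupport hxt, image_eq_zero_of_notMem_tsupport hxt]
      simp
    have hint' : Integrable (fun x => inner ℝ (gradient (φ i) x) (A x) + φ i x * B x) μ :=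
      hint.mono_set hS
    have hzero' : ∫ x, (inner ℝ (gradient (φ i) x) (A x) + φ i x * B x) ∂μ = 0 := by
      rw [← hzero]
      exact (setIntegral_eq_of_subset_of_forall_sdiff_eq_zero hΩ.measurableSet hS hvan).symm
    refine (lintegral_ofReal_le_of_le_add (R := fun x => R x + Y i x) hint' hzero'
      (hRm.add (hYm i)) ?_ hM0 ?_).trans ?_
    · filter_upwards [hR0, hY0 i] with x h1 h2
      positivity
    · filter_upwards [hM, hA, hA', hB] with x h1 h2 h3 h4
      have e1 : |inner ℝ (V x - gradient (φ i) x) (A x)| ≤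
          ‖sqrtQ (Q x) (gradient (φ i) x - V x)‖ * 𝔞 x := by
        rw [h2, inner_sqrtQ_right]
        refine (abs_real_inner_le_norm _ _).trans ?_
        rw [← neg_sub, map_neg, norm_neg]
        gcongr
      have e2 : |(w x - φ i x) * B x| ≤ |φ i x - w x| * 𝔟 x := by
        rw [abs_mul, abs_sub_comm]
        gcongr
      have e3 := (le_abs_self _).trans e1
      have e4 := (le_abs_self _).trans e2
      rw [inner_sub_left] at e3
      simp only [hY]
      linarith
    · refine (lintegral_mono fun x => ENNReal.ofReal_add_le).trans ?_
      rw [lintegral_add_left' hRm.ennreal_ofReal]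
  have hfin : Tendsto (fun i => ∫⁻ x, ENNReal.ofReal (R x) ∂μ + ∫⁻ x, ENNReal.ofReal (Y i x) ∂μ)
      atTop (𝓝 (∫⁻ x, ENNReal.ofReal (R x) ∂μ)) := by
    simpa using tendsto_const_nhds.add hYlim
  exact ge_of_tendsto' hfin hstep

end WeakLimits

/-! ### Smooth truncated powers of the solution. -/

section Profiles

/-- A smooth bounded increasing function of `u² + k²`, converging to it as `δ → 0`. -/
noncomputable def trunc (k δ u : ℝ) : ℝ := (u ^ 2 + k ^ 2) / (1 + δ * (u ^ 2 + k ^ 2))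

/-- The factor appearing in the logarithmic derivative of `trunc`. -/
noncomputable def truncSlope (k δ u : ℝ) : ℝ :=
  u / ((u ^ 2 + k ^ 2) * (1 + δ * (u ^ 2 + k ^ 2)))

/-- Truncated version of the power `√(u² + k²) ^ (1 + l)`. -/
noncomputable def powProfile (k δ l u : ℝ) : ℝ := √(u ^ 2 + k ^ 2) * trunc k δ u ^ (l / 2)

noncomputable def powProfileDeriv (k δ l u : ℝ) : ℝ :=
  trunc k δ u ^ (l / 2) * (u / √(u ^ 2 + k ^ 2) + l * √(u ^ 2 + k ^ 2) * truncSlope k δ u)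

/-- The factor of the test function depending on the solution. -/
noncomputable def testProfile (k δ l u : ℝ) : ℝ := u * trunc k δ u ^ (l / 2)

noncomputable def testProfileDeriv (k δ l u : ℝ) : ℝ :=
  trunc k δ u ^ (l / 2) * (1 + l * u * truncSlope k δ u)

variable {k δ l : ℝ}

theorem sq_add_sq_pos (hk : 0 < k) (u : ℝ) : 0 < u ^ 2 + k ^ 2 := by positivity

theorem trunc_pos (hk : 0 < k) (hδ : 0 < δ) (u : ℝ) : 0 < trunc k δ u := by
  have := sq_add_sq_pos hk u
  unfold trunc
  positivity

theorem trunc_le (hk : 0 < k) (hδ : 0 < δ) (u : ℝ) : trunc k δ u ≤ u ^ 2 + k ^ 2 := by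
  have := sq_add_sq_pos hk u
  unfold trunc
  rw [div_le_iff₀ (by positivity)]
  nlinarith [mul_pos hδ (mul_pos this this)]

theorem trunc_le_inv (hk : 0 < k) (hδ : 0 < δ) (u : ℝ) : trunc k δ u ≤ δ⁻¹ := by
  have := sq_add_sq_pos hk u
  unfold trunc
  rw [div_le_iff₀ (by positivity), mul_add, ← mul_assoc, inv_mul_cancel₀ hδ.ne']
  have := inv_pos.2 hδ
  linarith

theorem hasDerivAt_trunc_rpow (hk : 0 < k) (hδ : 0 < δ) (m u : ℝ) :
    HasDerivAt (fun u => trunc k δ u ^ m) (trunc k δ u ^ m * (2 * m * truncSlope k δ u)) u := by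
  have hq := sq_add_sq_pos hk u
  have hD : 0 < 1 + δ * (u ^ 2 + k ^ 2) := by positivity
  have hT := trunc_pos hk hδ u
  have h1 : HasDerivAt (fun u : ℝ => u ^ 2 + k ^ 2) (2 * u) u := by
    simpa using (hasDerivAt_pow 2 u).add_const (k ^ 2)
  have h2 : HasDerivAt (fun u : ℝ => 1 + δ * (u ^ 2 + k ^ 2)) (δ * (2 * u)) u :=
    (h1.const_mul δ).const_add 1
  have h3 := (h1.div h2 hD.ne').rpow_const (p := m) (Or.inl hT.ne')
  refine h3.congr_deriv ?_
  change (2 * u * (1 + δ * (u ^ 2 + k ^ 2)) - (u ^ 2 + k ^ 2) * (δ * (2 * u))) /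
    (1 + δ * (u ^ 2 + k ^ 2)) ^ 2 * m * trunc k δ u ^ (m - 1) = _
  rw [Real.rpow_sub_one hT.ne', trunc, truncSlope]
  field_simp
  ring

theorem hasDerivAt_powProfile (hk : 0 < k) (hδ : 0 < δ) (l u : ℝ) :
    HasDerivAt (powProfile k δ l) (powProfileDeriv k δ l u) u := by
  have hq := sq_add_sq_pos hk u
  have h1 : HasDerivAt (fun u : ℝ => u ^ 2 + k ^ 2) (2 * u) u := by
    simpa using (hasDerivAt_pow 2 u).add_const (k ^ 2)
  refine ((h1.sqrt hq.ne').mul (hasDerivAt_trunc_rpow hk hδ (l / 2) u)).congr_deriv ?_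
  rw [powProfileDeriv]
  field_simp

theorem hasDerivAt_testProfile (hk : 0 < k) (hδ : 0 < δ) (l u : ℝ) :
    HasDerivAt (testProfile k δ l) (testProfileDeriv k δ l u) u := by
  refine ((hasDerivAt_id' u).mul (hasDerivAt_trunc_rpow hk hδ (l / 2) u)).congr_deriv ?_
  rw [testProfileDeriv]
  ring

theorem continuous_trunc_rpow (hk : 0 < k) (hδ : 0 < δ) (m : ℝ) :
    Continuous fun u => trunc k δ u ^ m :=
  continuous_iff_continuousAt.2 fun u => (hasDerivAt_trunc_rpow hk hδ m u).continuousAt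

theorem continuous_truncSlope (hk : 0 < k) (hδ : 0 < δ) : Continuous (truncSlope k δ) := by
  unfold truncSlope
  refine continuous_id.div (by fun_prop) fun u => ?_
  have := sq_add_sq_pos hk u
  positivity

theorem continuous_powProfileDeriv (hk : 0 < k) (hδ : 0 < δ) (l : ℝ) :
    Continuous (powProfileDeriv k δ l) := by
  unfold powProfileDeriv
  refine (continuous_trunc_rpow hk hδ _).mul (Continuous.add ?_ ?_)
  · refine continuous_id.div (by fun_prop) fun u => ?_
    exact (Real.sqrt_pos.2 (sq_add_sq_pos hk u)).ne'
  · exact Continuous.mul (by fun_prop) (continuous_truncSlope hk hδ)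

theorem continuous_testProfileDeriv (hk : 0 < k) (hδ : 0 < δ) (l : ℝ) :
    Continuous (testProfileDeriv k δ l) := by
  unfold testProfileDeriv
  refine (continuous_trunc_rpow hk hδ _).mul (Continuous.add (by fun_prop) ?_)
  exact Continuous.mul (by fun_prop) (continuous_truncSlope hk hδ)

theorem abs_le_sqrt_sq_add_sq (k u : ℝ) : |u| ≤ √(u ^ 2 + k ^ 2) :=
  Real.abs_le_sqrt (by nlinarith [sq_nonneg k])

theorem mul_truncSlope_nonneg (hk : 0 < k) (hδ : 0 < δ) (u : ℝ) :
    0 ≤ u * truncSlope k δ u := by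
  have := sq_add_sq_pos hk u
  rw [truncSlope, ← mul_div_assoc, ← sq]
  positivity

/-- With `q = u² + k²` this is `√q |u| ≤ q ≤ q (1 + δ q)`. It makes the derivative bounds below
depend on `δ` only through `trunc`, so that `δ` can tend to zero later. -/
theorem sqrt_mul_abs_truncSlope_le (hk : 0 < k) (hδ : 0 < δ) (u : ℝ) :
    √(u ^ 2 + k ^ 2) * |truncSlope k δ u| ≤ 1 := by
  have hq := sq_add_sq_pos hk u
  have hs := Real.sqrt_pos.2 hq
  have hD : 1 ≤ 1 + δ * (u ^ 2 + k ^ 2) := by nlinarith [mul_pos hδ hq]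
  rw [truncSlope, abs_div, abs_of_pos (mul_pos hq (by linarith)), ← mul_div_assoc,
    div_le_one (mul_pos hq (by linarith))]
  have h1 : √(u ^ 2 + k ^ 2) * |u| ≤ u ^ 2 + k ^ 2 := by
    calc _ ≤ √(u ^ 2 + k ^ 2) * √(u ^ 2 + k ^ 2) := by
          gcongr; exact abs_le_sqrt_sq_add_sq k u
      _ = _ := Real.mul_self_sqrt hq.le
  nlinarith

theorem abs_powProfileDeriv_le (hk : 0 < k) (hδ : 0 < δ) (hl : 0 ≤ l) (u : ℝ) :
    |powProfileDeriv k δ l u| ≤ (1 + l) * trunc k δ u ^ (l / 2) := by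
  have hq := sq_add_sq_pos hk u
  have hs := Real.sqrt_pos.2 hq
  have hT := Real.rpow_nonneg (trunc_pos hk hδ u).le (l / 2)
  rw [powProfileDeriv, abs_mul, abs_of_nonneg hT, mul_comm]
  refine mul_le_mul_of_nonneg_right ((abs_add_le _ _).trans (add_le_add ?_ ?_)) hT
  · rw [abs_div, abs_of_pos hs, div_le_one hs]
    exact abs_le_sqrt_sq_add_sq k u
  · rw [abs_mul, abs_mul, abs_of_nonneg hl, abs_of_pos hs, mul_assoc]
    exact mul_le_of_le_one_right hl (sqrt_mul_abs_truncSlope_le hk hδ u)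

/-- The truncation increases with `|u|`, so its contribution to the derivative has a good sign and
ellipticity keeps its full strength. -/
theorem le_testProfileDeriv (hk : 0 < k) (hδ : 0 < δ) (hl : 0 ≤ l) (u : ℝ) :
    trunc k δ u ^ (l / 2) ≤ testProfileDeriv k δ l u := by
  have hT := Real.rpow_nonneg (trunc_pos hk hδ u).le (l / 2)
  rw [testProfileDeriv]
  refine le_mul_of_one_le_right hT ?_
  have := mul_nonneg hl (mul_truncSlope_nonneg hk hδ u)
  nlinarith

theorem testProfileDeriv_le (hk : 0 < k) (hδ : 0 < δ) (hl : 0 ≤ l) (u : ℝ) :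
    testProfileDeriv k δ l u ≤ (1 + l) * trunc k δ u ^ (l / 2) := by
  have hT := Real.rpow_nonneg (trunc_pos hk hδ u).le (l / 2)
  rw [testProfileDeriv, mul_comm]
  refine mul_le_mul_of_nonneg_right ?_ hT
  have h1 : u * truncSlope k δ u ≤ 1 := by
    refine (le_abs_self _).trans ?_
    rw [abs_mul]
    refine le_trans ?_ (sqrt_mul_abs_truncSlope_le hk hδ u)
    gcongr
    exact abs_le_sqrt_sq_add_sq k u
  nlinarith [mul_le_mul_of_nonneg_left h1 hl]

theorem abs_testProfile_le (hk : 0 < k) (hδ : 0 < δ) (u : ℝ) :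
    |testProfile k δ l u| ≤ √(u ^ 2 + k ^ 2) * trunc k δ u ^ (l / 2) := by
  have hT := Real.rpow_nonneg (trunc_pos hk hδ u).le (l / 2)
  rw [testProfile, abs_mul, abs_of_nonneg hT]
  gcongr
  exact abs_le_sqrt_sq_add_sq k u

theorem trunc_rpow_le (hk : 0 < k) (hδ : 0 < δ) (hl : 0 ≤ l) (u : ℝ) :
    trunc k δ u ^ (l / 2) ≤ δ⁻¹ ^ (l / 2) :=
  Real.rpow_le_rpow (trunc_pos hk hδ u).le (trunc_le_inv hk hδ u) (by positivity)

theorem powProfile_nonneg (hk : 0 < k) (hδ : 0 < δ) (u : ℝ) : 0 ≤ powProfile k δ l u :=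
  mul_nonneg (Real.sqrt_nonneg _) (Real.rpow_nonneg (trunc_pos hk hδ u).le _)

theorem powProfile_le (hk : 0 < k) (hδ : 0 < δ) (hl : 0 ≤ l) (u : ℝ) :
    powProfile k δ l u ≤ √(u ^ 2 + k ^ 2) ^ (1 + l) := by
  have hq := sq_add_sq_pos hk u
  have hs := Real.sqrt_pos.2 hq
  rw [powProfile, Real.rpow_add hs, Real.rpow_one]
  gcongr
  calc _ ≤ (u ^ 2 + k ^ 2) ^ (l / 2) :=
        Real.rpow_le_rpow (trunc_pos hk hδ u).le (trunc_le hk hδ u) (by positivity)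
    _ = _ := by
        rw [Real.sqrt_eq_rpow, ← Real.rpow_mul hq.le]
        congr 1; ring

/-- The constant depends on `δ` and is used only qualitatively: linear growth places the profile of
`u` in `L^{pσ}` for every `l`, and this finiteness makes the absorption legitimate. -/
theorem powProfile_le_linear (hk : 0 < k) (hδ : 0 < δ) (hl : 0 ≤ l) (u : ℝ) :
    powProfile k δ l u ≤ δ⁻¹ ^ (l / 2) * √(u ^ 2 + k ^ 2) := by
  rw [powProfile, mul_comm]
  exact mul_le_mul_of_nonneg_right (trunc_rpow_le hk hδ hl u) (Real.sqrt_nonneg _)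

theorem tendsto_powProfile (hk : 0 < k) (l u : ℝ) :
    Tendsto (fun i : ℕ => powProfile k (1 / ((i : ℝ) + 1)) l u) atTop
      (𝓝 (√(u ^ 2 + k ^ 2) ^ (1 + l))) := by
  have hq := sq_add_sq_pos hk u
  have hs := Real.sqrt_pos.2 hq
  have h1 : Tendsto (fun i : ℕ => trunc k (1 / ((i : ℝ) + 1)) u) atTop (𝓝 (u ^ 2 + k ^ 2)) := by
    have h2 : Tendsto (fun i : ℕ => 1 + 1 / ((i : ℝ) + 1) * (u ^ 2 + k ^ 2)) atTop (𝓝 1) := by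
      simpa using (tendsto_one_div_add_atTop_nhds_zero_nat.mul_const (u ^ 2 + k ^ 2)).const_add 1
    have h3 := (tendsto_const_nhds (x := u ^ 2 + k ^ 2)).div h2 one_ne_zero
    rwa [div_one] at h3
  have h2 : √(u ^ 2 + k ^ 2) ^ (1 + l) = √(u ^ 2 + k ^ 2) * (u ^ 2 + k ^ 2) ^ (l / 2) := by
    rw [Real.rpow_add hs, Real.rpow_one, Real.sqrt_eq_rpow, ← Real.rpow_mul hq.le]
    congr 2; ring
  rw [h2]
  exact (h1.rpow_const (Or.inl hq.ne')).const_mul _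

theorem le_sqrt_sq_add_sq (k u : ℝ) : k ≤ √(u ^ 2 + k ^ 2) :=
  Real.le_sqrt_of_sq_le (by nlinarith [sq_nonneg u])

theorem sqrt_sq_add_sq_le (hk : 0 < k) (u : ℝ) : √(u ^ 2 + k ^ 2) ≤ |u| + k := by
  rw [Real.sqrt_le_left (by positivity), ← sq_abs u]
  nlinarith [mul_nonneg (abs_nonneg u) hk.le]

end Profiles

/-! ### Pointwise inequalities behind the energy estimate. -/

section PointwiseEnergy

/-- Young's inequality by comparing `W` with `κ Y ^ m`: in either case a single term on the right
already suffices. -/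
theorem rpow_mul_le_add {Y W κ p m : ℝ} (hY : 0 ≤ Y) (hW : 0 ≤ W) (hκ : 0 < κ) (hm : 0 < m)
    (hmp : m ≤ p) : Y ^ (p - m) * W ≤ κ * Y ^ p + κ⁻¹ ^ ((p - m) / m) * W ^ (p / m) := by
  have hp : 0 < p := by linarith
  rcases le_total W (κ * Y ^ m) with h | h
  · have h1 : Y ^ (p - m) * W ≤ κ * Y ^ p := by
      calc Y ^ (p - m) * W ≤ Y ^ (p - m) * (κ * Y ^ m) := by gcongr
        _ = κ * (Y ^ (p - m) * Y ^ m) := by ring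
        _ = κ * Y ^ p := by
            rw [← Real.rpow_add_of_nonneg hY (by linarith) hm.le, sub_add_cancel]
    have h2 : 0 ≤ κ⁻¹ ^ ((p - m) / m) * W ^ (p / m) := by positivity
    linarith
  · have h1 : Y ≤ (κ⁻¹ * W) ^ (1 / m) := by
      rw [one_div, Real.le_rpow_inv_iff_of_pos hY (by positivity) hm, inv_mul_eq_div,
        le_div_iff₀ hκ, mul_comm]
      exact h
    have h2 : Y ^ (p - m) * W ≤ κ⁻¹ ^ ((p - m) / m) * W ^ (p / m) := by
      calc Y ^ (p - m) * W ≤ ((κ⁻¹ * W) ^ (1 / m)) ^ (p - m) * W := by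
            gcongr
        _ = κ⁻¹ ^ ((p - m) / m) * (W ^ ((p - m) / m) * W ^ (1 : ℝ)) := by
            rw [← Real.rpow_mul (by positivity), Real.mul_rpow (by positivity) hW, Real.rpow_one,
              mul_assoc, one_div_mul_eq_div]
        _ = _ := by
            rw [← Real.rpow_add_of_nonneg hW (div_nonneg (by linarith) hm.le) zero_le_one]
            congr 2
            field_simp
            ring
    have h3 : 0 ≤ κ * Y ^ p := by positivity
    linarith

/-- Since `ω ≥ k`, the factor `k ^ (-q) ω ^ q` is at least one; this is the origin of `b̄`, `d̄` and
`h̄`. -/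
theorem add_le_bar_mul_rpow {h g t ω k q : ℝ} (hq : 0 ≤ q) (hk : 0 < k) (hω : k ≤ ω) (hh : 0 ≤ h)
    (hg : 0 ≤ g) (ht0 : 0 ≤ t) (ht : t ≤ ω) : h * t ^ q + g ≤ (h + k ^ (-q) * g) * ω ^ q := by
  have h1 : t ^ q ≤ ω ^ q := Real.rpow_le_rpow ht0 ht hq
  have h2 : 1 ≤ k ^ (-q) * ω ^ q := by
    rw [Real.rpow_neg hk.le, inv_mul_eq_div, one_le_div (by positivity)]
    exact Real.rpow_le_rpow hk.le hω hq
  nlinarith [mul_le_mul_of_nonneg_left h1 hh, mul_le_mul_of_nonneg_left h2 hg]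

/-- Constants of the pointwise energy inequality. -/
noncomputable def energyConst₁ (a p : ℝ) : ℝ := p * a * (4 * p * a ^ 2) ^ (p - 1)

/-- The Young constant `κ⁻¹ ^ ((p - m) / m)` for `κ = (4 a)⁻¹` and `m = p + 1 - ψ`. -/
noncomputable def energyConst₂ (a p ψ : ℝ) : ℝ := (4 * a) ^ ((ψ - 1) / (p + 1 - ψ))

/-- The lower bound for `G'` serves the coercive part of `I`, the upper bound the part with `h` and
`g`; the factor `p (1 + l)` comes from `1 + p l ≤ p (1 + l)`. -/
theorem pointwise_elliptic {a p l η X ω u y G' g h h' I : ℝ}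
    (ha : 1 < a) (hp : 1 < p) (hη0 : 0 ≤ η) (hX : 0 ≤ X) (hω : 0 < ω)
    (hy : 0 < y) (hG'1 : y ^ p ≤ G') (hG'2 : G' ≤ (1 + p * l) * y ^ p) (hh' : 0 ≤ h')
    (hbar : h * |u| ^ p + g ≤ h' * ω ^ p) (hI : a⁻¹ * X ^ p - h * |u| ^ p - g ≤ I) :
    a⁻¹ * (η * y * X) ^ p - (η * (ω * y)) ^ p * (p * (1 + l) * h') ≤ η ^ p * G' * I := by
  have hηp : 0 ≤ η ^ p := by positivity
  have hyp : 0 < y ^ p := by positivity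
  have hωp : 0 < ω ^ p := by positivity
  have hXp : 0 ≤ X ^ p := by positivity
  have eY : (η * y * X) ^ p = η ^ p * y ^ p * X ^ p := by
    rw [Real.mul_rpow (by positivity) hX, Real.mul_rpow hη0 hy.le]
  have eF : (η * (ω * y)) ^ p = η ^ p * (ω ^ p * y ^ p) := by
    rw [Real.mul_rpow hη0 (by positivity), Real.mul_rpow hω.le hy.le]
  have hG'0 : 0 ≤ G' := hyp.le.trans hG'1
  have hax : 0 ≤ a⁻¹ * X ^ p := mul_nonneg (inv_nonneg.2 (by linarith)) hXp
  have s1 : G' * (a⁻¹ * X ^ p - h' * ω ^ p) ≤ G' * I :=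
    mul_le_mul_of_nonneg_left (by linarith) hG'0
  have s2 : y ^ p * (a⁻¹ * X ^ p) ≤ G' * (a⁻¹ * X ^ p) :=
    mul_le_mul_of_nonneg_right hG'1 hax
  have s3 : G' * (h' * ω ^ p) ≤ (p * (1 + l)) * y ^ p * (h' * ω ^ p) := by
    refine mul_le_mul_of_nonneg_right (hG'2.trans ?_) (by positivity)
    refine mul_le_mul_of_nonneg_right ?_ hyp.le
    rw [mul_add, mul_one]
    linarith
  have s4 : y ^ p * (a⁻¹ * X ^ p) - (p * (1 + l)) * y ^ p * (h' * ω ^ p) ≤ G' * I := by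
    rw [mul_sub] at s1
    linarith
  rw [eY, eF]
  calc _ = η ^ p * (y ^ p * (a⁻¹ * X ^ p) - (p * (1 + l)) * y ^ p * (h' * ω ^ p)) := by ring
    _ ≤ η ^ p * (G' * I) := mul_le_mul_of_nonneg_left s4 hηp
    _ = _ := by ring

/-- The factor `y ^ p` splits as `y ^ (p - 1) y`: the first part joins `X ^ (p - 1)` to form the
energy density, the second joins `E ω`. -/
theorem pointwise_cutoff {a p η X E ω y G b' J : ℝ}
    (ha : 1 < a) (hp : 1 < p) (hη0 : 0 ≤ η) (hX : 0 ≤ X) (hE : 0 ≤ E) (hω : 0 < ω)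
    (hy : 0 < y) (hG : |G| ≤ ω * y ^ p)
    (hJ : |J| ≤ p * η ^ (p - 1) * E * (a * X ^ (p - 1) + b' * ω ^ (p - 1))) :
    |G * J| ≤ ((4 * a)⁻¹ * (η * y * X) ^ p + energyConst₁ a p * (E * (ω * y)) ^ p) +
      p * (E * (ω * y) * b' * (η * (ω * y)) ^ (p - 1)) := by
  have ha0 : 0 < a := by linarith
  have hp0 : 0 < p := by linarith
  have eF1 : (η * (ω * y)) ^ (p - 1) = η ^ (p - 1) * (ω ^ (p - 1) * y ^ (p - 1)) := by
    rw [Real.mul_rpow hη0 (by positivity), Real.mul_rpow hω.le hy.le]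
  have eY1 : (η * y * X) ^ (p - 1) = η ^ (p - 1) * y ^ (p - 1) * X ^ (p - 1) := by
    rw [Real.mul_rpow (by positivity) hX, Real.mul_rpow hη0 hy.le]
  have ey : y ^ p = y ^ (p - 1) * y := by
    rw [← Real.rpow_add_one hy.ne', sub_add_cancel]
  have t2 : |G * J| ≤ p * a * ((η * y * X) ^ (p - 1) * (E * (ω * y))) +
      p * (E * (ω * y) * b' * (η * (ω * y)) ^ (p - 1)) := by
    rw [abs_mul]
    calc |G| * |J| ≤ ω * y ^ p * (p * η ^ (p - 1) * E * (a * X ^ (p - 1) + b' * ω ^ (p - 1))) :=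
          mul_le_mul hG hJ (abs_nonneg _) (by positivity)
      _ = _ := by
          rw [eY1, eF1, ey]
          ring
  refine t2.trans (add_le_add_left ?_ _)
  -- The choice of `κ` gives `p a κ = (4 a)⁻¹`, a quarter of the coercive term.
  have s1 := rpow_mul_le_add (Y := η * y * X) (W := E * (ω * y)) (κ := (4 * p * a ^ 2)⁻¹) (p := p)
    (m := 1) (by positivity) (by positivity) (by positivity) one_pos hp.le
  rw [inv_inv, div_one, div_one] at s1
  calc _ ≤ p * a * ((4 * p * a ^ 2)⁻¹ * (η * y * X) ^ p +
          (4 * p * a ^ 2) ^ (p - 1) * (E * (ω * y)) ^ p) :=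
        mul_le_mul_of_nonneg_left s1 (by positivity)
    _ = _ := by
        rw [energyConst₁]
        field_simp

/-- With `m = p + 1 - ψ` in `(0, 1]` the `c`-term is `(η y X) ^ (p - m)` times a function free of
the gradient. Young's inequality raises the latter to the power `p / m`, which produces the
exponents of `c` and `ū` in `Z̄`. -/
theorem pointwise_lower_order {a p ψ η X ω y G c d' B : ℝ}
    (ha : 1 < a) (hp : 1 < p) (hψ₀ : p ≤ ψ) (hψ₁ : ψ < p + 1)
    (hη0 : 0 ≤ η) (hX : 0 ≤ X) (hω : 0 < ω) (hy : 0 < y) (hG : |G| ≤ ω * y ^ p)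
    (hc : 0 ≤ c) (hB : |B| ≤ c * X ^ (ψ - 1) + d' * ω ^ (p - 1)) :
    |η ^ p * G * B| ≤ (4 * a)⁻¹ * (η * y * X) ^ p +
      (η * (ω * y)) ^ p * (energyConst₂ a p ψ *
        (c ^ (p / (p + 1 - ψ)) * ω ^ (p * (ψ - p) / (p + 1 - ψ)))) + (η * (ω * y)) ^ p * d' := by
  have ha0 : 0 < a := by linarith
  have hp0 : 0 < p := by linarith
  have hm0 : 0 < p + 1 - ψ := by linarith
  obtain ⟨m, hm⟩ : ∃ m, m = p + 1 - ψ := ⟨_, rfl⟩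
  have hψm : ψ - 1 = p - m := by rw [hm]; ring
  have hm1 : m ≤ 1 := by linarith
  rw [energyConst₂, ← hm, hψm]
  rw [← hm] at hm0
  rw [hψm] at hB
  have hηp : 0 ≤ η ^ p := by positivity
  have eF : (η * (ω * y)) ^ p = η ^ p * (ω ^ p * y ^ p) := by
    rw [Real.mul_rpow hη0 (by positivity), Real.mul_rpow hω.le hy.le]
  have eω : ω ^ p = ω ^ (p - 1) * ω := by
    rw [← Real.rpow_add_one hω.ne', sub_add_cancel]
  have t3 : |η ^ p * G * B| ≤ (η * y * X) ^ (p - m) * (c * ω * η ^ m * y ^ m) +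
      (η * (ω * y)) ^ p * d' := by
    rw [abs_mul, abs_mul, abs_of_nonneg hηp]
    calc η ^ p * |G| * |B| ≤ η ^ p * (ω * y ^ p) * (c * X ^ (p - m) + d' * ω ^ (p - 1)) :=
          mul_le_mul (mul_le_mul_of_nonneg_left hG hηp) hB (abs_nonneg _) (by positivity)
      _ = (η ^ p * y ^ p * X ^ (p - m)) * (c * ω) + η ^ p * (ω ^ (p - 1) * ω * y ^ p) * d' := by
          ring
      _ = _ := by
          have r1 : η ^ p = η ^ (p - m) * η ^ m := by
            rw [← Real.rpow_add_of_nonneg hη0 (by linarith) hm0.le, sub_add_cancel]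
          have r2 : y ^ p = y ^ (p - m) * y ^ m := by
            rw [← Real.rpow_add hy, sub_add_cancel]
          rw [← eω, eF, Real.mul_rpow (by positivity) hX, Real.mul_rpow hη0 hy.le]
          congr 1
          rw [r1, r2]
          ring
  refine t3.trans (add_le_add_left ?_ _)
  have s1 := rpow_mul_le_add (Y := η * y * X) (W := c * ω * η ^ m * y ^ m) (κ := (4 * a)⁻¹)
    (p := p) (m := m) (by positivity) (by positivity) (by positivity) hm0 (by linarith)
  refine s1.trans (le_of_eq ?_)
  have r1 : (c * ω * η ^ m * y ^ m) ^ (p / m) = c ^ (p / m) * ω ^ (p / m) * η ^ p * y ^ p := by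
    rw [Real.mul_rpow (by positivity) (by positivity), Real.mul_rpow (by positivity)
      (by positivity), Real.mul_rpow hc hω.le, ← Real.rpow_mul hη0, ← Real.rpow_mul hy.le,
      mul_div_cancel₀ p hm0.ne']
  -- From `ψ - p + m = 1`: one factor `ω ^ p` belongs to the power of the solution, the rest stays
  -- with `c`.
  have r2 : ω ^ (p / m) = ω ^ (p * (ψ - p) / m) * ω ^ p := by
    rw [← Real.rpow_add hω]
    congr 1
    have : ψ = p + 1 - m := by linarith
    rw [this]
    field_simp
    ring
  rw [inv_inv, r1, r2, eF]
  ring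

/-- The pointwise inequality behind the energy estimate: `J` and `I` stand for
`⟨∇(η^p), A⟩` and `⟨∇u, A⟩`. -/
theorem pointwise_energy {a p ψ l k η X E ω u y G G' b c d e f g h I J A' B : ℝ}
    (ha : 1 < a) (hp : 1 < p) (hψ₀ : p ≤ ψ) (hψ₁ : ψ < p + 1)
    (hη0 : 0 ≤ η) (hX : 0 ≤ X) (hE : 0 ≤ E) (hk : 0 < k) (hω : k ≤ ω) (hu : |u| ≤ ω)
    (hy : 0 < y) (hG'1 : y ^ p ≤ G') (hG'2 : G' ≤ (1 + p * l) * y ^ p) (hG : |G| ≤ ω * y ^ p)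
    (hb : 0 ≤ b) (hc : 0 ≤ c) (hd : 0 ≤ d) (he : 0 ≤ e) (hf : 0 ≤ f) (hg : 0 ≤ g) (hh : 0 ≤ h)
    (hI : a⁻¹ * X ^ p - h * |u| ^ p - g ≤ I)
    (hJ : |J| ≤ p * η ^ (p - 1) * E * A')
    (hA' : A' ≤ a * X ^ (p - 1) + b * |u| ^ (p - 1) + e)
    (hB : |B| ≤ c * X ^ (ψ - 1) + d * |u| ^ (p - 1) + f) :
    (2 * a)⁻¹ * (η * y * X) ^ p ≤ (G * J + η ^ p * G' * I + η ^ p * G * B) +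
      (energyConst₁ a p * (E * (ω * y)) ^ p +
        p * (E * (ω * y) * (b + k ^ (1 - p) * e) * (η * (ω * y)) ^ (p - 1)) +
        (η * (ω * y)) ^ p * (p * (1 + l) * (h + k ^ (-p) * g) + (d + k ^ (1 - p) * f) +
          energyConst₂ a p ψ * (c ^ (p / (p + 1 - ψ)) * ω ^ (p * (ψ - p) / (p + 1 - ψ))))) := by
  have hω0 : 0 < ω := hk.trans_le hω
  have hp0 : 0 < p := by linarith
  have hp1 : 0 ≤ p - 1 := by linarith
  have ek : k ^ (1 - p) = k ^ (-(p - 1)) := by congr 1; ring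
  have hbar1 := add_le_bar_mul_rpow hp0.le hk hω hh hg (abs_nonneg u) hu
  have hbar2 := add_le_bar_mul_rpow hp1 hk hω hb he (abs_nonneg u) hu
  have hbar3 := add_le_bar_mul_rpow hp1 hk hω hd hf (abs_nonneg u) hu
  rw [← ek] at hbar2 hbar3
  have hh'0 : 0 ≤ h + k ^ (-p) * g := by positivity
  have t1 := pointwise_elliptic ha hp hη0 hX hω0 hy hG'1 hG'2 hh'0 hbar1 hI
  have t2 := pointwise_cutoff ha hp hη0 hX hE hω0 hy hG
    (hJ.trans (mul_le_mul_of_nonneg_left (hA'.trans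
      (by linarith : _ ≤ a * X ^ (p - 1) + (b + k ^ (1 - p) * e) * ω ^ (p - 1))) (by positivity)))
  have t3 := pointwise_lower_order ha hp hψ₀ hψ₁ hη0 hX hω0 hy hG hc
    (hB.trans (by linarith : _ ≤ c * X ^ (ψ - 1) + (d + k ^ (1 - p) * f) * ω ^ (p - 1)))
  -- The two quarters pay for the two applications of Young's inequality; half of the coercive term
  -- survives.
  have e4 : a⁻¹ = (2 * a)⁻¹ + (4 * a)⁻¹ + (4 * a)⁻¹ := by
    have : a ≠ 0 := by linarith
    field_simp; norm_num
  have n2 := neg_abs_le (G * J)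
  have n3 := neg_abs_le (η ^ p * G * B)
  rw [e4, add_mul, add_mul] at t1
  rw [mul_add ((η * (ω * y)) ^ p), mul_add ((η * (ω * y)) ^ p)]
  linarith

end PointwiseEnergy

/-! ### Hölder estimates and absorption. -/

section MoserStep

variable {α : Type*} [MeasurableSpace α] {μ : Measure α}

theorem lintegral_rpow_mul₃_le {f g h : α → ℝ≥0∞} (hf : AEMeasurable f μ) (hg : AEMeasurable g μ)
    (hh : AEMeasurable h μ) {a b c : ℝ} (ha : 0 ≤ a) (hb : 0 ≤ b) (hc : 0 ≤ c)
    (habc : a + b + c = 1) :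
    ∫⁻ x, f x ^ a * g x ^ b * h x ^ c ∂μ ≤
      (∫⁻ x, f x ∂μ) ^ a * (∫⁻ x, g x ∂μ) ^ b * (∫⁻ x, h x ∂μ) ^ c := by
  have := ENNReal.lintegral_prod_norm_pow_le (μ := μ) (Finset.univ : Finset (Fin 3))
    (f := ![f, g, h]) (p := ![a, b, c])
    (by intro i _; fin_cases i <;> assumption)
    (by simpa [Fin.sum_univ_three] using habc)
    (by intro i _; fin_cases i <;> assumption)
  simpa [Fin.prod_univ_three] using this

/-- Hölder with `1 / p + 1 / (p' σ') + (p - 1) / (p σ) = 1`. -/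
theorem lintegral_mul_mul_rpow_le {p σ : ℝ} (hp : 1 < p) (hσ : 1 < σ) {P b w : α → ℝ≥0∞}
    (hP : AEMeasurable P μ) (hb : AEMeasurable b μ) (hw : AEMeasurable w μ) :
    ∫⁻ x, P x * b x * w x ^ (p - 1) ∂μ ≤ (∫⁻ x, P x ^ p ∂μ) ^ (1 / p) *
      (∫⁻ x, b x ^ (p.conjExponent * σ.conjExponent) ∂μ) ^
        (1 / (p.conjExponent * σ.conjExponent)) *
      ((∫⁻ x, w x ^ (p * σ) ∂μ) ^ (1 / (p * σ))) ^ (p - 1) := by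
  have hp1 : 0 < p - 1 := by linarith
  have hσ1 : 0 < σ - 1 := by linarith
  have hq : 0 < p.conjExponent * σ.conjExponent := by
    unfold Real.conjExponent; positivity
  have h := lintegral_rpow_mul₃_le (μ := μ) (hP.pow_const p)
    (hb.pow_const (p.conjExponent * σ.conjExponent)) (hw.pow_const (p * σ))
    (a := 1 / p) (b := 1 / (p.conjExponent * σ.conjExponent)) (c := (p - 1) / (p * σ))
    (by positivity) (by positivity) (by positivity) (by
      unfold Real.conjExponent; field_simp; ring)
  refine le_trans (le_of_eq (lintegral_congr fun x => ?_)) (h.trans_eq ?_)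
  · rw [← ENNReal.rpow_mul, ← ENNReal.rpow_mul, ← ENNReal.rpow_mul, mul_one_div_cancel (by linarith),
      mul_one_div_cancel hq.ne', mul_div_cancel₀ _ (by positivity), ENNReal.rpow_one,
      ENNReal.rpow_one]
  · rw [← ENNReal.rpow_mul _ (1 / (p * σ)), one_div_mul_eq_div]

/-- Writing `w ^ p = w ^ (p - ε) w ^ ε` and placing only the first factor in the high space `L^{pσ}`
leaves a power of that norm strictly below `p`, which is what absorption requires. -/
theorem lintegral_rpow_mul_le {p σ ε : ℝ} (hp : 1 < p) (hσ : 1 < σ) (hε : 0 < ε) (hε1 : ε ≤ 1)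
    {h w : α → ℝ≥0∞} (hh : AEMeasurable h μ) (hw : AEMeasurable w μ) :
    ∫⁻ x, w x ^ p * h x ∂μ ≤
      (∫⁻ x, h x ^ (p * σ.conjExponent / (p - ε)) ∂μ) ^ (1 / (p * σ.conjExponent / (p - ε))) *
      ((∫⁻ x, w x ^ (p * σ) ∂μ) ^ (1 / (p * σ))) ^ (p - ε) *
      ((∫⁻ x, w x ^ p ∂μ) ^ (1 / p)) ^ ε := by
  have hp1 : 0 < p - ε := by linarith
  have hσ1 : 0 < σ - 1 := by linarith
  have hq : 0 < p * σ.conjExponent / (p - ε) := by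
    unfold Real.conjExponent; positivity
  have H := lintegral_rpow_mul₃_le (μ := μ) (hh.pow_const (p * σ.conjExponent / (p - ε)))
    (hw.pow_const (p * σ)) (hw.pow_const p)
    (a := 1 / (p * σ.conjExponent / (p - ε))) (b := (p - ε) / (p * σ)) (c := ε / p)
    (by positivity) (by positivity) (by positivity) (by
      unfold Real.conjExponent; field_simp; ring)
  refine le_trans (le_of_eq (lintegral_congr fun x => ?_)) (H.trans_eq ?_)
  · rw [← ENNReal.rpow_mul, ← ENNReal.rpow_mul, ← ENNReal.rpow_mul,
      mul_one_div_cancel hq.ne', mul_div_cancel₀ _ (by positivity), mul_div_cancel₀ _ (by linarith),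
      ENNReal.rpow_one, mul_assoc, ← ENNReal.rpow_add_of_nonneg _ _ hp1.le hε.le, sub_add_cancel,
      mul_comm]
  · rw [← ENNReal.rpow_mul _ (1 / (p * σ)), ← ENNReal.rpow_mul _ (1 / p), one_div_mul_eq_div,
      one_div_mul_eq_div]

theorem rpow_mul_rpow_le_of_le {x W : ℝ≥0∞} (hWx : W ≤ x) {p ε ε' : ℝ} (hε : 0 ≤ ε) (h : ε ≤ ε')
    (h' : ε' ≤ p) : W ^ ε' * x ^ (p - ε') ≤ W ^ ε * x ^ (p - ε) := by
  calc W ^ ε' * x ^ (p - ε') = W ^ ε * (W ^ (ε' - ε) * x ^ (p - ε')) := by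
        rw [← mul_assoc, ← ENNReal.rpow_add_of_nonneg _ _ hε (by linarith), add_sub_cancel]
    _ ≤ W ^ ε * (x ^ (ε' - ε) * x ^ (p - ε')) := by
        gcongr
    _ = _ := by
        rw [← ENNReal.rpow_add_of_nonneg _ _ (by linarith) (by linarith)]
        congr 2
        ring

/-- Absorption of the lower order powers of `x` in the Caccioppoli–Sobolev inequality. -/
theorem le_of_absorb {x W R S K A : ℝ≥0∞} {p ε ε₁ ε₂ ε₃ : ℝ} (hp : 1 < p) (hε : 0 < ε)
    (h₁ : ε ≤ ε₁) (h₁' : ε₁ ≤ 1) (h₂ : ε ≤ ε₂) (h₂' : ε₂ ≤ 1) (h₃ : ε ≤ ε₃) (h₃' : ε₃ ≤ 1)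
    (hx : x ≠ ∞) (hS : 1 ≤ S) (hK : 1 ≤ K) (hA : 1 ≤ A)
    (hsob : x ≤ S * (2 * W + A * R))
    (hen : R ^ p ≤ K * A * (W ^ p + W * x ^ (p - 1) + W ^ ε₁ * x ^ (p - ε₁) +
      W ^ ε₂ * x ^ (p - ε₂) + W ^ ε₃ * x ^ (p - ε₃))) :
    x ≤ (7 * S * K * A ^ 2) ^ (p / ε) * W := by
  have hp0 : 0 < p := by linarith
  have hSKA : 1 ≤ 7 * S * K * A ^ 2 := by
    calc (1 : ℝ≥0∞) = 1 * 1 * 1 * 1 ^ 2 := by norm_num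
      _ ≤ 7 * S * K * A ^ 2 := by gcongr; norm_num
  -- If `x ≤ W` there is nothing to absorb. Otherwise a smaller exponent on `W` only increases the
  -- mixed products, and all five terms are at most `W ^ ε * x ^ (p - ε)`.
  rcases le_total x W with hxW | hWx
  · calc x ≤ 1 * W := by rwa [one_mul]
      _ ≤ _ := by
          gcongr
          exact ENNReal.one_le_rpow hSKA (by positivity)
  · rcases eq_or_ne x 0 with h0 | h0
    · rw [h0]; exact zero_le
    set θ := ε / p with hθ
    have hθ0 : 0 < θ := by positivity
    have hθ1 : θ ≤ 1 := by rw [hθ, div_le_one hp0]; linarith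
    have hKA : 1 ≤ 5 * (K * A) := by
      calc (1 : ℝ≥0∞) = 1 * (1 * 1) := by norm_num
        _ ≤ 5 * (K * A) := by gcongr; norm_num
    have hR : R ≤ (5 * (K * A)) * (W ^ θ * x ^ (1 - θ)) := by
      have h5 : R ^ p ≤ 5 * (K * A) * (W ^ ε * x ^ (p - ε)) := by
        refine hen.trans ?_
        have e1 : W ^ p ≤ W ^ ε * x ^ (p - ε) := by
          simpa using rpow_mul_rpow_le_of_le hWx hε.le (by linarith : ε ≤ p) le_rfl
        have e2 : W * x ^ (p - 1) ≤ W ^ ε * x ^ (p - ε) := by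
          simpa using rpow_mul_rpow_le_of_le hWx hε.le (by linarith : ε ≤ 1) hp.le
        have e3 := rpow_mul_rpow_le_of_le hWx hε.le h₁ (by linarith : ε₁ ≤ p)
        have e4 := rpow_mul_rpow_le_of_le hWx hε.le h₂ (by linarith : ε₂ ≤ p)
        have e5 := rpow_mul_rpow_le_of_le hWx hε.le h₃ (by linarith : ε₃ ≤ p)
        calc _ ≤ K * A * (W ^ ε * x ^ (p - ε) + W ^ ε * x ^ (p - ε) + W ^ ε * x ^ (p - ε) +
              W ^ ε * x ^ (p - ε) + W ^ ε * x ^ (p - ε)) := by gcongr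
          _ = _ := by ring
      calc R ≤ (5 * (K * A) * (W ^ ε * x ^ (p - ε))) ^ (1 / p) := by
            rwa [one_div, ENNReal.le_rpow_inv_iff hp0]
        _ = (5 * (K * A)) ^ (1 / p) * (W ^ θ * x ^ (1 - θ)) := by
            rw [ENNReal.mul_rpow_of_nonneg (5 * (K * A)) _ (by positivity),
              ENNReal.mul_rpow_of_nonneg (W ^ ε) _ (by positivity), ← ENNReal.rpow_mul,
              ← ENNReal.rpow_mul, mul_one_div, mul_one_div, sub_div, div_self hp0.ne']
        _ ≤ _ := by
            gcongr
            calc _ ≤ (5 * (K * A)) ^ (1 : ℝ) := ENNReal.rpow_le_rpow_of_exponent_le hKA (by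
                  rw [div_le_one hp0]; exact hp.le)
              _ = _ := ENNReal.rpow_one _
    have hW : W ≤ W ^ θ * x ^ (1 - θ) := by
      simpa using rpow_mul_rpow_le_of_le hWx hθ0.le hθ1 le_rfl
    -- The constant is `7 = 2 + 5`: two copies of `W` from the Sobolev estimate and five energy
    -- terms.
    have hxD : x ≤ (7 * S * K * A ^ 2) * (W ^ θ * x ^ (1 - θ)) := by
      calc x ≤ S * (2 * (W ^ θ * x ^ (1 - θ)) + A * ((5 * (K * A)) * (W ^ θ * x ^ (1 - θ)))) := by
            refine hsob.trans ?_
            gcongr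
        _ = S * (2 * (1 * 1 ^ 2) + 5 * (K * A ^ 2)) * (W ^ θ * x ^ (1 - θ)) := by ring
        _ ≤ S * (2 * (K * A ^ 2) + 5 * (K * A ^ 2)) * (W ^ θ * x ^ (1 - θ)) := by gcongr
        _ = _ := by ring
    -- Division by `x ^ (1 - θ)` uses that `x` is finite and nonzero. Raising to the power `1 / θ =
    -- p / ε` afterwards affects only the constant, while `W` returns to the first power.
    have hxθ : x ^ θ ≤ (7 * S * K * A ^ 2) * W ^ θ := by
      have hne : x ^ (1 - θ) ≠ 0 := (ENNReal.rpow_pos (pos_iff_ne_zero.2 h0) hx).ne'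
      have hne' : x ^ (1 - θ) ≠ ∞ := ENNReal.rpow_ne_top_of_nonneg (by linarith) hx
      rw [← ENNReal.mul_le_mul_iff_left hne hne', ← ENNReal.rpow_add_of_nonneg _ _ hθ0.le
        (by linarith), add_sub_cancel, ENNReal.rpow_one, mul_assoc]
      exact hxD
    calc x = (x ^ θ) ^ (1 / θ) := by
          rw [← ENNReal.rpow_mul, mul_one_div_cancel hθ0.ne', ENNReal.rpow_one]
      _ ≤ ((7 * S * K * A ^ 2) * W ^ θ) ^ (1 / θ) := by gcongr
      _ = _ := by
          rw [ENNReal.mul_rpow_of_nonneg _ _ (by positivity), ← ENNReal.rpow_mul,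
            mul_one_div_cancel hθ0.ne', ENNReal.rpow_one, hθ, one_div_div]

/-- One step of the iteration: the energy estimate and the Sobolev estimate combine to a reverse
Hölder inequality. -/
theorem moser_step {p σ ε ε₁ ε₂ ε₃ : ℝ} (hp : 1 < p) (hσ : 1 < σ) (hε : 0 < ε)
    (hε₁ : ε ≤ ε₁) (hε₁' : ε₁ ≤ 1) (hε₂ : ε ≤ ε₂) (hε₂' : ε₂ ≤ 1) (hε₃ : ε ≤ ε₃) (hε₃' : ε₃ ≤ 1)
    {P Y w b g₁ g₂ g₃ : α → ℝ≥0∞} (hPm : AEMeasurable P μ) (hwm : AEMeasurable w μ)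
    (hbm : AEMeasurable b μ) (g₁m : AEMeasurable g₁ μ) (g₂m : AEMeasurable g₂ μ)
    (g₃m : AEMeasurable g₃ μ) {S K A M Z Φ r : ℝ≥0∞} (hS : 1 ≤ S) (hK : 1 ≤ K) (hA : 1 ≤ A)
    (hM : 1 ≤ M) (hZ : 1 ≤ Z)
    (hsob : (∫⁻ x, w x ^ (p * σ) ∂μ) ^ (1 / (p * σ)) ≤ S * (r * (∫⁻ x, P x ^ p ∂μ) ^ (1 / p) +
      A * (r * (∫⁻ x, Y x ^ p ∂μ) ^ (1 / p)) + (∫⁻ x, w x ^ p ∂μ) ^ (1 / p)))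
    (hen : ∫⁻ x, Y x ^ p ∂μ ≤ K * A * (∫⁻ x, P x ^ p ∂μ + ∫⁻ x, P x * b x * w x ^ (p - 1) ∂μ +
      ∫⁻ x, w x ^ p * g₁ x ∂μ + ∫⁻ x, w x ^ p * g₂ x ∂μ + ∫⁻ x, w x ^ p * g₃ x ∂μ))
    (hfin : (∫⁻ x, w x ^ (p * σ) ∂μ) ^ (1 / (p * σ)) ≠ ∞)
    (hP : r * (∫⁻ x, P x ^ p ∂μ) ^ (1 / p) ≤ M * Φ)
    (hw : (∫⁻ x, w x ^ p ∂μ) ^ (1 / p) ≤ Φ)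
    (hb : r ^ (p - 1) * (∫⁻ x, b x ^ (p.conjExponent * σ.conjExponent) ∂μ) ^
        (1 / (p.conjExponent * σ.conjExponent)) ≤ Z)
    (h₁ : (r ^ p * (∫⁻ x, g₁ x ^ (p * σ.conjExponent / (p - ε₁)) ∂μ) ^
      (1 / (p * σ.conjExponent / (p - ε₁)))) ^ (1 / ε₁) ≤ Z)
    (h₂ : (r ^ p * (∫⁻ x, g₂ x ^ (p * σ.conjExponent / (p - ε₂)) ∂μ) ^
      (1 / (p * σ.conjExponent / (p - ε₂)))) ^ (1 / ε₂) ≤ Z)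
    (h₃ : (r ^ p * (∫⁻ x, g₃ x ^ (p * σ.conjExponent / (p - ε₃)) ∂μ) ^
      (1 / (p * σ.conjExponent / (p - ε₃)))) ^ (1 / ε₃) ≤ Z) :
    (∫⁻ x, w x ^ (p * σ) ∂μ) ^ (1 / (p * σ)) ≤ (7 * S * K * A ^ 2) ^ (p / ε) * (M * Z * Φ) := by
  have hp0 : 0 < p := by linarith
  have hb' := lintegral_mul_mul_rpow_le (μ := μ) hp hσ hPm hbm hwm
  have h₁' := lintegral_rpow_mul_le (μ := μ) hp hσ (hε.trans_le hε₁) hε₁' g₁m hwm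
  have h₂' := lintegral_rpow_mul_le (μ := μ) hp hσ (hε.trans_le hε₂) hε₂' g₂m hwm
  have h₃' := lintegral_rpow_mul_le (μ := μ) hp hσ (hε.trans_le hε₃) hε₃' g₃m hwm
  set x := (∫⁻ x, w x ^ (p * σ) ∂μ) ^ (1 / (p * σ)) with hx
  set v := (∫⁻ x, w x ^ p ∂μ) ^ (1 / p) with hv
  set π := (∫⁻ x, P x ^ p ∂μ) ^ (1 / p) with hπ
  have hMZ : M * Φ ≤ M * Z * Φ := by
    calc M * Φ = M * 1 * Φ := by rw [mul_one]
      _ ≤ M * Z * Φ := by gcongr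
  have hZΦ : Z * Φ ≤ M * Z * Φ := by
    calc Z * Φ = 1 * Z * Φ := by rw [one_mul]
      _ ≤ M * Z * Φ := by gcongr
  have hΦ : Φ ≤ M * Z * Φ := by
    calc Φ = 1 * Φ := by rw [one_mul]
      _ ≤ Z * Φ := by gcongr
      _ ≤ _ := hZΦ
  -- The root in the definition of `Z̄` makes `Z` enter with the same exponent `e` as the norm `v ≤
  -- Φ`, so both merge into one power of `M Z Φ`.
  have hterm : ∀ {e : ℝ} {N : ℝ≥0∞}, 0 < e → (r ^ p * N) ^ (1 / e) ≤ Z →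
      r ^ p * (N * x ^ (p - e) * v ^ e) ≤ (M * Z * Φ) ^ e * x ^ (p - e) := by
    intro e N he hN
    rw [one_div, ENNReal.rpow_inv_le_iff he] at hN
    calc r ^ p * (N * x ^ (p - e) * v ^ e) = (r ^ p * N) * v ^ e * x ^ (p - e) := by ring
      _ ≤ Z ^ e * Φ ^ e * x ^ (p - e) := by gcongr
      _ = (Z * Φ) ^ e * x ^ (p - e) := by rw [ENNReal.mul_rpow_of_nonneg _ _ he.le]
      _ ≤ _ := by gcongr
  -- Here `W = M Z Φ`. It dominates both the cutoff term and the `L^p` norm of `w`, whence `2 W` in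
  -- the Sobolev estimate.
  refine le_of_absorb hp hε hε₁ hε₁' hε₂ hε₂' hε₃ hε₃' hfin hS hK hA
    (R := r * (∫⁻ x, Y x ^ p ∂μ) ^ (1 / p)) ?_ ?_
  · refine hsob.trans ?_
    calc _ ≤ S * (M * Z * Φ + A * (r * (∫⁻ x, Y x ^ p ∂μ) ^ (1 / p)) + M * Z * Φ) := by
          refine mul_le_mul_right ?_ _
          exact add_le_add (add_le_add (hP.trans hMZ) le_rfl) (hw.trans hΦ)
      _ = _ := by ring
  · have hpp : ∀ N : ℝ≥0∞, (r * N ^ (1 / p)) ^ p = r ^ p * N := fun N => by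
      rw [ENNReal.mul_rpow_of_nonneg _ _ hp0.le, ← ENNReal.rpow_mul, one_div_mul_cancel hp0.ne',
        ENNReal.rpow_one]
    rw [hpp]
    calc r ^ p * ∫⁻ x, Y x ^ p ∂μ ≤ r ^ p * (K * A * (∫⁻ x, P x ^ p ∂μ +
          ∫⁻ x, P x * b x * w x ^ (p - 1) ∂μ + ∫⁻ x, w x ^ p * g₁ x ∂μ +
          ∫⁻ x, w x ^ p * g₂ x ∂μ + ∫⁻ x, w x ^ p * g₃ x ∂μ)) := by gcongr
      _ = K * A * (r ^ p * ∫⁻ x, P x ^ p ∂μ + r ^ p * ∫⁻ x, P x * b x * w x ^ (p - 1) ∂μ +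
          r ^ p * ∫⁻ x, w x ^ p * g₁ x ∂μ + r ^ p * ∫⁻ x, w x ^ p * g₂ x ∂μ +
          r ^ p * ∫⁻ x, w x ^ p * g₃ x ∂μ) := by ring
      _ ≤ _ := by
          refine mul_le_mul_right (add_le_add (add_le_add (add_le_add (add_le_add ?_ ?_) ?_) ?_)
            ?_) _
          · rw [← hpp]
            exact ENNReal.rpow_le_rpow (hP.trans hMZ) hp0.le
          · refine (mul_le_mul_right hb' _).trans ?_
            have er : r ^ p = r * r ^ (p - 1) := by
              conv_rhs => rw [← ENNReal.rpow_one r, ← ENNReal.rpow_mul]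
              rw [one_mul, ← ENNReal.rpow_add_of_nonneg _ _ zero_le_one (by linarith)]
              congr 1; ring
            calc _ = (r * π) * (r ^ (p - 1) * (∫⁻ x, b x ^ (p.conjExponent * σ.conjExponent) ∂μ) ^
                  (1 / (p.conjExponent * σ.conjExponent))) * x ^ (p - 1) := by rw [er]; ring
              _ ≤ (M * Φ) * Z * x ^ (p - 1) := by gcongr
              _ = _ := by ring
          · exact (mul_le_mul_right h₁' _).trans (hterm (hε.trans_le hε₁) h₁)
          · exact (mul_le_mul_right h₂' _).trans (hterm (hε.trans_le hε₂) h₂)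
          · exact (mul_le_mul_right h₃' _).trans (hterm (hε.trans_le hε₃) h₃)

end MoserStep

/-! ### The infinite product and passage to the supremum. -/

section Iteration

/-- Unrolling the recursion gives partial sums of `χ⁻¹ ^ i` and `i χ⁻¹ ^ i` as exponents. Both
series converge, and the bases are at least one, so partial sums may be replaced by full sums. -/
theorem le_of_iterate {χ : ℝ} (hχ : 1 < χ) {A B Z : ℝ≥0∞} (hA : 1 ≤ A) (hB : 1 ≤ B) (hZ : 1 ≤ Z)
    {I : ℕ → ℝ≥0∞} (hI : ∀ j, I (j + 1) ≤ (A * B ^ j * Z) ^ (χ⁻¹ ^ j) * I j) (j : ℕ) :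
    I j ≤ A ^ (χ / (χ - 1)) * B ^ (∑' i : ℕ, (i : ℝ) * χ⁻¹ ^ i) * Z ^ (χ / (χ - 1)) * I 0 := by
  have hχ0 : 0 < χ := by linarith
  have hr0 : 0 ≤ χ⁻¹ := by positivity
  have hr1 : χ⁻¹ < 1 := inv_lt_one_of_one_lt₀ hχ
  have hfinite : I j ≤ A ^ (∑ i ∈ Finset.range j, χ⁻¹ ^ i) *
      B ^ (∑ i ∈ Finset.range j, (i : ℝ) * χ⁻¹ ^ i) * Z ^ (∑ i ∈ Finset.range j, χ⁻¹ ^ i) * I 0 := by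
    induction j with
    | zero => simp
    | succ j ih =>
      have hs : 0 ≤ ∑ i ∈ Finset.range j, χ⁻¹ ^ i := Finset.sum_nonneg fun i _ => by positivity
      have hs' : 0 ≤ ∑ i ∈ Finset.range j, (i : ℝ) * χ⁻¹ ^ i :=
        Finset.sum_nonneg fun i _ => by positivity
      have hj : 0 ≤ χ⁻¹ ^ j := by positivity
      rw [Finset.sum_range_succ, Finset.sum_range_succ, ENNReal.rpow_add_of_nonneg _ _ hs hj,
        ENNReal.rpow_add_of_nonneg _ _ hs hj, ENNReal.rpow_add_of_nonneg _ _ hs' (by positivity)]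
      calc I (j + 1) ≤ (A * B ^ j * Z) ^ (χ⁻¹ ^ j) * I j := hI j
        _ = A ^ (χ⁻¹ ^ j) * B ^ ((j : ℝ) * χ⁻¹ ^ j) * Z ^ (χ⁻¹ ^ j) * I j := by
            rw [ENNReal.mul_rpow_of_nonneg _ _ hj, ENNReal.mul_rpow_of_nonneg _ _ hj,
              ENNReal.rpow_mul, ENNReal.rpow_natCast]
        _ ≤ _ := mul_le_mul_right ih _
        _ = _ := by
            generalize B ^ ((j : ℝ) * χ⁻¹ ^ j) = e₁
            generalize B ^ (∑ i ∈ Finset.range j, (i : ℝ) * χ⁻¹ ^ i) = e₂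
            ring
  have hsum : Summable fun i : ℕ => χ⁻¹ ^ i := summable_geometric_of_lt_one hr0 hr1
  have hsum' : Summable fun i : ℕ => (i : ℝ) * χ⁻¹ ^ i := by
    simpa using summable_pow_mul_geometric_of_norm_lt_one 1
      (by rwa [Real.norm_eq_abs, abs_of_nonneg hr0] : ‖χ⁻¹‖ < 1)
  have hb1 : ∑ i ∈ Finset.range j, χ⁻¹ ^ i ≤ χ / (χ - 1) := by
    refine (hsum.sum_le_tsum _ fun i _ => by positivity).trans_eq ?_
    rw [tsum_geometric_of_lt_one hr0 hr1]
    have : χ - 1 ≠ 0 := by linarith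
    field_simp
  have hb2 := hsum'.sum_le_tsum (Finset.range j) fun i _ => by positivity
  refine hfinite.trans ?_
  gcongr

variable {α : Type*} [MeasurableSpace α] {μ : Measure α}

/-- Chebyshev at a level `c > K`: the measure of `{c ≤ g}` is at most `(K / c) ^ q j`, which tends
to zero. Finiteness of the measure plays no role. -/
theorem ae_le_of_lintegral_rpow_le {q : ℕ → ℝ} (hq0 : ∀ j, 0 < q j) (hq : Tendsto q atTop atTop)
    {g : α → ℝ≥0∞} (hg : AEMeasurable g μ) {K : ℝ≥0∞}
    (h : ∀ j, (∫⁻ x, g x ^ q j ∂μ) ^ (1 / q j) ≤ K) : ∀ᵐ x ∂μ, g x ≤ K := by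
  rcases eq_or_ne K ∞ with hK | hK
  · simp [hK]
  have hlevel : ∀ c : ℝ≥0∞, K < c → c ≠ ∞ → μ {x | c ≤ g x} = 0 := by
    intro c hKc hc
    have hc0 : c ≠ 0 := (zero_le.trans_lt hKc).ne'
    have hKc1 : K / c < 1 := ENNReal.div_lt_of_lt_mul (by rwa [one_mul])
    have hj : ∀ j, μ {x | c ≤ g x} ≤ (K / c) ^ q j := by
      intro j
      have h1 := h j
      rw [one_div, ENNReal.rpow_inv_le_iff (hq0 j)] at h1
      have h2 := mul_meas_ge_le_lintegral₀ (hg.pow_const (q j)) (c ^ q j)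
      have h3 : {x | c ≤ g x} ⊆ {x | c ^ q j ≤ g x ^ q j} := fun x hx =>
        ENNReal.rpow_le_rpow hx (hq0 j).le
      rw [ENNReal.div_rpow_of_nonneg _ _ (hq0 j).le, ENNReal.le_div_iff_mul_le
        (Or.inl (ENNReal.rpow_pos (pos_iff_ne_zero.2 hc0) hc).ne')
        (Or.inl (ENNReal.rpow_ne_top_of_nonneg (hq0 j).le hc)), mul_comm]
      exact (mul_le_mul_right (measure_mono h3) _).trans (h2.trans h1)
    have hn : ∀ m : ℕ, μ {x | c ≤ g x} ≤ (K / c) ^ m := by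
      intro m
      obtain ⟨j, hjm⟩ := (hq.eventually_ge_atTop (m : ℝ)).exists
      refine (hj j).trans ?_
      rw [← ENNReal.rpow_natCast]
      exact ENNReal.rpow_le_rpow_of_exponent_ge hKc1.le hjm
    exact le_antisymm (ge_of_tendsto' (ENNReal.tendsto_pow_atTop_nhds_zero_of_lt_one hKc1) hn)
      zero_le
  obtain ⟨c, -, hc, hclim⟩ := exists_seq_strictAnti_tendsto' (lt_top_iff_ne_top.2 hK)
  have hall : ∀ᵐ x ∂μ, ∀ m, g x < c m := by
    rw [ae_all_iff]
    intro m
    have := hlevel (c m) (hc m).1 (hc m).2.ne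
    filter_upwards [measure_eq_zero_iff_ae_notMem.1 this] with x hx
    exact not_le.1 hx
  filter_upwards [hall] with x hx
  exact ge_of_tendsto' hclim fun m => (hx m).le

end Iteration

/-! ### Integrability of the structural majorants. -/

section Majorants

variable {α : Type*} [MeasurableSpace α] {μ : Measure α}

theorem memLp_abs_rpow {q t : ℝ} (ht : 0 < t) {X : α → ℝ}
    (hX : MemLp X (ENNReal.ofReal q) μ) :
    MemLp (fun x => |X x| ^ t) (ENNReal.ofReal (q / t)) μ := by
  have := hX.norm_rpow_div (ENNReal.ofReal t)
  rwa [ENNReal.toReal_ofReal ht.le, ← ENNReal.ofReal_div_of_pos ht] at this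

theorem holderTriple_ofReal {a b c : ℝ} (ha : 0 < a) (hb : 0 < b) (hc : 0 < c)
    (h : a⁻¹ + b⁻¹ = c⁻¹) :
    ENNReal.HolderTriple (ENNReal.ofReal a) (ENNReal.ofReal b) (ENNReal.ofReal c) := by
  constructor
  rw [← ENNReal.ofReal_inv_of_pos ha, ← ENNReal.ofReal_inv_of_pos hb,
    ← ENNReal.ofReal_inv_of_pos hc, ← ENNReal.ofReal_add (by positivity) (by positivity), h]

theorem memLp_mul_abs_rpow {A q t c : ℝ} (hA : 0 < A) (hq : 0 < q) (ht : 0 < t) (hc : 0 < c)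
    (h : A⁻¹ + t / q = c⁻¹) {b X : α → ℝ} (hb : MemLp b (ENNReal.ofReal A) μ)
    (hX : MemLp X (ENNReal.ofReal q) μ) :
    MemLp (fun x => b x * |X x| ^ t) (ENNReal.ofReal c) μ := by
  have := holderTriple_ofReal hA (div_pos hq ht) hc (by rw [inv_div]; exact h)
  exact (memLp_abs_rpow ht hX).mul' hb

/-- Integrability of the structural majorants of `A` and `B`. -/
theorem memLp_majorants {p σ ψ : ℝ} (hp : 1 < p) (hσ : 1 < σ) (hψ₀ : p ≤ ψ)
    (hψ₁ : ψ < p + 1 - σ⁻¹) {b c d e f X u : α → ℝ} (a : ℝ)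
    (hb : MemLp b (ENNReal.ofReal (σ * p / (σ * (p - 1) - p + 1))) μ)
    (hc : MemLp c (ENNReal.ofReal (σ * p / (σ * p - 1 - σ * (ψ - 1)))) μ)
    (hd : MemLp d (ENNReal.ofReal (p * σ / (p * σ - p))) μ)
    (he : MemLp e (ENNReal.ofReal (Real.conjExponent p)) μ)
    (hf : MemLp f (ENNReal.ofReal (Real.conjExponent (σ * p))) μ)
    (hX : MemLp X (ENNReal.ofReal p) μ) (hu : MemLp u (ENNReal.ofReal (p * σ)) μ) :
    MemLp (fun x => a * |X x| ^ (p - 1) + b x * |u x| ^ (p - 1) + e x)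
      (ENNReal.ofReal (Real.conjExponent p)) μ ∧
    MemLp (fun x => c x * |X x| ^ (ψ - 1) + d x * |u x| ^ (p - 1) + f x)
      (ENNReal.ofReal (Real.conjExponent (σ * p))) μ := by
  have hp0 : 0 < p := by linarith
  have hσ0 : 0 < σ := by linarith
  have hp1 : 0 < p - 1 := by linarith
  have hσ1 : 0 < σ - 1 := by linarith
  have hσp : 0 < σ * p - 1 := by nlinarith
  have hB : 0 < σ * (p - 1) - p + 1 := by nlinarith
  -- The upper bound on `ψ`, multiplied by `σ`, says exactly that the Lebesgue exponent of `c` is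
  -- positive and finite.
  have hC : 0 < σ * p - 1 - σ * (ψ - 1) := by
    have := mul_lt_mul_of_pos_left hψ₁ hσ0
    rw [mul_sub, mul_inv_cancel₀ hσ0.ne'] at this
    linarith
  have hD : 0 < p * σ - p := by nlinarith
  have hψ1 : 0 < ψ - 1 := by linarith
  constructor
  · refine MemLp.add (MemLp.add ?_ ?_) he
    · exact (memLp_abs_rpow hp1 hX).const_mul a
    · refine memLp_mul_abs_rpow (by positivity) (by positivity) hp1
        (by unfold Real.conjExponent; positivity) ?_ hb hu
      unfold Real.conjExponent
      field_simp
      ring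
  · refine MemLp.add (MemLp.add ?_ ?_) hf
    · refine memLp_mul_abs_rpow (by positivity) (by positivity) hψ1
        (by unfold Real.conjExponent; positivity) ?_ hc hX
      unfold Real.conjExponent
      field_simp
      ring
    · refine memLp_mul_abs_rpow (by positivity) (by positivity) hp1
        (by unfold Real.conjExponent; positivity) ?_ hd hu
      unfold Real.conjExponent
      field_simp
      ring

end Majorants

/-! ### Test functions built from the solution. -/

section TestFunctions

variable {n : ℕ} {Ω S : Set (Rn n)} {Q : Rn n → Matrix (Fin n) (Fin n) ℝ} {p σ s : ℝ}
  {sStar : ℝ≥0∞}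

/-- Multiplication with the gradient of a cutoff function is bounded from `L^{pσ}` to `L^p`. -/
theorem exists_eLpNorm_mul_le (hvol : volume S ≠ ∞) (hp : 1 < p) (hs : 1 ≤ s) (hsσ : s ≤ σ)
    (hH : ENNReal.HolderTriple (ENNReal.ofReal (s * p)) sStar (ENNReal.ofReal p))
    {E : Rn n → ℝ} (hEm : AEMeasurable E (volume.restrict S))
    (hE : eLpNorm E sStar (volume.restrict S) ≠ ∞) :
    ∃ C : ℝ≥0∞, C ≠ ∞ ∧ ∀ g : Rn n → ℝ, AEMeasurable g (volume.restrict S) →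
      eLpNorm (fun x => |g x| * E x) (ENNReal.ofReal p) (volume.restrict S) ≤
        C * eLpNorm g (ENNReal.ofReal (p * σ)) (volume.restrict S) := by
  have hle : ENNReal.ofReal (s * p) ≤ ENNReal.ofReal (p * σ) :=
    ENNReal.ofReal_le_ofReal (by nlinarith)
  set e := 1 / (ENNReal.ofReal (s * p)).toReal - 1 / (ENNReal.ofReal (p * σ)).toReal with he
  have he0 : 0 ≤ e := by
    have h1 : 0 < s * p := by nlinarith
    rw [he, ENNReal.toReal_ofReal h1.le, ENNReal.toReal_ofReal (by nlinarith), sub_nonneg]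
    exact one_div_le_one_div_of_le h1 (by nlinarith)
  refine ⟨volume S ^ e * eLpNorm E sStar (volume.restrict S),
    ENNReal.mul_ne_top (ENNReal.rpow_ne_top_of_nonneg he0 hvol) hE, fun g hg => ?_⟩
  refine (eLpNorm_smul_le_mul_eLpNorm (p := ENNReal.ofReal (s * p)) (q := sStar)
    hEm.aestronglyMeasurable hg.abs.aestronglyMeasurable).trans ?_
  have h1 := eLpNorm_le_eLpNorm_mul_rpow_measure_univ hle
    (hg.abs.aestronglyMeasurable (μ := volume.restrict S))
  rw [Measure.restrict_apply_univ, ← he] at h1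
  have h2 : eLpNorm (fun x => |g x|) (ENNReal.ofReal (p * σ)) (volume.restrict S) =
    eLpNorm g (ENNReal.ofReal (p * σ)) (volume.restrict S) := eLpNorm_norm g
  rw [h2] at h1
  calc _ ≤ eLpNorm g (ENNReal.ofReal (p * σ)) (volume.restrict S) * volume S ^ e *
        eLpNorm E sStar (volume.restrict S) := by gcongr
    _ = _ := by ring

/-- Supplies the hypothesis of the chain rule on the term where the cutoff is differentiated:
convergence in `L^{pσ}` compensates for `E` being only in `L^{s*}`. -/
theorem IsApprox.tendsto_mul {f : ℕ → Rn n → ℝ} {u : Rn n → ℝ} {v : Rn n → Rn n}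
    (hf : IsApprox Ω S Q p (ENNReal.ofReal (p * σ)) f u v) (hΩ : IsOpen Ω) (hS : S ⊆ Ω)
    (hvol : volume S ≠ ∞) (hp : 1 < p) (hs : 1 ≤ s) (hsσ : s ≤ σ)
    (hH : ENNReal.HolderTriple (ENNReal.ofReal (s * p)) sStar (ENNReal.ofReal p))
    {E : Rn n → ℝ} (hEm : AEMeasurable E (volume.restrict S))
    (hE : eLpNorm E sStar (volume.restrict S) ≠ ∞) :
    Tendsto (fun i => eLpNorm (fun x => |f i x - u x| * E x) (ENNReal.ofReal p)
      (volume.restrict S)) atTop (𝓝 0) := by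
  obtain ⟨C, hC, hle⟩ := exists_eLpNorm_mul_le hvol hp hs hsσ hH hEm hE
  have h0 := ENNReal.Tendsto.const_mul hf.lim (Or.inr hC)
  rw [mul_zero] at h0
  refine tendsto_of_tendsto_of_tendsto_of_le_of_le tendsto_const_nhds h0 (fun _ => zero_le)
    fun i => hle _ ?_
  exact ((aemeasurable_of_locallyLipschitzOn hΩ (hf.lip i)).sub hf.meas_u).mono_measure
    (Measure.restrict_mono hS le_rfl)

theorem lipschitzWith_of_hasDerivAt {H H' : ℝ → ℝ} {L : ℝ≥0} (hH : ∀ z, HasDerivAt H (H' z) z)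
    (hL : ∀ z, |H' z| ≤ L) : LipschitzWith L H := by
  refine lipschitzWith_of_nnnorm_deriv_le (fun z => (hH z).differentiableAt) fun z => ?_
  rw [(hH z).deriv, ← NNReal.coe_le_coe]
  exact hL z

/-- The product of a cutoff function and a smooth function of a Sobolev function has vanishing
boundary values. -/
theorem IsApprox.memW0_mul_comp {f : ℕ → Rn n → ℝ} {u : Rn n → ℝ} {v : Rn n → Rn n}
    (hf : IsApprox Ω S Q p (ENNReal.ofReal (p * σ)) f u v) (hΩ : IsOpen Ω) (hS : S ⊆ Ω)
    (hvol : volume S ≠ ∞) (hQ : MeasurableForm Q (volume.restrict Ω)) (hp : 1 < p) (hσ : 1 < σ)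
    {ζ : Rn n → ℝ} (hζ : Lip0 S ζ) (h01 : ∀ x, 0 ≤ ζ x ∧ ζ x ≤ 1)
    (hE : Tendsto (fun i => eLpNorm (fun x => |f i x - u x| * ‖sqrtQ (Q x) (gradient ζ x)‖)
      (ENNReal.ofReal p) (volume.restrict S)) atTop (𝓝 0))
    {H H' : ℝ → ℝ} {L : ℝ≥0} (hH : ∀ z, HasDerivAt H (H' z) z) (hH'c : Continuous H')
    (hL : ∀ z, |H' z| ≤ L)
    (hfin : eLpNorm (fun x => ζ x * H (u x)) (ENNReal.ofReal p) (volume.restrict S) ≠ ∞)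
    (hfin' : eLpNorm (fun x => sqrtQ (Q x) (H (u x) • gradient ζ x + (ζ x * H' (u x)) • v x))
      (ENNReal.ofReal p) (volume.restrict S) ≠ ∞) :
    MemW0 S Q p (fun x => ζ x * H (u x))
      (fun x => H (u x) • gradient ζ x + (ζ x * H' (u x)) • v x) := by
  have hHL := lipschitzWith_of_hasDerivAt hH hL
  have hHc : Continuous H := hHL.continuous
  have hmono : volume.restrict S ≤ volume.restrict Ω := Measure.restrict_mono hS le_rfl
  have hmu := hf.meas_u.mono_measure hmono
  have hmv := hf.meas_v.mono_measure hmono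
  obtain ⟨Kζ, hKζ⟩ := hζ.1
  have hmζ : AEMeasurable ζ (volume.restrict Ω) := hKζ.continuous.measurable.aemeasurable
  have hw : AEMeasurable (fun x => ζ x * H (u x)) (volume.restrict S) :=
    (hmζ.mono_measure hmono).mul (hHc.measurable.comp_aemeasurable hmu)
  have hV : AEMeasurable (fun x => H (u x) • gradient ζ x + (ζ x * H' (u x)) • v x)
      (volume.restrict Ω) :=
    ((hHc.measurable.comp_aemeasurable hf.meas_u).smul (measurable_gradient ζ).aemeasurable).add
      ((hmζ.mul (hH'c.measurable.comp_aemeasurable hf.meas_u)).smul hf.meas_v)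
  have hlip : ∀ i, Lip0 S (fun x => ζ x * H (f i x)) := fun i => hζ.mul_comp hΩ hS (hf.lip i) hHL
  have hmi : ∀ i, AEMeasurable (fun x => ζ x * H (f i x)) (volume.restrict S) := fun i => by
    obtain ⟨K, hK⟩ := (hlip i).1
    exact hK.continuous.measurable.aemeasurable
  have hP1 : 1 ≤ ENNReal.ofReal p := by rw [ENNReal.one_le_ofReal]; exact hp.le
  have hlim : Tendsto (fun i => eLpNorm (fun x => ζ x * H (f i x) - ζ x * H (u x))
      (ENNReal.ofReal p) (volume.restrict S)) atTop (𝓝 0) := by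
    have h1 := tendsto_eLpNorm_mul_comp_sub hf.lim h01 hHL
    set e := 1 / (ENNReal.ofReal p).toReal - 1 / (ENNReal.ofReal (p * σ)).toReal with he
    have he0 : 0 ≤ e := by
      rw [he, ENNReal.toReal_ofReal (by linarith), ENNReal.toReal_ofReal (by nlinarith), sub_nonneg]
      exact one_div_le_one_div_of_le (by linarith) (by nlinarith)
    have h2 := ENNReal.Tendsto.mul_const (b := volume S ^ e) h1
      (Or.inr (ENNReal.rpow_ne_top_of_nonneg he0 hvol))
    rw [zero_mul] at h2
    refine tendsto_of_tendsto_of_tendsto_of_le_of_le tendsto_const_nhds h2 (fun _ => zero_le)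
      fun i => ?_
    have h3 := eLpNorm_le_eLpNorm_mul_rpow_measure_univ (p := ENNReal.ofReal p)
      (q := ENNReal.ofReal (p * σ)) (ENNReal.ofReal_le_ofReal (by nlinarith))
      ((hmi i).sub hw).aestronglyMeasurable
    rwa [Measure.restrict_apply_univ, ← he] at h3
  have hgrad := tendsto_gradient_mul_comp hΩ hS hQ hp.le hf.lip hf.meas_u hf.meas_v hf.ae_lim
    hf.lim_grad hf.v_mem hζ h01 hE hH hH'c hL
  have hev : ∀ᶠ i in atTop, wNorm S Q p (fun x => ζ x * H (f i x)) < ∞ := by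
    filter_upwards [hlim.eventually (gt_mem_nhds ENNReal.zero_lt_top),
      hgrad.eventually (gt_mem_nhds ENNReal.zero_lt_top)] with i h1 h2
    refine (wNorm_le_add hp.le _).trans_lt (ENNReal.add_lt_top.2 ⟨?_, ?_⟩)
    · have hle : eLpNorm (fun x => sqrtQ (Q x) (gradient (fun x => ζ x * H (f i x)) x))
          (ENNReal.ofReal p) (volume.restrict S) ≤
          eLpNorm (fun x => ‖sqrtQ (Q x) (gradient (fun x => ζ x * H (f i x)) x -
            (H (u x) • gradient ζ x + (ζ x * H' (u x)) • v x))‖ +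
          ‖sqrtQ (Q x) (H (u x) • gradient ζ x + (ζ x * H' (u x)) • v x)‖)
          (ENNReal.ofReal p) (volume.restrict S) := by
        refine eLpNorm_mono_real fun x => ?_
        refine le_trans (le_of_eq ?_) (norm_add_le _ _)
        rw [← map_add, sub_add_cancel]
      refine (hle.trans (eLpNorm_add_le ?_ ?_ hP1)).trans_lt ?_
      · exact (hQ.mono hS _ ((measurable_gradient _).aemeasurable.sub hV)).aestronglyMeasurable
      · exact (hQ.mono hS _ hV).aestronglyMeasurable
      · rw [eLpNorm_norm, eLpNorm_norm]
        exact ENNReal.add_lt_top.2 ⟨h2, hfin'.lt_top⟩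
    · have hle := eLpNorm_add_le ((hmi i).sub hw).aestronglyMeasurable hw.aestronglyMeasurable hP1
      rw [sub_add_cancel] at hle
      exact hle.trans_lt (ENNReal.add_lt_top.2 ⟨h1, hfin.lt_top⟩)
  -- The norms of the approximants are known to be finite only from some index on, so a tail of the
  -- sequence is used.
  obtain ⟨N, hN⟩ := eventually_atTop.1 hev
  exact ⟨fun i x => ζ x * H (f (i + N) x), fun i => ⟨hlip _, hN _ (Nat.le_add_left _ _)⟩, hw,
    hV.mono_measure hmono, hlim.comp (tendsto_add_atTop_nat N),
    hgrad.comp (tendsto_add_atTop_nat N)⟩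

end TestFunctions

/-! ### The energy estimate. -/

section Energy

variable {n : ℕ} {Ω S : Set (Rn n)} {Q : Rn n → Matrix (Fin n) (Fin n) ℝ} {p σ s : ℝ}
  {sStar : ℝ≥0∞}

/-- The right-hand side of the energy estimate, in terms of the cutoff function `η`, the size `E` of
its gradient, the regularized solution `ω`, the power `F` of it, and the structural coefficients. -/
noncomputable def energyRHS (a p ψ l k : ℝ) (η E ω F b c d e f g h : Rn n → ℝ) (x : Rn n) : ℝ :=
  energyConst₁ a p * (E x * F x) ^ p +
    p * (E x * F x * (b x + k ^ (1 - p) * e x) * (η x * F x) ^ (p - 1)) +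
    (η x * F x) ^ p * (p * (1 + l) * (h x + k ^ (-p) * g x) + (d x + k ^ (1 - p) * f x) +
      energyConst₂ a p ψ * (c x ^ (p / (p + 1 - ψ)) * ω x ^ (p * (ψ - p) / (p + 1 - ψ))))

theorem AdmissibleCoefficients.memLp_majorants {ψ : ℝ} {b c d e f g h : Rn n → ℝ}
    (hadm : AdmissibleCoefficients Ω p σ p ψ p b c d e f g h) (hK : IsCompact (closure S))
    (hKΩ : closure S ⊆ Ω) (hp : 1 < p) (hσ : 1 < σ) (hψ₀ : p ≤ ψ) (hψ₁ : ψ < p + 1 - σ⁻¹)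
    {X u : Rn n → ℝ} (a : ℝ) (hX : MemLp X (ENNReal.ofReal p) (volume.restrict S))
    (hu : MemLp u (ENNReal.ofReal (p * σ)) (volume.restrict S)) :
    MemLp (fun x => a * |X x| ^ (p - 1) + b x * |u x| ^ (p - 1) + e x)
      (ENNReal.ofReal (Real.conjExponent p)) (volume.restrict S) ∧
    MemLp (fun x => c x * |X x| ^ (ψ - 1) + d x * |u x| ^ (p - 1) + f x)
      (ENNReal.ofReal (Real.conjExponent (σ * p))) (volume.restrict S) := by
  have hle : volume.restrict S ≤ volume.restrict (closure S) :=
    Measure.restrict_mono subset_closure le_rfl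
  exact DegQuasilinear.memLp_majorants hp hσ hψ₀ hψ₁ a
    ((hadm.loc_b _ hK hKΩ).mono_measure hle) ((hadm.loc_c _ hK hKΩ).mono_measure hle)
    ((hadm.loc_d _ hK hKΩ).mono_measure hle) ((hadm.loc_e _ hK hKΩ).mono_measure hle)
    ((hadm.loc_f _ hK hKΩ).mono_measure hle) hX hu

/-- `∇(η ^ p) = p η ^ (p - 1) ∇η` is at most `p |∇η|` in the degenerate norm. -/
theorem eLpNorm_gradient_rpow_ne_top {η : Rn n → ℝ} (hη : Lip0 S η) (h01 : ∀ x, 0 ≤ η x ∧ η x ≤ 1)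
    (hp : 1 ≤ p) (hE : eLpNorm (fun x => sqrtQ (Q x) (gradient η x)) sStar (volume.restrict S) ≠ ∞) :
    eLpNorm (fun x => ‖sqrtQ (Q x) (gradient (fun x => η x ^ p) x)‖) sStar (volume.restrict S)
      ≠ ∞ := by
  obtain ⟨K, hK⟩ := hη.1
  have hle : eLpNorm (fun x => ‖sqrtQ (Q x) (gradient (fun x => η x ^ p) x)‖) sStar
      (volume.restrict S) ≤
      (p.toNNReal : ℝ≥0∞) * eLpNorm (fun x => sqrtQ (Q x) (gradient η x)) sStar
        (volume.restrict S) := by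
    refine eLpNorm_le_nnreal_smul_eLpNorm_of_ae_le_mul ?_ sStar
    filter_upwards [ae_restrict_of_ae hK.ae_differentiableAt] with x hx
    rw [← NNReal.coe_le_coe, NNReal.coe_mul, coe_nnnorm, coe_nnnorm, norm_norm,
      Real.coe_toNNReal _ (by linarith), gradient_rpow hp hx, map_smul, norm_smul, norm_mul,
      Real.norm_eq_abs, Real.norm_eq_abs, abs_of_nonneg (by linarith : (0 : ℝ) ≤ p),
      abs_of_nonneg (Real.rpow_nonneg (h01 x).1 _)]
    refine mul_le_mul_of_nonneg_right ?_ (norm_nonneg _)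
    exact mul_le_of_le_one_right (by linarith)
      (Real.rpow_le_one (h01 x).1 (h01 x).2 (by linarith))
  exact (hle.trans_lt (ENNReal.mul_lt_top ENNReal.coe_lt_top hE.lt_top)).ne

/-- The Lipschitz functions obtained from `η ^ p * testProfile k δ (p * l)` at the approximants are
admissible and approximate the formal test function at `u`. In the limit the pointwise energy
inequality is integrated, and the equation removes the terms with `A` and `B`. -/
theorem IsApprox.energy_estimate {f₀ : ℕ → Rn n → ℝ} {u : Rn n → ℝ} {v : Rn n → Rn n}
    (hap : IsApprox Ω S Q p (ENNReal.ofReal (p * σ)) f₀ u v) (hΩ : IsOpen Ω) (hS : S ⊆ Ω)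
    (hK : IsCompact (closure S)) (hKΩ : closure S ⊆ Ω)
    (hvol : volume S ≠ ∞) (hQ : MeasurableForm Q (volume.restrict Ω)) (hp : 1 < p) (hσ : 1 < σ)
    (hs : 1 ≤ s) (hsσ : s ≤ σ)
    (hH : ENNReal.HolderTriple (ENNReal.ofReal (s * p)) sStar (ENNReal.ofReal p))
    {a ψ : ℝ} (ha : 1 < a) (hψ₀ : p ≤ ψ) (hψ₁ : ψ < p + 1 - σ⁻¹)
    {A : Rn n → ℝ → Rn n → Rn n} {B : Rn n → ℝ → Rn n → ℝ} {b c d e f g h : Rn n → ℝ}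
    (hadm : AdmissibleCoefficients Ω p σ p ψ p b c d e f g h)
    (hstr : StructuralConditions Ω Q p a p ψ p b c d e f g h A B)
    (hweak : WeakSolution Ω Q p A B u v)
    {η : Rn n → ℝ} (hη : Lip0 S η) (h01 : ∀ x, 0 ≤ η x ∧ η x ≤ 1)
    (hE : eLpNorm (fun x => sqrtQ (Q x) (gradient η x)) sStar (volume.restrict S) ≠ ∞)
    {k δ l : ℝ} (hk : 0 < k) (hδ : 0 < δ) (hl : 0 ≤ l) :
    ∫⁻ x in S, ENNReal.ofReal ((2 * a)⁻¹ *
        (η x * trunc k δ (u x) ^ (l / 2) * ‖sqrtQ (Q x) (v x)‖) ^ p) ≤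
      ∫⁻ x in S, ENNReal.ofReal (energyRHS a p ψ l k η (fun x => ‖sqrtQ (Q x) (gradient η x)‖)
        (fun x => √(u x ^ 2 + k ^ 2)) (fun x => powProfile k δ l (u x)) b c d e f g h x) := by
  have hp0 : 0 < p := by linarith
  have hσ0 : 0 < σ := by linarith
  have hmono : volume.restrict S ≤ volume.restrict Ω := Measure.restrict_mono hS le_rfl
  have hmu := hap.meas_u.mono_measure hmono
  have hmX := hQ.mono hS _ hap.meas_v
  have hXp : MemLp (fun x => ‖sqrtQ (Q x) (v x)‖) (ENNReal.ofReal p) (volume.restrict S) :=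
    ⟨hmX.aestronglyMeasurable, by rw [eLpNorm_norm]; exact hap.v_mem.lt_top⟩
  have hup : MemLp u (ENNReal.ofReal (p * σ)) (volume.restrict S) :=
    ⟨hmu.aestronglyMeasurable, hap.u_mem.lt_top⟩
  obtain ⟨h𝔞, h𝔟⟩ := hadm.memLp_majorants hK hKΩ hp hσ hψ₀ hψ₁ a hXp hup
  obtain ⟨A', hA'⟩ := hstr
  have hA'S := ae_restrict_of_ae_restrict_of_subset hS hA'
  have hnn : ∀ᵐ x ∂(volume.restrict S),
      0 ≤ b x ∧ 0 ≤ c x ∧ 0 ≤ d x ∧ 0 ≤ e x ∧ 0 ≤ f x ∧ 0 ≤ g x ∧ 0 ≤ h x :=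
    ae_restrict_of_ae_restrict_of_subset hS
      ((ae_restrict_iff' hΩ.measurableSet).2 (ae_of_all _ hadm.nonneg))
  have hpl : 0 ≤ p * l := by positivity
  have hζ : Lip0 S (fun x => η x ^ p) := hη.rpow h01 hp.le
  have hζ01 : ∀ x, 0 ≤ η x ^ p ∧ η x ^ p ≤ 1 := fun x =>
    ⟨Real.rpow_nonneg (h01 x).1 _, Real.rpow_le_one (h01 x).1 (h01 x).2 hp0.le⟩
  have hEζ := hap.tendsto_mul hΩ hS hvol hp hs hsσ hH
    (hQ.mono hS _ (measurable_gradient (fun x => η x ^ p)).aemeasurable)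
    (eLpNorm_gradient_rpow_ne_top hη h01 hp.le hE)
  set L : ℝ≥0 := ((1 + p * l) * δ⁻¹ ^ (p * l / 2)).toNNReal with hL
  have hLb : ∀ z, |testProfileDeriv k δ (p * l) z| ≤ L := by
    intro z
    have h1 := le_testProfileDeriv hk hδ hpl z
    have h2 := testProfileDeriv_le hk hδ hpl z
    have h3 := trunc_rpow_le hk hδ hpl z
    have h4 := Real.rpow_nonneg (trunc_pos hk hδ z).le (p * l / 2)
    rw [abs_of_nonneg (h4.trans h1), hL, Real.coe_toNNReal _ (by positivity)]
    exact h2.trans (mul_le_mul_of_nonneg_left h3 (by positivity))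
  have hHd := hasDerivAt_testProfile hk hδ (p * l)
  have hHL := lipschitzWith_of_hasDerivAt hHd hLb
  have hH'c := continuous_testProfileDeriv hk hδ (p * l)
  have hlip : ∀ i, Lip0 S (fun x => η x ^ p * testProfile k δ (p * l) (f₀ i x)) := fun i =>
    hζ.mul_comp hΩ hS (hap.lip i) hHL
  have hlipΩ : ∀ i, Lip0 Ω (fun x => η x ^ p * testProfile k δ (p * l) (f₀ i x)) := fun i =>
    ⟨(hlip i).1, (hlip i).2.1, (hlip i).2.2.trans hS⟩
  have hlim := tendsto_eLpNorm_mul_comp_sub hap.lim hζ01 hHL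
  have hgrad := tendsto_gradient_mul_comp hΩ hS hQ hp.le hap.lip hap.meas_u hap.meas_v hap.ae_lim
    hap.lim_grad hap.v_mem hζ hζ01 hEζ hHd hH'c hLb
  obtain ⟨Kη, hKη⟩ := hη.1
  obtain ⟨Kζ, hKζ⟩ := hζ.1
  have hmη : AEMeasurable η (volume.restrict S) := hKη.continuous.measurable.aemeasurable
  have hmζ : AEMeasurable (fun x => η x ^ p) (volume.restrict Ω) :=
    hKζ.continuous.measurable.aemeasurable
  have hwm : AEMeasurable (fun x => η x ^ p * testProfile k δ (p * l) (u x))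
      (volume.restrict Ω) :=
    hmζ.mul (hHL.continuous.measurable.comp_aemeasurable hap.meas_u)
  have hVm : AEMeasurable (fun x => testProfile k δ (p * l) (u x) • gradient (fun x => η x ^ p) x +
      (η x ^ p * testProfileDeriv k δ (p * l) (u x)) • v x) (volume.restrict Ω) :=
    ((hHL.continuous.measurable.comp_aemeasurable hap.meas_u).smul
      (measurable_gradient _).aemeasurable).add
      ((hmζ.mul (hH'c.measurable.comp_aemeasurable hap.meas_u)).smul hap.meas_v)
  have hmE := hQ.mono hS _ (measurable_gradient η).aemeasurable
  have hmω : AEMeasurable (fun x => √(u x ^ 2 + k ^ 2)) (volume.restrict S) :=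
    ((hmu.pow_const 2).add_const _).sqrt
  have hFc : Continuous (powProfile k δ l) :=
    continuous_iff_continuousAt.2 fun z => (hasDerivAt_powProfile hk hδ l z).continuousAt
  have hmF : AEMeasurable (fun x => powProfile k δ l (u x)) (volume.restrict S) :=
    hFc.measurable.comp_aemeasurable hmu
  have hmb := hadm.meas_b.mono_measure hmono
  have hmc := hadm.meas_c.mono_measure hmono
  have hmd := hadm.meas_d.mono_measure hmono
  have hme := hadm.meas_e.mono_measure hmono
  have hmf := hadm.meas_f.mono_measure hmono
  have hmg := hadm.meas_g.mono_measure hmono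
  have hmh := hadm.meas_h.mono_measure hmono
  have hψp : 0 < p + 1 - ψ := by
    have := inv_pos.2 hσ0
    linarith
  have hPP' : ENNReal.HolderConjugate (ENNReal.ofReal p) (ENNReal.ofReal p.conjExponent) :=
    (Real.HolderConjugate.conjExponent hp).ennrealOfReal
  -- The majorant of `B` lies only in `L^{(σp)'}`; this is why the test functions must converge in
  -- `L^{pσ}` and not merely in `L^p`.
  have hqq' : ENNReal.HolderConjugate (ENNReal.ofReal (p * σ))
      (ENNReal.ofReal (σ * p).conjExponent) := by
    rw [mul_comm p σ]
    exact (Real.HolderConjugate.conjExponent (by nlinarith)).ennrealOfReal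
  have hRm : AEMeasurable (energyRHS a p ψ l k η (fun x => ‖sqrtQ (Q x) (gradient η x)‖)
      (fun x => √(u x ^ 2 + k ^ 2)) (fun x => powProfile k δ l (u x)) b c d e f g h)
      (volume.restrict S) := by
    unfold energyRHS
    refine AEMeasurable.add (AEMeasurable.add ?_ ?_) ?_
    · exact ((hmE.mul hmF).pow_const p).const_mul _
    · exact (((hmE.mul hmF).mul (hmb.add (hme.const_mul _))).mul
        ((hmη.mul hmF).pow_const _)).const_mul _
    · exact ((hmη.mul hmF).pow_const p).mul ((((hmh.add (hmg.const_mul _)).const_mul _).add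
        (hmd.add (hmf.const_mul _))).add (((hmc.pow_const _).mul (hmω.pow_const _)).const_mul _))
  have hRpos : ∀ᵐ x ∂(volume.restrict S),
      0 ≤ energyRHS a p ψ l k η (fun x => ‖sqrtQ (Q x) (gradient η x)‖)
      (fun x => √(u x ^ 2 + k ^ 2)) (fun x => powProfile k δ l (u x)) b c d e f g h x := by
    filter_upwards [hnn] with x hx
    obtain ⟨hb, hc, hd, he, hf, hg, hh⟩ := hx
    have hF := powProfile_nonneg (l := l) hk hδ (u x)
    have hη0 := (h01 x).1
    unfold energyRHS energyConst₁ energyConst₂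
    positivity
  refine lintegral_le_of_tendsto_testFunctions hΩ hS hQ (A := fun x => A x (u x) (v x))
    (A' := fun x => A' x (u x) (v x)) (B := fun x => B x (u x) (v x)) ?_ ?_ ?_ h𝔞 h𝔟 hlip
    (fun i => hweak.2 _ (hlipΩ i)) hwm hVm hlim hgrad hRm hRpos ?_ ?_
  · filter_upwards [hA'S] with x hx
    exact (hx _ _).1
  · filter_upwards [hA'S] with x hx
    rw [abs_of_nonneg (norm_nonneg (sqrtQ (Q x) (v x)))]
    exact (hx _ _).2.2.1
  · filter_upwards [hA'S] with x hx
    rw [abs_of_nonneg (norm_nonneg (sqrtQ (Q x) (v x)))]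
    exact (hx _ _).2.2.2
  · refine ae_of_all _ fun x => ?_
    have hη0 := (h01 x).1
    have := Real.rpow_nonneg (trunc_pos hk hδ (u x)).le (l / 2)
    positivity
  · filter_upwards [hA'S, hnn, ae_restrict_of_ae hKη.ae_differentiableAt] with x hx hx' hdx
    obtain ⟨hb, hc, hd, he, hf, hg, hh⟩ := hx'
    obtain ⟨hA1, hA2, hA3, hA4⟩ := hx (u x) (v x)
    have hη0 := (h01 x).1
    have hy : 0 < trunc k δ (u x) ^ (l / 2) := Real.rpow_pos_of_pos (trunc_pos hk hδ (u x)) _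
    -- Reconciles the exponent `p l` of the test function with the exponent `l` of the profile `F`,
    -- which enters the estimate to the power `p`.
    have hyp : (trunc k δ (u x) ^ (l / 2)) ^ p = trunc k δ (u x) ^ (p * l / 2) := by
      rw [← Real.rpow_mul (trunc_pos hk hδ (u x)).le]
      congr 1; ring
    have hJ : |inner ℝ (gradient (fun x => η x ^ p) x) (A x (u x) (v x))| ≤
        p * η x ^ (p - 1) * ‖sqrtQ (Q x) (gradient η x)‖ * ‖A' x (u x) (v x)‖ := by
      rw [hA1, inner_sqrtQ_right, gradient_rpow hp.le hdx, map_smul]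
      refine (abs_real_inner_le_norm _ _).trans (le_of_eq ?_)
      rw [norm_smul, Real.norm_eq_abs, abs_of_nonneg (by positivity)]
    have key := pointwise_energy (l := l) (E := ‖sqrtQ (Q x) (gradient η x)‖)
      (ω := √(u x ^ 2 + k ^ 2)) (G := testProfile k δ (p * l) (u x))
      (G' := testProfileDeriv k δ (p * l) (u x)) (y := trunc k δ (u x) ^ (l / 2))
      (I := inner ℝ (v x) (A x (u x) (v x)))
      ha hp hψ₀ (by linarith) hη0 (norm_nonneg _) (norm_nonneg _) hk
      (le_sqrt_sq_add_sq k (u x)) (abs_le_sqrt_sq_add_sq k (u x)) hy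
      (by rw [hyp]; exact le_testProfileDeriv hk hδ hpl _)
      (by rw [hyp]; exact testProfileDeriv_le hk hδ hpl _)
      (by rw [hyp]; exact abs_testProfile_le hk hδ _)
      hb hc hd he hf hg hh hA2 hJ hA3 hA4
    refine key.trans (le_of_eq ?_)
    rw [inner_add_left, real_inner_smul_left, real_inner_smul_left]
    rfl

end Energy

/-! ### Reverse Hölder inequality for truncated powers. -/

section ReverseHolder

variable {n : ℕ} {Ω S : Set (Rn n)} {Q : Rn n → Matrix (Fin n) (Fin n) ℝ} {p σ s : ℝ}
  {sStar : ℝ≥0∞}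

/-- The constant in the energy estimate. -/
noncomputable def energyConst (a p ψ : ℝ) : ℝ :=
  2 * a * (energyConst₁ a p + p + 1 + energyConst₂ a p ψ)

theorem energyConst₁_nonneg {a p : ℝ} (ha : 1 < a) (hp : 1 < p) : 0 ≤ energyConst₁ a p := by
  unfold energyConst₁
  positivity

theorem energyConst₂_nonneg {a p ψ : ℝ} (ha : 1 < a) : 0 ≤ energyConst₂ a p ψ := by
  unfold energyConst₂
  positivity

theorem one_le_energyConst {a p ψ : ℝ} (ha : 1 < a) (hp : 1 < p) : 1 ≤ energyConst a p ψ := by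
  have h₁ := energyConst₁_nonneg ha hp
  have h₂ := energyConst₂_nonneg (p := p) (ψ := ψ) ha
  unfold energyConst
  nlinarith

/-- Only the coefficient of the `h`-term grows with `l`, and it does so linearly, so a single factor
`1 + l` covers all five terms. -/
theorem ofReal_energyRHS_le {a ψ l k : ℝ} (ha : 1 < a) (hp : 1 < p) (hl : 0 ≤ l) (hk : 0 < k)
    {η E ω F b c d e f g h : Rn n → ℝ} {x : Rn n}
    (hη : 0 ≤ η x) (hE : 0 ≤ E x) (hω : 0 ≤ ω x) (hF : 0 ≤ F x) (hb : 0 ≤ b x) (hc : 0 ≤ c x)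
    (hd : 0 ≤ d x) (he : 0 ≤ e x) (hf : 0 ≤ f x) (hg : 0 ≤ g x) (hh : 0 ≤ h x) :
    ENNReal.ofReal (2 * a * energyRHS a p ψ l k η E ω F b c d e f g h x) ≤
      ENNReal.ofReal (energyConst a p ψ) * ENNReal.ofReal (1 + l) *
        (‖E x * F x‖ₑ ^ p + ‖E x * F x‖ₑ * ‖b x + k ^ (1 - p) * e x‖ₑ * ‖η x * F x‖ₑ ^ (p - 1) +
          ‖η x * F x‖ₑ ^ p *
            ‖c x ^ (p / (p + 1 - ψ)) * ω x ^ (p * (ψ - p) / (p + 1 - ψ))‖ₑ +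
          ‖η x * F x‖ₑ ^ p * ‖h x + k ^ (-p) * g x‖ₑ +
          ‖η x * F x‖ₑ ^ p * ‖d x + k ^ (1 - p) * f x‖ₑ) := by
  have h₁ := energyConst₁_nonneg ha hp
  have h₂ := energyConst₂_nonneg (p := p) (ψ := ψ) ha
  have hK : 0 ≤ energyConst a p ψ := zero_le_one.trans (one_le_energyConst ha hp)
  have hP : 0 ≤ E x * F x := mul_nonneg hE hF
  have hw : 0 ≤ η x * F x := mul_nonneg hη hF
  have hb' : 0 ≤ b x + k ^ (1 - p) * e x := by positivity
  have hc' : 0 ≤ c x ^ (p / (p + 1 - ψ)) * ω x ^ (p * (ψ - p) / (p + 1 - ψ)) := by positivity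
  have hh' : 0 ≤ h x + k ^ (-p) * g x := by positivity
  have hd' : 0 ≤ d x + k ^ (1 - p) * f x := by positivity
  rw [energyRHS, Real.enorm_of_nonneg hP, Real.enorm_of_nonneg hw, Real.enorm_of_nonneg hb',
    Real.enorm_of_nonneg hc', Real.enorm_of_nonneg hh', Real.enorm_of_nonneg hd',
    ENNReal.ofReal_rpow_of_nonneg hP (by linarith), ENNReal.ofReal_rpow_of_nonneg hw (by linarith),
    ENNReal.ofReal_rpow_of_nonneg hw (by linarith)]
  generalize E x * F x = P at *
  generalize η x * F x = w at *
  generalize b x + k ^ (1 - p) * e x = b' at *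
  generalize c x ^ (p / (p + 1 - ψ)) * ω x ^ (p * (ψ - p) / (p + 1 - ψ)) = c' at *
  generalize h x + k ^ (-p) * g x = h' at *
  generalize d x + k ^ (1 - p) * f x = d' at *
  have hPp : 0 ≤ P ^ p := by positivity
  have hwp : 0 ≤ w ^ p := by positivity
  have hwp1 : 0 ≤ w ^ (p - 1) := by positivity
  have t2 : 0 ≤ P * b' * w ^ (p - 1) := by positivity
  have t3 : 0 ≤ w ^ p * c' := by positivity
  have t4 : 0 ≤ w ^ p * h' := by positivity
  have t5 : 0 ≤ w ^ p * d' := by positivity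
  rw [← ENNReal.ofReal_mul hP, ← ENNReal.ofReal_mul (mul_nonneg hP hb'), ← ENNReal.ofReal_mul hwp,
    ← ENNReal.ofReal_mul hwp, ← ENNReal.ofReal_mul hwp, ← ENNReal.ofReal_add hPp t2,
    ← ENNReal.ofReal_add (by positivity) t3, ← ENNReal.ofReal_add (by positivity) t4,
    ← ENNReal.ofReal_add (by positivity) t5, ← ENNReal.ofReal_mul hK,
    ← ENNReal.ofReal_mul (by positivity)]
  refine ENNReal.ofReal_le_ofReal ?_
  rw [energyConst, mul_assoc (2 * a) _ (1 + l), mul_assoc (2 * a) (_ * (1 + l))]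
  refine mul_le_mul_of_nonneg_left ?_ (by linarith : 0 ≤ 2 * a)
  generalize energyConst₁ a p = C₁ at *
  generalize energyConst₂ a p ψ = C₂ at *
  have hκ : C₁ + p + 1 + C₂ ≤ (C₁ + p + 1 + C₂) * (1 + l) :=
    le_mul_of_one_le_right (by positivity) (by linarith)
  have hpl : p * (1 + l) ≤ (C₁ + p + 1 + C₂) * (1 + l) :=
    mul_le_mul_of_nonneg_right (by linarith) (by positivity)
  have k1 := mul_le_mul_of_nonneg_right ((by linarith : C₁ ≤ C₁ + p + 1 + C₂).trans hκ) hPp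
  have k2 := mul_le_mul_of_nonneg_right ((by linarith : p ≤ C₁ + p + 1 + C₂).trans hκ) t2
  have k3 := mul_le_mul_of_nonneg_right ((by linarith : C₂ ≤ C₁ + p + 1 + C₂).trans hκ) t3
  have k4 := mul_le_mul_of_nonneg_right hpl t4
  have k5 := mul_le_mul_of_nonneg_right ((by linarith : 1 ≤ C₁ + p + 1 + C₂).trans hκ) t5
  calc _ = C₁ * P ^ p + p * (P * b' * w ^ (p - 1)) + C₂ * (w ^ p * c') +
        p * (1 + l) * (w ^ p * h') + 1 * (w ^ p * d') := by ring
    _ ≤ _ := by rw [mul_add, mul_add, mul_add, mul_add]; linarith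

theorem memLp_powProfile {μ : Measure (Rn n)} [IsFiniteMeasure μ] {q : ℝ≥0∞} {u : Rn n → ℝ}
    (hu : MemLp u q μ) {k δ l : ℝ} (hk : 0 < k) (hδ : 0 < δ) (hl : 0 ≤ l) :
    MemLp (fun x => powProfile k δ l (u x)) q μ := by
  have hFc : Continuous (powProfile k δ l) :=
    continuous_iff_continuousAt.2 fun z => (hasDerivAt_powProfile hk hδ l z).continuousAt
  have h1 : MemLp (fun x => δ⁻¹ ^ (l / 2) * (‖u x‖ + k)) q μ :=
    (hu.norm.add (memLp_const k)).const_mul _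
  refine h1.mono (hFc.measurable.comp_aemeasurable hu.aemeasurable).aestronglyMeasurable
    (ae_of_all _ fun x => ?_)
  rw [Real.norm_of_nonneg (powProfile_nonneg hk hδ _), Real.norm_of_nonneg (by positivity)]
  refine (powProfile_le_linear hk hδ hl _).trans ?_
  exact mul_le_mul_of_nonneg_left (sqrt_sq_add_sq_le hk _) (by positivity)

set_option maxHeartbeats 800000 in
/-- The reverse Hölder inequality for the truncated powers. -/
theorem IsApprox.truncated_reverse_holder {f₀ : ℕ → Rn n → ℝ} {u : Rn n → ℝ} {v : Rn n → Rn n}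
    (hap : IsApprox Ω S Q p (ENNReal.ofReal (p * σ)) f₀ u v) (hΩ : IsOpen Ω) (hS : S ⊆ Ω)
    (hcl : IsCompact (closure S)) (hclΩ : closure S ⊆ Ω)
    (hvol : volume S ≠ ∞) (hvol0 : volume S ≠ 0) (hQ : MeasurableForm Q (volume.restrict Ω))
    (hp : 1 < p) (hσ : 1 < σ) (hs : 1 ≤ s) (hsσ : s ≤ σ)
    (hH : ENNReal.HolderTriple (ENNReal.ofReal (s * p)) sStar (ENNReal.ofReal p))
    {C r : ℝ} (hr : 0 < r)
    (hSob : ∀ (w : Rn n → ℝ) (v : Rn n → Rn n), MemW0 S Q p w v →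
      avgNorm w (ENNReal.ofReal (p * σ)) S ≤
        ENNReal.ofReal C * (ENNReal.ofReal r *
              avgNorm (fun x => sqrtQ (Q x) (v x)) (ENNReal.ofReal p) S
            + avgNorm w (ENNReal.ofReal p) S))
    {a ψ : ℝ} (ha : 1 < a) (hψ₀ : p ≤ ψ) (hψ₁ : ψ < p + 1 - σ⁻¹)
    {A : Rn n → ℝ → Rn n → Rn n} {B : Rn n → ℝ → Rn n → ℝ} {b c d e f g h : Rn n → ℝ}
    (hadm : AdmissibleCoefficients Ω p σ p ψ p b c d e f g h)
    (hstr : StructuralConditions Ω Q p a p ψ p b c d e f g h A B)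
    (hweak : WeakSolution Ω Q p A B u v)
    {η : Rn n → ℝ} (hη : Lip0 S η) (h01 : ∀ x, 0 ≤ η x ∧ η x ≤ 1) {M : ℝ≥0∞} (hM1 : 1 ≤ M)
    (hM : M ≠ ∞)
    (hE : ENNReal.ofReal r * avgNorm (fun x => sqrtQ (Q x) (gradient η x)) sStar S ≤ M)
    {ε ε₁ ε₂ ε₃ : ℝ} (hε : 0 < ε) (hε₁ : ε ≤ ε₁) (hε₁' : ε₁ ≤ 1) (hε₂ : ε ≤ ε₂) (hε₂' : ε₂ ≤ 1)
    (hε₃ : ε ≤ ε₃) (hε₃' : ε₃ ≤ 1)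
    {k δ l : ℝ} (hk : 0 < k) (hδ : 0 < δ) (hl : 0 ≤ l) :
    avgNorm (fun x => η x * powProfile k δ l (u x)) (ENNReal.ofReal (p * σ)) S ≤
      (7 * ENNReal.ofReal (max 1 C) * ENNReal.ofReal (energyConst a p ψ) *
          ENNReal.ofReal (1 + l) ^ 2) ^ (p / ε) *
        (M * Zbar S r p σ ψ ε₁ ε₂ ε₃ k u b c d e f g h *
          avgNorm ((tsupport η).indicator fun x => powProfile k δ l (u x))
            (ENNReal.ofReal (s * p)) S) := by
  have hp0 : 0 < p := by linarith
  have hσ0 : 0 < σ := by linarith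
  have hP1 : 1 ≤ ENNReal.ofReal p := by rw [ENNReal.one_le_ofReal]; exact hp.le
  have hmono : volume.restrict S ≤ volume.restrict Ω := Measure.restrict_mono hS le_rfl
  have hψp : 0 < p + 1 - ψ := by
    have := inv_pos.2 hσ0
    linarith
  set μ : Measure (Rn n) := (volume S)⁻¹ • volume.restrict S with hμ
  have hinv0 : (volume S)⁻¹ ≠ 0 := ENNReal.inv_ne_zero.2 hvol
  have hinv : (volume S)⁻¹ ≠ ∞ := ENNReal.inv_ne_top.2 hvol0
  -- With total mass one, `L^q` norms increase with `q`; the passage from `L^p` to `L^{sp}` then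
  -- costs no constant depending on the ball.
  have hprob : IsProbabilityMeasure μ := ⟨by
    rw [hμ, Measure.smul_apply, Measure.restrict_apply_univ, smul_eq_mul,
      ENNReal.inv_mul_cancel hvol0 hvol]⟩
  have hac : ∀ {P : Rn n → Prop}, (∀ᵐ x ∂(volume.restrict S), P x) → ∀ᵐ x ∂μ, P x :=
    fun hP => Measure.ae_smul_measure hP _
  have hfinite : IsFiniteMeasure (volume.restrict S) := ⟨by
    rwa [Measure.restrict_apply_univ, lt_top_iff_ne_top]⟩
  have htop : ∀ {F : Type} [NormedAddCommGroup F] {φ : Rn n → F} {q : ℝ≥0∞},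
      eLpNorm φ q (volume.restrict S) ≠ ∞ → eLpNorm φ q μ ≠ ∞ := by
    intro F _ φ q hφ
    rw [hμ, eLpNorm_smul_measure_of_ne_zero hinv0]
    exact ENNReal.mul_ne_top (ENNReal.rpow_ne_top_of_nonneg ENNReal.toReal_nonneg hinv) hφ
  have hnn : ∀ᵐ x ∂μ, 0 ≤ b x ∧ 0 ≤ c x ∧ 0 ≤ d x ∧ 0 ≤ e x ∧ 0 ≤ f x ∧ 0 ≤ g x ∧ 0 ≤ h x :=
    hac (ae_restrict_of_ae_restrict_of_subset hS
      ((ae_restrict_iff' hΩ.measurableSet).2 (ae_of_all _ hadm.nonneg)))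
  have hmeas : ∀ {F : Type} [MeasurableSpace F] {φ : Rn n → F},
      AEMeasurable φ (volume.restrict S) → AEMeasurable φ μ := fun hφ => hφ.smul_measure _
  have hmu := hap.meas_u.mono_measure hmono
  have hmX := hQ.mono hS _ hap.meas_v
  have hmE := hQ.mono hS _ (measurable_gradient η).aemeasurable
  obtain ⟨Kη, hKη⟩ := hη.1
  have hmη : AEMeasurable η (volume.restrict S) := hKη.continuous.measurable.aemeasurable
  have hu : MemLp u (ENNReal.ofReal (p * σ)) (volume.restrict S) :=
    ⟨hmu.aestronglyMeasurable, hap.u_mem.lt_top⟩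
  set F : Rn n → ℝ := fun x => powProfile k δ l (u x) with hF
  have hF0 : ∀ x, 0 ≤ F x := fun x => powProfile_nonneg hk hδ (u x)
  have hFp : MemLp F (ENNReal.ofReal (p * σ)) (volume.restrict S) := memLp_powProfile hu hk hδ hl
  have hmF : AEMeasurable F (volume.restrict S) := hFp.aemeasurable
  set E : Rn n → ℝ := fun x => ‖sqrtQ (Q x) (gradient η x)‖ with hEdef
  set X : Rn n → ℝ := fun x => ‖sqrtQ (Q x) (v x)‖ with hX
  set Y : Rn n → ℝ := fun x => η x * trunc k δ (u x) ^ (l / 2) * X x with hY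
  have hEtop : eLpNorm (fun x => sqrtQ (Q x) (gradient η x)) sStar (volume.restrict S) ≠ ∞ := by
    intro htop'
    rw [avgNorm_eq hvol, htop', ENNReal.mul_top (ENNReal.rpow_pos
      (pos_iff_ne_zero.2 hinv0) hinv).ne', ENNReal.mul_top
      (ENNReal.ofReal_pos.2 hr).ne', top_le_iff] at hE
    exact hM hE
  have hEtop' : eLpNorm E sStar (volume.restrict S) ≠ ∞ := by
    rw [hEdef, eLpNorm_norm]
    exact hEtop
  have hwle : ∀ x, ‖η x * F x‖ ≤ ‖F x‖ := fun x => by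
    rw [norm_mul, Real.norm_of_nonneg (h01 x).1]
    exact mul_le_of_le_one_left (norm_nonneg _) (h01 x).2
  have hwp : MemLp (fun x => η x * F x) (ENNReal.ofReal (p * σ)) (volume.restrict S) :=
    hFp.mono (hmη.mul hmF).aestronglyMeasurable (ae_of_all _ hwle)
  have hwp' : MemLp (fun x => η x * F x) (ENNReal.ofReal p) (volume.restrict S) :=
    hwp.mono_exponent (ENNReal.ofReal_le_ofReal (by nlinarith))
  have hPtop : eLpNorm (fun x => E x * F x) (ENNReal.ofReal p) (volume.restrict S) ≠ ∞ := by
    obtain ⟨C', hC', hle⟩ := exists_eLpNorm_mul_le hvol hp hs hsσ hH hmE hEtop'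
    refine ((le_of_eq ?_).trans_lt ((hle F hmF).trans_lt
      (ENNReal.mul_lt_top hC'.lt_top hFp.2))).ne
    refine congrArg (fun φ => eLpNorm φ _ _) (funext fun x => ?_)
    rw [abs_of_nonneg (hF0 x), mul_comm]
  have hYle : ∀ x, ‖Y x‖ ≤ δ⁻¹ ^ (l / 2) * ‖X x‖ := fun x => by
    have hT := Real.rpow_nonneg (trunc_pos hk hδ (u x)).le (l / 2)
    rw [hY, norm_mul, norm_mul, Real.norm_of_nonneg (h01 x).1, Real.norm_of_nonneg hT]
    gcongr
    exact (mul_le_of_le_one_left hT (h01 x).2).trans (trunc_rpow_le hk hδ hl _)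
  have hmY : AEMeasurable Y (volume.restrict S) :=
    (hmη.mul ((continuous_trunc_rpow hk hδ (l / 2)).measurable.comp_aemeasurable hmu)).mul hmX
  have hXtop : eLpNorm X (ENNReal.ofReal p) (volume.restrict S) ≠ ∞ := by
    rw [hX, eLpNorm_norm]
    exact hap.v_mem
  have hYtop : eLpNorm Y (ENNReal.ofReal p) (volume.restrict S) ≠ ∞ :=
    ((MemLp.of_le_mul (g := X) ⟨hmX.aestronglyMeasurable, hXtop.lt_top⟩
      hmY.aestronglyMeasurable (ae_of_all _ hYle)).2).ne
  -- The gradient of `η F` splits into a cutoff part `E F` and the energy density `Y`, with factor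
  -- `1 + l` from the derivative of the profile.
  have hVle : ∀ x, ‖sqrtQ (Q x) (powProfile k δ l (u x) • gradient η x +
      (η x * powProfileDeriv k δ l (u x)) • v x)‖ ≤ ‖E x * F x‖ + ‖(1 + l) * Y x‖ := fun x => by
    have hT := Real.rpow_nonneg (trunc_pos hk hδ (u x)).le (l / 2)
    rw [map_add, map_smul, map_smul]
    refine (norm_add_le _ _).trans (add_le_add (le_of_eq ?_) ?_)
    · rw [norm_smul, norm_mul, mul_comm, hEdef, norm_norm]
    · rw [norm_smul, hY, norm_mul, norm_mul, norm_mul, norm_mul, hX, norm_norm, Real.norm_of_nonneg hT,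
        Real.norm_of_nonneg (by positivity : 0 ≤ 1 + l), ← mul_assoc, mul_left_comm]
      gcongr
      exact abs_powProfileDeriv_le hk hδ hl _
  have hVnorm : ∀ {ν : Measure (Rn n)}, AEMeasurable (fun x => E x * F x) ν → AEMeasurable Y ν →
      eLpNorm (fun x => sqrtQ (Q x) (powProfile k δ l (u x) • gradient η x +
        (η x * powProfileDeriv k δ l (u x)) • v x)) (ENNReal.ofReal p) ν ≤
      eLpNorm (fun x => E x * F x) (ENNReal.ofReal p) ν +
        ENNReal.ofReal (1 + l) * eLpNorm Y (ENNReal.ofReal p) ν := by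
    intro ν h1 h2
    refine (eLpNorm_mono_real hVle).trans ((eLpNorm_add_le h1.norm.aestronglyMeasurable
      (h2.const_mul _).norm.aestronglyMeasurable hP1).trans ?_)
    rw [eLpNorm_norm, eLpNorm_norm]
    refine add_le_add le_rfl (le_of_eq ?_)
    have := eLpNorm_const_smul (1 + l) Y (ENNReal.ofReal p) ν
    rw [Real.enorm_of_nonneg (by positivity)] at this
    exact this
  set L : ℝ≥0 := ((1 + l) * δ⁻¹ ^ (l / 2)).toNNReal with hL
  have hLb : ∀ z, |powProfileDeriv k δ l z| ≤ L := by
    intro z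
    rw [hL, Real.coe_toNNReal _ (by positivity)]
    exact (abs_powProfileDeriv_le hk hδ hl z).trans
      (mul_le_mul_of_nonneg_left (trunc_rpow_le hk hδ hl z) (by positivity))
  have hmem := hap.memW0_mul_comp hΩ hS hvol hQ hp hσ hη h01
    (hap.tendsto_mul hΩ hS hvol hp hs hsσ hH hmE hEtop') (hasDerivAt_powProfile hk hδ l)
    (continuous_powProfileDeriv hk hδ l) hLb hwp'.2.ne
    ((hVnorm (hmE.mul hmF) hmY).trans_lt (ENNReal.add_lt_top.2 ⟨hPtop.lt_top,
      ENNReal.mul_lt_top ENNReal.ofReal_lt_top hYtop.lt_top⟩)).ne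
  have hsob := hSob _ _ hmem
  have hen := hap.energy_estimate hΩ hS hcl hclΩ hvol hQ hp hσ hs hsσ hH ha hψ₀ hψ₁ hadm hstr hweak
    hη h01 hEtop hk hδ hl
  have hDm : MeasurableSet (tsupport η) := (isClosed_tsupport η).measurableSet
  set G := (tsupport η).indicator F with hG
  have hmG : AEMeasurable G μ := (hmeas hmF).indicator hDm
  -- The gradient of `η` vanishes off its closed support, so the right side sees `F` only there;
  -- this lets successive cutoffs be chained.
  have hPG : (fun x => E x * F x) = fun x => E x * G x := by
    funext x
    by_cases hx : x ∈ tsupport η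
    · rw [hG, indicator_of_mem hx]
    · rw [hEdef]
      simp only [gradient_eq_zero_of_notMem_tsupport hx, map_zero, norm_zero, zero_mul]
  have hwG : ∀ x, ‖η x * F x‖ ≤ ‖G x‖ := fun x => by
    by_cases hx : x ∈ tsupport η
    · rw [hG, indicator_of_mem hx]
      exact hwle x
    · rw [image_eq_zero_of_notMem_tsupport hx, zero_mul, norm_zero]
      exact norm_nonneg _
  have hr' : ∀ t : ℝ, ENNReal.ofReal (r ^ t) = ENNReal.ofReal r ^ t := fun t =>
    (ENNReal.ofReal_rpow_of_pos hr).symm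
  have hpσ : 0 < p * σ := by positivity
  have hσ' : 0 < σ.conjExponent := by
    have : 0 < σ - 1 := by linarith
    unfold Real.conjExponent
    positivity
  have hp' : 0 < p.conjExponent := by
    have : 0 < p - 1 := by linarith
    unfold Real.conjExponent
    positivity
  have hq : ∀ {e : ℝ}, e ≤ 1 → 0 < p * σ.conjExponent / (p - e) := fun he =>
    div_pos (by positivity) (by linarith)
  -- Stated for unnamed summands, so that `rfl` reads them off the definition of `Zbar`.
  have hZ : ∀ {x₁ x₂ x₃ x₄ : ℝ≥0∞}, Zbar S r p σ ψ ε₁ ε₂ ε₃ k u b c d e f g h =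
      1 + x₁ + x₂ + x₃ + x₄ → 1 ≤ Zbar S r p σ ψ ε₁ ε₂ ε₃ k u b c d e f g h ∧
      x₁ ≤ Zbar S r p σ ψ ε₁ ε₂ ε₃ k u b c d e f g h ∧
      x₂ ≤ Zbar S r p σ ψ ε₁ ε₂ ε₃ k u b c d e f g h ∧
      x₃ ≤ Zbar S r p σ ψ ε₁ ε₂ ε₃ k u b c d e f g h ∧
      x₄ ≤ Zbar S r p σ ψ ε₁ ε₂ ε₃ k u b c d e f g h := fun hx => by
    rw [hx]
    refine ⟨?_, ?_, ?_, ?_, le_add_self⟩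
    · rw [add_assoc, add_assoc, add_assoc]; exact le_self_add
    · rw [add_assoc, add_assoc]; exact le_add_self.trans le_self_add
    · rw [add_assoc]; exact le_add_self.trans le_self_add
    · exact le_add_self.trans le_self_add
  obtain ⟨hZ₀, hZb, hZ₁, hZ₂, hZ₃⟩ := hZ rfl
  rw [hr'] at hZb hZ₁ hZ₂ hZ₃
  simp only [avgNorm, ← hμ] at hZb hZ₁ hZ₂ hZ₃ hsob hE ⊢
  have hmb := hadm.meas_b.mono_measure hmono
  have hmc := hadm.meas_c.mono_measure hmono
  have hmd := hadm.meas_d.mono_measure hmono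
  have hme := hadm.meas_e.mono_measure hmono
  have hmf := hadm.meas_f.mono_measure hmono
  have hmg := hadm.meas_g.mono_measure hmono
  have hmh := hadm.meas_h.mono_measure hmono
  have hmP : AEMeasurable (fun x => ‖E x * F x‖ₑ) μ := (hmeas (hmE.mul hmF)).enorm
  have hmw : AEMeasurable (fun x => ‖η x * F x‖ₑ) μ := (hmeas (hmη.mul hmF)).enorm
  have hmb' : AEMeasurable (fun x => ‖b x + k ^ (1 - p) * e x‖ₑ) μ :=
    (hmeas (hmb.add (hme.const_mul _))).enorm
  have hmω : AEMeasurable (fun x => √(u x ^ 2 + k ^ 2)) (volume.restrict S) :=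
    ((hmu.pow_const 2).add_const _).sqrt
  have hmc' : AEMeasurable (fun x => ‖c x ^ (p / (p + 1 - ψ)) *
      √(u x ^ 2 + k ^ 2) ^ (p * (ψ - p) / (p + 1 - ψ))‖ₑ) μ :=
    (hmeas ((hmc.pow_const _).mul (hmω.pow_const _))).enorm
  have hmh' : AEMeasurable (fun x => ‖h x + k ^ (-p) * g x‖ₑ) μ :=
    (hmeas (hmh.add (hmg.const_mul _))).enorm
  have hmd' : AEMeasurable (fun x => ‖d x + k ^ (1 - p) * f x‖ₑ) μ :=
    (hmeas (hmd.add (hmf.const_mul _))).enorm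
  have step := moser_step (μ := μ) hp hσ hε hε₁ hε₁' hε₂ hε₂' hε₃ hε₃' (Y := fun x => ‖Y x‖ₑ)
    (S := ENNReal.ofReal (max 1 C)) (K := ENNReal.ofReal (energyConst a p ψ))
    (A := ENNReal.ofReal (1 + l)) (M := M) (Z := Zbar S r p σ ψ ε₁ ε₂ ε₃ k u b c d e f g h)
    (Φ := eLpNorm G (ENNReal.ofReal (s * p)) μ) (r := ENNReal.ofReal r)
    hmP hmw hmb' hmc' hmh' hmd'
    (by rw [ENNReal.one_le_ofReal]; exact le_max_left _ _)
    (by rw [ENNReal.one_le_ofReal]; exact one_le_energyConst ha hp)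
    (by rw [ENNReal.one_le_ofReal]; linarith) hM1 hZ₀ ?_ ?_ ?_ ?_ ?_ ?_ ?_ ?_ ?_
  · rwa [← eLpNorm_ofReal_eq hpσ (fun x => η x * F x)] at step
  · rw [← eLpNorm_ofReal_eq hpσ (fun x => η x * F x), ← eLpNorm_ofReal_eq hp0 (fun x => η x * F x),
      ← eLpNorm_ofReal_eq hp0 (fun x => E x * F x), ← eLpNorm_ofReal_eq hp0 Y]
    refine hsob.trans ?_
    refine mul_le_mul' (ENNReal.ofReal_le_ofReal (le_max_right _ _)) (add_le_add ?_ le_rfl)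
    refine (mul_le_mul_right (hVnorm (hmeas (hmE.mul hmF)) (hmeas hmY)) _).trans (le_of_eq ?_)
    ring
  · have ha0 : 0 ≤ 2 * a := by linarith
    have hmwp : ∀ {φ : Rn n → ℝ≥0∞}, AEMeasurable φ μ →
        AEMeasurable (fun x => ‖η x * F x‖ₑ ^ p * φ x) μ := fun hφ => (hmw.pow_const p).mul hφ
    have hmPb : AEMeasurable (fun x => ‖E x * F x‖ₑ * ‖b x + k ^ (1 - p) * e x‖ₑ *
        ‖η x * F x‖ₑ ^ (p - 1)) μ := (hmP.mul hmb').mul (hmw.pow_const _)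
    have hen' : ∫⁻ x, ‖Y x‖ₑ ^ p ∂μ ≤ ∫⁻ x, ENNReal.ofReal (2 * a *
        energyRHS a p ψ l k η E (fun x => √(u x ^ 2 + k ^ 2)) F b c d e f g h x) ∂μ := by
      have e1 : ∀ x, ‖Y x‖ₑ ^ p = ENNReal.ofReal (2 * a) *
          ENNReal.ofReal ((2 * a)⁻¹ * (η x * trunc k δ (u x) ^ (l / 2) * X x) ^ p) := fun x => by
        have hY0 : 0 ≤ Y x := mul_nonneg (mul_nonneg (h01 x).1
          (Real.rpow_nonneg (trunc_pos hk hδ (u x)).le _)) (norm_nonneg _)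
        rw [← ENNReal.ofReal_mul ha0, mul_inv_cancel_left₀ (by linarith), Real.enorm_of_nonneg hY0,
          ENNReal.ofReal_rpow_of_nonneg hY0 hp0.le]
      simp only [e1, ENNReal.ofReal_mul ha0]
      rw [lintegral_const_mul' _ _ ENNReal.ofReal_ne_top,
        lintegral_const_mul' _ _ ENNReal.ofReal_ne_top, hμ, lintegral_smul_measure,
        lintegral_smul_measure]
      simp only [smul_eq_mul]
      gcongr
    refine hen'.trans ((lintegral_mono_ae (hnn.mono fun x hx =>
      ofReal_energyRHS_le (p := p) (ψ := ψ) (η := η) (E := E)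
        (ω := fun x => √(u x ^ 2 + k ^ 2)) (F := F) (b := b) (c := c) (d := d) (e := e) (f := f)
        (g := g) (h := h) (x := x) ha hp hl hk (h01 x).1 (norm_nonneg _) (Real.sqrt_nonneg _)
        (hF0 x) hx.1 hx.2.1 hx.2.2.1 hx.2.2.2.1 hx.2.2.2.2.1 hx.2.2.2.2.2.1
        hx.2.2.2.2.2.2)).trans (le_of_eq ?_))
    rw [lintegral_const_mul' _ _ (ENNReal.mul_ne_top ENNReal.ofReal_ne_top ENNReal.ofReal_ne_top),
      lintegral_add_right' _ (hmwp hmd'), lintegral_add_right' _ (hmwp hmh'),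
      lintegral_add_right' _ (hmwp hmc'), lintegral_add_right' _ hmPb]
  · rw [← eLpNorm_ofReal_eq hpσ (fun x => η x * F x)]
    exact htop hwp.2.ne
  · rw [← eLpNorm_ofReal_eq hp0 (fun x => E x * F x), hPG]
    have h1 : eLpNorm (fun x => E x * G x) (ENNReal.ofReal p) μ ≤
        eLpNorm G (ENNReal.ofReal (s * p)) μ * eLpNorm E sStar μ := by
      have := eLpNorm_smul_le_mul_eLpNorm (p := ENNReal.ofReal (s * p)) (q := sStar)
        (r := ENNReal.ofReal p) (hmeas hmE).aestronglyMeasurable hmG.aestronglyMeasurable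
      refine le_trans (le_of_eq ?_) this
      refine congrArg (fun φ => eLpNorm φ _ _) (funext fun x => ?_)
      rw [Pi.smul_apply', smul_eq_mul, mul_comm]
    rw [hEdef, eLpNorm_norm] at h1
    calc _ ≤ ENNReal.ofReal r * (eLpNorm G (ENNReal.ofReal (s * p)) μ *
          eLpNorm (fun x => sqrtQ (Q x) (gradient η x)) sStar μ) := by gcongr
      _ = (ENNReal.ofReal r * eLpNorm (fun x => sqrtQ (Q x) (gradient η x)) sStar μ) *
          eLpNorm G (ENNReal.ofReal (s * p)) μ := by ring
      _ ≤ _ := by gcongr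
  · rw [← eLpNorm_ofReal_eq hp0 (fun x => η x * F x)]
    refine (eLpNorm_le_eLpNorm_of_exponent_le (q := ENNReal.ofReal (s * p))
      (ENNReal.ofReal_le_ofReal (by nlinarith)) (hmeas (hmη.mul hmF)).aestronglyMeasurable).trans ?_
    exact eLpNorm_mono hwG
  · rw [← eLpNorm_ofReal_eq (by positivity) (fun x => b x + k ^ (1 - p) * e x)]
    exact hZb
  · rw [← eLpNorm_ofReal_eq (hq hε₁') (fun x => c x ^ (p / (p + 1 - ψ)) *
      √(u x ^ 2 + k ^ 2) ^ (p * (ψ - p) / (p + 1 - ψ)))]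
    -- `Zbar` contains `|u| + k` in place of `ω`. The exponent is nonnegative because `p ≤ ψ`, so `ω
    -- ≤ |u| + k` suffices.
    refine le_trans ?_ hZ₁
    refine ENNReal.rpow_le_rpow ?_ (one_div_nonneg.2 (hε.trans_le hε₁).le)
    refine mul_le_mul_right (eLpNorm_mono_ae (hnn.mono fun x hx => ?_)) _
    have hc := hx.2.1
    rw [Real.norm_of_nonneg (by positivity), Real.norm_of_nonneg (by positivity)]
    have : 0 ≤ p * (ψ - p) / (p + 1 - ψ) :=
      div_nonneg (mul_nonneg hp0.le (by linarith)) hψp.le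
    gcongr
    exact sqrt_sq_add_sq_le hk _
  · rw [← eLpNorm_ofReal_eq (hq hε₂') (fun x => h x + k ^ (-p) * g x)]
    exact hZ₂
  · rw [← eLpNorm_ofReal_eq (hq hε₃') (fun x => d x + k ^ (1 - p) * f x)]
    exact hZ₃

end ReverseHolder

/-! ### Removal of the truncation and Moser iteration. -/

section LocalBound

variable {n : ℕ} {Ω S : Set (Rn n)} {Q : Rn n → Matrix (Fin n) (Fin n) ℝ} {p σ s : ℝ}
  {sStar : ℝ≥0∞}

theorem avgNorm_indicator_rpow {D : Set (Rn n)} {ω : Rn n → ℝ} (hω : ∀ x, 0 ≤ ω x) {q α : ℝ}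
    (hq : 0 ≤ q) (hα : 0 < α) :
    avgNorm (D.indicator fun x => ω x ^ α) (ENNReal.ofReal q) S =
      avgNorm (D.indicator ω) (ENNReal.ofReal (q * α)) S ^ α := by
  rw [avgNorm, avgNorm, ENNReal.ofReal_mul hq, ← eLpNorm_norm_rpow _ hα]
  refine congrArg (fun φ => eLpNorm φ _ _) (funext fun x => ?_)
  by_cases hx : x ∈ D
  · rw [indicator_of_mem hx, indicator_of_mem hx, Real.norm_of_nonneg (hω x)]
  · rw [indicator_of_notMem hx, indicator_of_notMem hx, norm_zero, Real.zero_rpow hα.ne']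

/-- The reverse Hölder inequality for powers of the regularized solution `√(u² + k²)`. -/
theorem IsApprox.reverse_holder {f₀ : ℕ → Rn n → ℝ} {u : Rn n → ℝ} {v : Rn n → Rn n}
    (hap : IsApprox Ω S Q p (ENNReal.ofReal (p * σ)) f₀ u v) (hΩ : IsOpen Ω) (hS : S ⊆ Ω)
    (hcl : IsCompact (closure S)) (hclΩ : closure S ⊆ Ω)
    (hvol : volume S ≠ ∞) (hvol0 : volume S ≠ 0) (hQ : MeasurableForm Q (volume.restrict Ω))
    (hp : 1 < p) (hσ : 1 < σ) (hs : 1 ≤ s) (hsσ : s ≤ σ)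
    (hH : ENNReal.HolderTriple (ENNReal.ofReal (s * p)) sStar (ENNReal.ofReal p))
    {C r : ℝ} (hr : 0 < r)
    (hSob : ∀ (w : Rn n → ℝ) (v : Rn n → Rn n), MemW0 S Q p w v →
      avgNorm w (ENNReal.ofReal (p * σ)) S ≤
        ENNReal.ofReal C * (ENNReal.ofReal r *
              avgNorm (fun x => sqrtQ (Q x) (v x)) (ENNReal.ofReal p) S
            + avgNorm w (ENNReal.ofReal p) S))
    {a ψ : ℝ} (ha : 1 < a) (hψ₀ : p ≤ ψ) (hψ₁ : ψ < p + 1 - σ⁻¹)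
    {A : Rn n → ℝ → Rn n → Rn n} {B : Rn n → ℝ → Rn n → ℝ} {b c d e f g h : Rn n → ℝ}
    (hadm : AdmissibleCoefficients Ω p σ p ψ p b c d e f g h)
    (hstr : StructuralConditions Ω Q p a p ψ p b c d e f g h A B)
    (hweak : WeakSolution Ω Q p A B u v)
    {η : Rn n → ℝ} (hη : Lip0 S η) (h01 : ∀ x, 0 ≤ η x ∧ η x ≤ 1) {M : ℝ≥0∞} (hM1 : 1 ≤ M)
    (hM : M ≠ ∞)
    (hE : ENNReal.ofReal r * avgNorm (fun x => sqrtQ (Q x) (gradient η x)) sStar S ≤ M)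
    {D : Set (Rn n)} (hD : MeasurableSet D) (hone : ∀ x ∈ D, η x = 1)
    {ε ε₁ ε₂ ε₃ : ℝ} (hε : 0 < ε) (hε₁ : ε ≤ ε₁) (hε₁' : ε₁ ≤ 1) (hε₂ : ε ≤ ε₂) (hε₂' : ε₂ ≤ 1)
    (hε₃ : ε ≤ ε₃) (hε₃' : ε₃ ≤ 1) {k α : ℝ} (hk : 0 < k) (hα : 1 ≤ α) :
    avgNorm (D.indicator fun x => √(u x ^ 2 + k ^ 2)) (ENNReal.ofReal (p * σ * α)) S ≤
      ((7 * ENNReal.ofReal (max 1 C) * ENNReal.ofReal (energyConst a p ψ) *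
          ENNReal.ofReal α ^ 2) ^ (p / ε) *
        (M * Zbar S r p σ ψ ε₁ ε₂ ε₃ k u b c d e f g h)) ^ α⁻¹ *
      avgNorm ((tsupport η).indicator fun x => √(u x ^ 2 + k ^ 2)) (ENNReal.ofReal (s * p * α))
        S := by
  have hl : 0 ≤ α - 1 := by linarith
  have hα0 : 0 < α := by linarith
  have hmu : AEMeasurable u ((volume S)⁻¹ • volume.restrict S) :=
    (hap.meas_u.mono_measure (Measure.restrict_mono hS le_rfl)).smul_measure _
  have hω : ∀ x, 0 ≤ √(u x ^ 2 + k ^ 2) := fun x => Real.sqrt_nonneg _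
  have hδ : ∀ i : ℕ, (0 : ℝ) < 1 / (i + 1) := fun i => by positivity
  set κ := (7 * ENNReal.ofReal (max 1 C) * ENNReal.ofReal (energyConst a p ψ) *
    ENNReal.ofReal α ^ 2) ^ (p / ε) with hκ
  set Z := Zbar S r p σ ψ ε₁ ε₂ ε₃ k u b c d e f g h with hZ
  have hstep : ∀ i : ℕ, avgNorm (D.indicator fun x => powProfile k (1 / ((i : ℝ) + 1)) (α - 1) (u x))
      (ENNReal.ofReal (p * σ)) S ≤ κ * (M * Z * avgNorm ((tsupport η).indicator
        fun x => √(u x ^ 2 + k ^ 2) ^ α) (ENNReal.ofReal (s * p)) S) := by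
    intro i
    have h1 := hap.truncated_reverse_holder hΩ hS hcl hclΩ hvol hvol0 hQ hp hσ hs hsσ hH hr hSob ha
      hψ₀ hψ₁ hadm hstr hweak hη h01 hM1 hM hE hε hε₁ hε₁' hε₂ hε₂' hε₃ hε₃' hk (hδ i) hl
    rw [add_sub_cancel, ← hκ, ← hZ] at h1
    have hF0 : ∀ x, 0 ≤ powProfile k (1 / ((i : ℝ) + 1)) (α - 1) (u x) := fun x =>
      powProfile_nonneg hk (hδ i) _
    refine le_trans (eLpNorm_mono fun x => ?_) (h1.trans ?_)
    · by_cases hx : x ∈ D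
      · rw [indicator_of_mem hx, hone x hx, one_mul]
      · rw [indicator_of_notMem hx, norm_zero]
        exact norm_nonneg _
    · refine mul_le_mul_right (mul_le_mul_right (eLpNorm_mono fun x => ?_) _) _
      by_cases hx : x ∈ tsupport η
      · rw [indicator_of_mem hx, indicator_of_mem hx, Real.norm_of_nonneg (hF0 x),
          Real.norm_of_nonneg (Real.rpow_nonneg (hω x) _)]
        simpa using powProfile_le hk (hδ i) hl (u x)
      · rw [indicator_of_notMem hx, indicator_of_notMem hx]
  have hFc : ∀ i : ℕ, Continuous (powProfile k (1 / ((i : ℝ) + 1)) (α - 1)) := fun i =>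
    continuous_iff_continuousAt.2 fun z => (hasDerivAt_powProfile hk (hδ i) _ z).continuousAt
  -- The bound `hstep` does not depend on the truncation parameter `1 / (i + 1)`, so Fatou's lemma
  -- applies. Neither side needs to be known finite any more.
  have hlim := Lp.eLpNorm_lim_le_liminf_eLpNorm (μ := (volume S)⁻¹ • volume.restrict S)
    (p := ENNReal.ofReal (p * σ))
    (f := fun (i : ℕ) => D.indicator fun x => powProfile k (1 / ((i : ℝ) + 1)) (α - 1) (u x))
    (fun i => (((hFc i).measurable.comp_aemeasurable hmu).indicator hD).aestronglyMeasurable)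
    (D.indicator fun x => √(u x ^ 2 + k ^ 2) ^ α) (ae_of_all _ fun x => by
      by_cases hx : x ∈ D
      · simp only [indicator_of_mem hx]
        simpa using tendsto_powProfile hk (α - 1) (u x)
      · simp only [indicator_of_notMem hx]
        exact tendsto_const_nhds)
  have hle := hlim.trans ((liminf_le_liminf (Eventually.of_forall hstep)).trans_eq
    (liminf_const _))
  change avgNorm _ _ S ≤ _ at hle
  rw [avgNorm_indicator_rpow hω (by positivity) hα0,
    avgNorm_indicator_rpow hω (by positivity) hα0, ← ENNReal.le_rpow_inv_iff hα0] at hle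
  refine hle.trans (le_of_eq ?_)
  rw [← mul_assoc, ENNReal.mul_rpow_of_nonneg _ _ (by positivity), ← ENNReal.rpow_mul _ α,
    mul_inv_cancel₀ hα0.ne', ENNReal.rpow_one]

/-- The constant in the local boundedness estimate. -/
noncomputable def moserConst (p σ s a ψ ε C : ℝ) (M N : ℝ≥0∞) : ℝ≥0∞ :=
  2 * ((7 * ENNReal.ofReal (max 1 C) * ENNReal.ofReal (energyConst a p ψ)) ^ (p / ε) * M) ^
      (σ / (σ - s)) *
    ((ENNReal.ofReal (σ / s) ^ 2) ^ (p / ε) * N) ^ (∑' i : ℕ, (i : ℝ) * (σ / s)⁻¹ ^ i)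

/-- Moser iteration along a sequence of cutoff functions. -/
theorem IsApprox.eLpNorm_top_le {f₀ : ℕ → Rn n → ℝ} {u : Rn n → ℝ} {v : Rn n → Rn n}
    (hap : IsApprox Ω S Q p (ENNReal.ofReal (p * σ)) f₀ u v) (hΩ : IsOpen Ω) (hS : S ⊆ Ω)
    (hcl : IsCompact (closure S)) (hclΩ : closure S ⊆ Ω)
    (hvol : volume S ≠ ∞) (hvol0 : volume S ≠ 0) (hQ : MeasurableForm Q (volume.restrict Ω))
    (hp : 1 < p) (hσ : 1 < σ) (hs : 1 ≤ s) (hsσ : s < σ)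
    (hH : ENNReal.HolderTriple (ENNReal.ofReal (s * p)) sStar (ENNReal.ofReal p))
    {C r : ℝ} (hr : 0 < r)
    (hSob : ∀ (w : Rn n → ℝ) (v : Rn n → Rn n), MemW0 S Q p w v →
      avgNorm w (ENNReal.ofReal (p * σ)) S ≤
        ENNReal.ofReal C * (ENNReal.ofReal r *
              avgNorm (fun x => sqrtQ (Q x) (v x)) (ENNReal.ofReal p) S
            + avgNorm w (ENNReal.ofReal p) S))
    {a ψ : ℝ} (ha : 1 < a) (hψ₀ : p ≤ ψ) (hψ₁ : ψ < p + 1 - σ⁻¹)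
    {A : Rn n → ℝ → Rn n → Rn n} {B : Rn n → ℝ → Rn n → ℝ} {b c d e f g h : Rn n → ℝ}
    (hadm : AdmissibleCoefficients Ω p σ p ψ p b c d e f g h)
    (hstr : StructuralConditions Ω Q p a p ψ p b c d e f g h A B)
    (hweak : WeakSolution Ω Q p A B u v)
    {η : ℕ → Rn n → ℝ} (hη : ∀ j, Lip0 S (η j)) (h01 : ∀ j x, 0 ≤ η j x ∧ η j x ≤ 1)
    {M N : ℝ≥0∞} (hM1 : 1 ≤ M) (hM : M ≠ ∞) (hN1 : 1 ≤ N) (hN : N ≠ ∞)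
    (hE : ∀ j, ENNReal.ofReal r *
      avgNorm (fun x => sqrtQ (Q x) (gradient (η j) x)) sStar S ≤ M * N ^ j)
    (hsucc : ∀ j, ∀ x ∈ tsupport (η (j + 1)), η j x = 1)
    {T : Set (Rn n)} (hT : NullMeasurableSet T) (hTS : T ⊆ S) (hone : ∀ j, ∀ x ∈ T, η j x = 1)
    {ε ε₁ ε₂ ε₃ : ℝ} (hε : 0 < ε) (hε₁ : ε ≤ ε₁) (hε₁' : ε₁ ≤ 1) (hε₂ : ε ≤ ε₂) (hε₂' : ε₂ ≤ 1)
    (hε₃ : ε ≤ ε₃) (hε₃' : ε₃ ≤ 1) {k : ℝ} (hk : 0 < k) :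
    eLpNorm (fun x => |u x| + k) ∞ (volume.restrict T) ≤
      moserConst p σ s a ψ ε C M N *
        Zbar S r p σ ψ ε₁ ε₂ ε₃ k u b c d e f g h ^ (σ / (σ - s)) *
        avgNorm (fun x => |u x| + k) (ENNReal.ofReal (s * p)) S := by
  have hp0 : 0 < p := by linarith
  have hs0 : 0 < s := by linarith
  have hσ0 : 0 < σ := by linarith
  have hpε : 0 < p / ε := by positivity
  set χ := σ / s with hχ
  have hχ1 : 1 < χ := by rw [hχ, one_lt_div hs0]; exact hsσ
  have hχ0 : 0 < χ := by linarith
  have hχe : χ / (χ - 1) = σ / (σ - s) := by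
    have : σ - s ≠ 0 := by linarith
    rw [hχ]
    field_simp
  set ω : Rn n → ℝ := fun x => √(u x ^ 2 + k ^ 2) with hω
  set Z := Zbar S r p σ ψ ε₁ ε₂ ε₃ k u b c d e f g h with hZ
  have hZ1 : 1 ≤ Z := by
    rw [hZ, Zbar, add_assoc, add_assoc, add_assoc]
    exact le_self_add
  set κ : ℝ≥0∞ := 7 * ENNReal.ofReal (max 1 C) * ENNReal.ofReal (energyConst a p ψ) with hκ
  have hκ1 : 1 ≤ κ := by
    have h1 : 1 ≤ ENNReal.ofReal (max 1 C) := by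
      rw [ENNReal.one_le_ofReal]; exact le_max_left _ _
    have h2 : 1 ≤ ENNReal.ofReal (energyConst a p ψ) := by
      rw [ENNReal.one_le_ofReal]; exact one_le_energyConst ha hp
    calc (1 : ℝ≥0∞) = 1 * 1 * 1 := by norm_num
      _ ≤ κ := by rw [hκ]; gcongr; norm_num
  have hq : ∀ j : ℕ, 0 < s * p * χ ^ j := fun j => by positivity
  set I : ℕ → ℝ≥0∞ := fun j =>
    avgNorm ((tsupport (η j)).indicator ω) (ENNReal.ofReal (s * p * χ ^ j)) S with hI
  -- The reverse Hölder inequality with `α = χ ^ j`, cutoff `η j` and `D` the support of `η (j +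
  -- 1)`. The growth in `j` comes from `α ^ 2 = χ ^ (2 j)` and from the cutoff bound `N ^ j`.
  have hrec : ∀ j, I (j + 1) ≤ (κ ^ (p / ε) * M * ((ENNReal.ofReal χ ^ 2) ^ (p / ε) * N) ^ j * Z) ^
      (χ⁻¹ ^ j) * I j := by
    intro j
    have h1 := hap.reverse_holder hΩ hS hcl hclΩ hvol hvol0 hQ hp hσ hs hsσ.le hH hr hSob ha
      hψ₀ hψ₁ hadm hstr hweak (hη j) (h01 j) (M := M * N ^ j) (one_le_mul hM1 (one_le_pow₀ hN1))
      (ENNReal.mul_ne_top hM (ENNReal.pow_ne_top hN)) (hE j)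
      (isClosed_tsupport (η (j + 1))).measurableSet (hsucc j) hε hε₁ hε₁' hε₂ hε₂' hε₃ hε₃' hk
      (one_le_pow₀ hχ1.le : 1 ≤ χ ^ j)
    -- The exponent gained in one step is the exponent required by the next, since `χ = σ / s`.
    have e1 : p * σ * χ ^ j = s * p * χ ^ (j + 1) := by
      rw [pow_succ, hχ]
      field_simp
    rw [e1] at h1
    refine h1.trans (le_of_eq ?_)
    rw [inv_pow, ← hκ, ENNReal.ofReal_pow hχ0.le, ENNReal.mul_rpow_of_nonneg _ _ hpε.le, mul_pow,
      ← pow_mul, mul_comm j 2, pow_mul, ← ENNReal.rpow_natCast (_ ^ 2) j, ← ENNReal.rpow_mul,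
      mul_comm (j : ℝ), ENNReal.rpow_mul, ENNReal.rpow_natCast]
    congr 2
    ring
  have hbound := le_of_iterate hχ1 (one_le_mul (ENNReal.one_le_rpow hκ1 hpε) hM1)
    (one_le_mul (ENNReal.one_le_rpow (one_le_pow₀ (by
      rw [ENNReal.one_le_ofReal]; exact hχ1.le)) hpε) hN1) hZ1 hrec
  rw [hχe] at hbound
  have hI0 : I 0 ≤ avgNorm (fun x => |u x| + k) (ENNReal.ofReal (s * p)) S := by
    rw [hI]
    simp only [pow_zero, mul_one]
    refine eLpNorm_mono_real fun x => ?_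
    refine (norm_indicator_le_norm_self _ _).trans ?_
    rw [Real.norm_of_nonneg (Real.sqrt_nonneg _)]
    exact sqrt_sq_add_sq_le hk _
  have hmω : AEMeasurable ω (volume.restrict T) :=
    (((hap.meas_u.mono_measure (Measure.restrict_mono (hTS.trans hS) le_rfl)).pow_const
      2).add_const _).sqrt
  -- All cutoffs equal one on `T`, so every `I j` dominates the norm of `ω` over `T`. The weight
  -- `|S|⁻¹` is kept for this comparison and does not affect null sets.
  have hae := ae_le_of_lintegral_rpow_le (μ := (volume S)⁻¹ • volume.restrict T)
    (q := fun j => s * p * χ ^ j) (g := fun x => ‖ω x‖ₑ) hq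
    ((tendsto_pow_atTop_atTop_of_one_lt hχ1).const_mul_atTop (by positivity))
    (hmω.smul_measure _).enorm
    (fun j => by
      rw [← eLpNorm_ofReal_eq (hq j)]
      refine le_trans ?_ (hbound j)
      have h1 : eLpNorm ω (ENNReal.ofReal (s * p * χ ^ j)) ((volume S)⁻¹ • volume.restrict T) =
          eLpNorm ((tsupport (η j)).indicator ω) (ENNReal.ofReal (s * p * χ ^ j))
            ((volume S)⁻¹ • volume.restrict T) := by
        refine eLpNorm_congr_ae (Measure.ae_smul_measure ?_ _)
        filter_upwards [ae_restrict_mem₀ hT] with x hx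
        rw [indicator_of_mem (subset_tsupport _ (by
          rw [Function.mem_support, hone j x hx]; exact one_ne_zero))]
      rw [h1]
      refine eLpNorm_mono_measure _ ?_
      gcongr)
  rw [Measure.ae_ennreal_smul_measure_iff (ENNReal.inv_ne_zero.2 hvol)] at hae
  rw [eLpNorm_exponent_top]
  refine eLpNormEssSup_le_of_ae_enorm_bound ?_
  filter_upwards [hae] with x hx
  -- The source of the leading factor `2` in `moserConst`.
  have h2 : |u x| + k ≤ 2 * ω x := by
    have h3 := abs_le_sqrt_sq_add_sq k (u x)
    have h4 := le_sqrt_sq_add_sq k (u x)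
    rw [hω]
    simp only
    linarith
  calc ‖|u x| + k‖ₑ = ENNReal.ofReal (|u x| + k) := Real.enorm_of_nonneg (by positivity)
    _ ≤ ENNReal.ofReal (2 * ω x) := ENNReal.ofReal_le_ofReal h2
    _ = 2 * ‖ω x‖ₑ := by
        rw [ENNReal.ofReal_mul zero_le_two, ENNReal.ofReal_ofNat,
          Real.enorm_of_nonneg (Real.sqrt_nonneg _ : 0 ≤ ω x)]
    _ ≤ _ := mul_le_mul_right (hx.trans (mul_le_mul_right hI0 _)) 2
    _ = _ := by
        rw [moserConst, ← hκ, ← hχ]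
        ring

end LocalBound

/-! ### Exponents, finiteness of the constant and cutoff sequences. -/

section Assembly

/-- `s* > p σ'` means `s' > σ'`. If `s ≥ σ` held as well, `1/s + 1/s'` would be strictly less than
`1/σ + 1/σ' = 1`. Inverses in `ℝ≥0∞` cover the case `s' = ∞`. -/
theorem exponent_bounds {p σ s : ℝ} {sStar s' : ℝ≥0∞} (hp : 1 < p) (hσ : 1 < σ)
    (hsStar : ENNReal.ofReal (p * Real.conjExponent σ) < sStar)
    (hs' : sStar = s' * ENNReal.ofReal p) (hs : (ENNReal.ofReal s)⁻¹ + s'⁻¹ = 1) :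
    1 ≤ s ∧ s < σ ∧
      ENNReal.HolderTriple (ENNReal.ofReal (s * p)) sStar (ENNReal.ofReal p) := by
  have hp0 : 0 < p := by linarith
  have hP0 : ENNReal.ofReal p ≠ 0 := (ENNReal.ofReal_pos.2 hp0).ne'
  have h1s : 1 ≤ s := by
    have h1 : (ENNReal.ofReal s)⁻¹ ≤ 1 := hs ▸ le_self_add
    rwa [ENNReal.inv_le_one, ENNReal.one_le_ofReal] at h1
  have hconj : ENNReal.HolderConjugate (ENNReal.ofReal σ) (ENNReal.ofReal σ.conjExponent) :=
    (Real.HolderConjugate.conjExponent hσ).ennrealOfReal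
  have hσs' : ENNReal.ofReal σ.conjExponent < s' := by
    rw [hs', ENNReal.ofReal_mul hp0.le, mul_comm] at hsStar
    exact lt_of_mul_lt_mul_right' hsStar
  refine ⟨h1s, ?_, ⟨?_⟩⟩
  · by_contra! hle
    have h1 : (ENNReal.ofReal s)⁻¹ ≤ (ENNReal.ofReal σ)⁻¹ :=
      ENNReal.inv_le_inv.2 (ENNReal.ofReal_le_ofReal hle)
    have h2 : s'⁻¹ < (ENNReal.ofReal σ.conjExponent)⁻¹ := ENNReal.inv_lt_inv.2 hσs'
    have h3 := ENNReal.add_lt_add_of_le_of_lt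
      (ENNReal.inv_ne_top.2 (ENNReal.ofReal_pos.2 (by linarith : 0 < s)).ne') h1 h2
    rw [hs, hconj.inv_add_inv_eq_one] at h3
    exact h3.false
  · rw [hs', ENNReal.ofReal_mul (by linarith), ENNReal.mul_inv (Or.inr ENNReal.ofReal_ne_top)
      (Or.inr hP0), ENNReal.mul_inv (Or.inr ENNReal.ofReal_ne_top) (Or.inr hP0), ← add_mul, hs,
      one_mul]

theorem moserConst_ne_top {p σ s a ψ ε C : ℝ} {M N : ℝ≥0∞} (hp : 1 < p) (hs : 1 ≤ s)
    (hsσ : s < σ) (hε : 0 < ε) (hM : M ≠ ∞) (hN : N ≠ ∞) : moserConst p σ s a ψ ε C M N ≠ ∞ := by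
  have hpε : 0 ≤ p / ε := by positivity
  have h1 : 0 ≤ σ / (σ - s) := div_nonneg (by linarith) (by linarith)
  have h2 : 0 ≤ ∑' i : ℕ, (i : ℝ) * (σ / s)⁻¹ ^ i := tsum_nonneg fun i =>
    mul_nonneg i.cast_nonneg (pow_nonneg (inv_nonneg.2 (div_nonneg (by linarith) (by linarith))) _)
  unfold moserConst
  refine ENNReal.mul_ne_top (ENNReal.mul_ne_top ENNReal.ofNat_ne_top
    (ENNReal.rpow_ne_top_of_nonneg h1 (ENNReal.mul_ne_top
      (ENNReal.rpow_ne_top_of_nonneg hpε ?_) hM)))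
    (ENNReal.rpow_ne_top_of_nonneg h2 (ENNReal.mul_ne_top
      (ENNReal.rpow_ne_top_of_nonneg hpε (ENNReal.pow_ne_top ENNReal.ofReal_ne_top)) hN))
  exact ENNReal.mul_ne_top (ENNReal.mul_ne_top ENNReal.ofNat_ne_top ENNReal.ofReal_ne_top)
    ENNReal.ofReal_ne_top

variable {n : ℕ} {Ω : Set (Rn n)} {ρ : Rn n → Rn n → ℝ} {Q : Rn n → Matrix (Fin n) (Fin n) ℝ}
  {τ : ℝ} {sStar : ℝ≥0∞} {N C : ℝ} {y : Rn n} {r : ℝ} {η : ℕ → Rn n → ℝ}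

theorem IsCutoffSeq.lip0 (h : IsCutoffSeq Ω ρ Q τ sStar N C y r η)
    (hcl : IsCompact (closure (qball Ω ρ y r))) {j : ℕ} (hj : 1 ≤ j) :
    Lip0 (qball Ω ρ y r) (η j) := by
  have hsub : tsupport (η j) ⊆ qball Ω ρ y r := by
    rcases Nat.exists_eq_add_of_le' hj with ⟨i, rfl⟩
    rcases Nat.eq_zero_or_pos i with rfl | hi
    · exact h.supp_one
    · exact (h.supp_succ i hi).trans fun x hx => hx.1
  exact ⟨h.lipschitz j hj,
    hcl.of_isClosed_subset (isClosed_tsupport _) (hsub.trans subset_closure), hsub⟩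

/-- The maxima with `1` make both constants admissible in the iteration. Cutoffs are numbered from
`1`, and the shift to index `0` costs one more factor `N`. -/
theorem IsCutoffSeq.ofReal_mul_avgNorm_le (h : IsCutoffSeq Ω ρ Q τ sStar N C y r η) (hr : 0 < r)
    (hN : 0 < N) (j : ℕ) :
    ENNReal.ofReal r *
        avgNorm (fun x => sqrtQ (Q x) (gradient (η (j + 1)) x)) sStar (qball Ω ρ y r) ≤
      ENNReal.ofReal (max 1 C * max 1 N) * ENNReal.ofReal (max 1 N) ^ j := by
  refine (mul_le_mul_right (h.grad_le (j + 1) (Nat.le_add_left _ _)) _).trans ?_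
  rw [← ENNReal.ofReal_mul hr.le, ← ENNReal.ofReal_pow (le_max_of_le_left zero_le_one),
    ← ENNReal.ofReal_mul (by positivity), mul_div_cancel₀ _ hr.ne']
  refine ENNReal.ofReal_le_ofReal ?_
  rw [mul_assoc, ← pow_succ']
  gcongr
  · exact le_max_right _ _
  · exact le_max_right _ _

end Assembly

end DegQuasilinear

/-! ### The local boundedness theorem. -/

theorem theorem1p1 {n : ℕ} (Ω : Set (DegQuasilinear.Rn n)) (hΩ : IsOpen Ω)
    (p : ℝ) (hp : 1 < p)
    -- the quadratic form
    (Q : DegQuasilinear.Rn n → Matrix (Fin n) (Fin n) ℝ)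
    (hQ : ∀ x ∈ Ω, (Q x).PosSemidef)
    (hQloc : DegQuasilinear.LocLp (fun x => Matrix.toEuclideanCLM (𝕜 := ℝ) (Q x))
      (ENNReal.ofReal (p / 2)) Ω)
    -- the quasimetric space
    (ρ : DegQuasilinear.Rn n → DegQuasilinear.Rn n → ℝ) (κ : ℝ)
    (hρ : DegQuasilinear.IsQuasimetric Ω ρ κ)
    (hmeas : ∀ x ∈ Ω, ∀ r : ℝ, 0 < r → NullMeasurableSet (DegQuasilinear.qball Ω ρ x r))
    (hcond : DegQuasilinear.QuasiDominatesEuclid Ω ρ)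
    (r₁ : DegQuasilinear.Rn n → ℝ) (hr₁ : ∀ y ∈ Ω, 0 < r₁ y)
    (hclosure : ∀ y ∈ Ω, ∀ r : ℝ, 0 < r → r < r₁ y →
      IsCompact (closure (DegQuasilinear.qball Ω ρ y r)) ∧
        closure (DegQuasilinear.qball Ω ρ y r) ⊆ Ω)
    -- the Sobolev estimate
    (σ : ℝ) (hσ : 1 < σ)
    (hSob : ∃ C : ℝ, 0 < C ∧ DegQuasilinear.SobolevEstimate Ω ρ r₁ Q p σ C)
    -- the cutoff functions, with `s* = s' p` and `1/s + 1/s' = 1`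
    (τ : ℝ) (hτ₀ : 0 < τ) (hτ₁ : τ < 1)
    (sStar s' : ℝ≥0∞) (s : ℝ)
    (hsStar : ENNReal.ofReal (p * Real.conjExponent σ) < sStar)
    (hs' : sStar = s' * ENNReal.ofReal p)
    (hs : (ENNReal.ofReal s)⁻¹ + s'⁻¹ = 1)
    (η : DegQuasilinear.Rn n → ℝ → ℕ → DegQuasilinear.Rn n → ℝ)
    (hη : ∃ N C : ℝ, 0 < N ∧ 0 < C ∧ ∀ y ∈ Ω, ∀ r : ℝ, 0 < r → r < r₁ y →
      DegQuasilinear.IsCutoffSeq Ω ρ Q τ sStar N C y r (η y r))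
    -- the constants of the structural conditions and of the estimate
    (a ψ : ℝ) (ha : 1 < a) (hψ₀ : p ≤ ψ) (hψ₁ : ψ < p + 1 - σ⁻¹)
    (ε₁ ε₂ ε₃ : ℝ) (hε₁ : ε₁ ∈ Ioc (0 : ℝ) 1) (hε₂ : ε₂ ∈ Ioc (0 : ℝ) 1)
    (hε₃ : ε₃ ∈ Ioc (0 : ℝ) 1) :
    ∃ C : ℝ, 0 < C ∧
      ∀ (t t' : ℝ≥0∞), t⁻¹ + t'⁻¹ = 1 →
      -- qualitative integrability of the cutoff functions
      (∀ y ∈ Ω, ∀ r : ℝ, 0 < r → r < r₁ y → ∀ j : ℕ, 1 ≤ j →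
        eLpNorm (fun x => DegQuasilinear.sqrtQ (Q x) (gradient (η y r j) x))
          (t * ENNReal.ofReal p) (volume.restrict (DegQuasilinear.qball Ω ρ y r)) < ∞) →
      -- qualitative local higher integrability
      (∀ y ∈ Ω, ∀ r : ℝ, 0 < r → r < r₁ y → ∃ c₂ : ℝ, 0 < c₂ ∧
        ∀ f : DegQuasilinear.Rn n → ℝ, LocallyLipschitzOn Ω f →
          eLpNorm f (ENNReal.ofReal p * t') (volume.restrict (DegQuasilinear.qball Ω ρ y r)) ≤
            ENNReal.ofReal c₂ * DegQuasilinear.wNorm Ω Q p f) →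
      ∀ (A : DegQuasilinear.Rn n → ℝ → DegQuasilinear.Rn n → DegQuasilinear.Rn n)
        (B : DegQuasilinear.Rn n → ℝ → DegQuasilinear.Rn n → ℝ)
        (b c d e f g h : DegQuasilinear.Rn n → ℝ),
        DegQuasilinear.AdmissibleCoefficients Ω p σ p ψ p b c d e f g h →
        DegQuasilinear.StructuralConditions Ω Q p a p ψ p b c d e f g h A B →
      ∀ (u : DegQuasilinear.Rn n → ℝ) (v : DegQuasilinear.Rn n → DegQuasilinear.Rn n),
        DegQuasilinear.WeakSolution Ω Q p A B u v →
      ∀ y ∈ Ω, ∀ r : ℝ, 0 < r → r < τ * r₁ y → ∀ k : ℝ, 0 < k →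
        eLpNorm (fun x => |u x| + k) ∞
            (volume.restrict (DegQuasilinear.qball Ω ρ y (τ * r))) ≤
          ENNReal.ofReal C *
            DegQuasilinear.Zbar (DegQuasilinear.qball Ω ρ y r) r p σ ψ ε₁ ε₂ ε₃ k
              u b c d e f g h ^ (σ / (σ - s)) *
            DegQuasilinear.avgNorm (fun x => |u x| + k) (ENNReal.ofReal (s * p))
              (DegQuasilinear.qball Ω ρ y r) := by
  obtain ⟨CS, -, hSob⟩ := hSob
  obtain ⟨N, Cη, hN, -, hη⟩ := hη
  obtain ⟨hs1, hsσ, hH⟩ := DegQuasilinear.exponent_bounds hp hσ hsStar hs' hs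
  have hform := DegQuasilinear.measurableForm_of_locLp hΩ hQ hQloc
  have hε : 0 < min ε₁ (min ε₂ ε₃) := lt_min hε₁.1 (lt_min hε₂.1 hε₃.1)
  -- The smallest `εᵢ` is the common absorption exponent. `K` is fixed before `t`, `t'`, the
  -- equation, its coefficients, the solution and the ball appear.
  set K := DegQuasilinear.moserConst p σ s a ψ (min ε₁ (min ε₂ ε₃)) CS (ENNReal.ofReal (max 1 Cη * max 1 N))
    (ENNReal.ofReal (max 1 N)) with hK
  have hKtop : K ≠ ∞ := DegQuasilinear.moserConst_ne_top hp hs1 hsσ hε ENNReal.ofReal_ne_top ENNReal.ofReal_ne_top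
  refine ⟨max 1 K.toReal, lt_max_of_lt_left one_pos, ?_⟩
  intro t t' htt' ht ht' A B b c d e f g h hadm hstr u v hweak y hy r hr hrτ k hk
  have hKle : K ≤ ENNReal.ofReal (max 1 K.toReal) :=
    (ENNReal.ofReal_toReal hKtop).symm.le.trans (ENNReal.ofReal_le_ofReal (le_max_right _ _))
  have hTS : DegQuasilinear.qball Ω ρ y (τ * r) ⊆ DegQuasilinear.qball Ω ρ y r := fun x hx =>
    ⟨hx.1, hx.2.trans_le (mul_le_of_le_one_left hr.le hτ₁.le)⟩
  -- On a null ball normalized norms carry no information, but the left side is zero.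
  by_cases hvol0 : volume (DegQuasilinear.qball Ω ρ y r) = 0
  · rw [Measure.restrict_eq_zero.2 (measure_mono_null hTS hvol0), eLpNorm_measure_zero]
    exact zero_le
  have hrr : r < r₁ y := hrτ.trans_le (mul_le_of_le_one_left (hr₁ y hy).le hτ₁.le)
  -- The restriction `r < τ r₁(y)` admits the ball of radius `r / τ`, whose first cutoff equals one
  -- on the ball of radius `r`.
  have hR : 0 < r / τ := div_pos hr hτ₀
  have hRr : r / τ < r₁ y := by rwa [div_lt_iff₀ hτ₀, mul_comm]
  have hSR : DegQuasilinear.qball Ω ρ y r ⊆ DegQuasilinear.qball Ω ρ y (r / τ) := fun x hx =>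
    ⟨hx.1, hx.2.trans_le (le_div_self hr.le hτ₀ hτ₁.le)⟩
  have hfin : ∀ r', 0 < r' → r' < r₁ y → volume (DegQuasilinear.qball Ω ρ y r') ≠ ∞ := fun r' h1 h2 =>
    ((measure_mono subset_closure).trans_lt (hclosure y hy r' h1 h2).1.measure_lt_top).ne
  have hsub : ∀ r', DegQuasilinear.qball Ω ρ y r' ⊆ Ω := fun r' x hx => hx.1
  have hcR := hη y hy _ hR hRr
  have hcr := hη y hy r hr hrr
  obtain ⟨c₂, -, hc₂⟩ := ht' y hy _ hR hRr
  -- `C'` depends on the qualitative data, but only its finiteness is used: it yields approximants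
  -- converging in `L^{pσ}` and does not enter `K`.
  obtain ⟨C', hC', hloc⟩ := DegQuasilinear.eLpNorm_le_of_sobolev hΩ (hsub _) hSR (hfin _ hR hRr) hform hp
    (hmeas y hy r hr) (hSob y hy _ hR hRr) (hcR.lip0 (hclosure y hy _ hR hRr).1 le_rfl)
    (hcR.range 1 le_rfl) (fun x hx => (hcR.eq_one 1 le_rfl (by
      rwa [mul_div_cancel₀ _ hτ₀.ne'])).2) htt' (ht y hy _ hR hRr 1 le_rfl) hc₂
  obtain ⟨f₀, hap⟩ := hweak.1.exists_approx hΩ (hsub r) hform hp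
    (by rw [ENNReal.one_le_ofReal]; nlinarith) hC' hloc
  have hj : ∀ j : ℕ, 1 ≤ j + 1 := fun j => Nat.le_add_left _ _
  refine (hap.eLpNorm_top_le hΩ (hsub r) (hclosure y hy r hr hrr).1 (hclosure y hy r hr hrr).2
    (hfin r hr hrr) hvol0 hform hp hσ hs1 hsσ hH hr (hSob y hy r hr hrr) ha hψ₀ hψ₁ hadm hstr hweak
    (η := fun j => η y r (j + 1)) (fun j => hcr.lip0 (hclosure y hy r hr hrr).1 (hj j))
    (fun j => hcr.range _ (hj j))
    (by rw [ENNReal.one_le_ofReal]; exact one_le_mul_of_one_le_of_one_le (le_max_left _ _)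
          (le_max_left _ _)) ENNReal.ofReal_ne_top
    (by rw [ENNReal.one_le_ofReal]; exact le_max_left _ _) ENNReal.ofReal_ne_top
    (hcr.ofReal_mul_avgNorm_le hr hN) (fun j x hx => (hcr.supp_succ _ (hj j) hx).2)
    (hmeas y hy _ (mul_pos hτ₀ hr)) hTS (fun j x hx => (hcr.eq_one _ (hj j) hx).2) hε
    (min_le_left _ _) hε₁.2 ((min_le_right _ _).trans (min_le_left _ _)) hε₂.2
    ((min_le_right _ _).trans (min_le_right _ _)) hε₃.2 hk).trans ?_
  rw [← hK]
  gcongr
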